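/- **DiPGauss programs.** Let $\mathcal X$ (finite-domain variables) and $\mathcal R$ (real variables) be disjoint countably infinite sets of variables. A DiPGauss program $\mathsf P=(\mathcal I,\mathcal O,S)$ comes with a finite domain $\mathsf{DOM}\subseteq\mathbb Q$ and consists of disjoint finite sets $\mathcal I,\mathcal O\subseteq\mathcal X$ of input and output variables and a statement $S$ of the loop-free grammar $$R ::= r \mid qR \mid R+R \mid R+q,\qquad B ::= R\sim R \mid R\sim x \mid x\sim x,$$ $$S ::= x\gets d \mid r\gets \mathcal N(x,\tfrac a\epsilon) \mid r\gets \mathrm{Lap}(x,\tfrac a\epsilon) \mid r\gets R \mid \textsf{if } B \textsf{ then } S \textsf{ else } S \mid \textsf{skip}\mid S;S,$$ where $r\in\mathcal R$, $x\in\mathcal X$, $q\in\mathbb Q$, $d\in\mathsf{DOM}$, $a\in\mathbb Q^{>0}$ and $\sim\,\in\{=,\le,<,\ge,>,\ne\}$. Here $\mathcal N(\mu,\sigma)$ is the Gaussian with mean $\mu$ and standard deviation $\sigma$, and $\mathrm{Lap}(\mu,b)$ is the Laplace distribution with density $\frac1{2b}e^{-|t-\mu|/b}$. Along every control path, each real variable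 is assigned at most once, and every reference to a non-input variable is preceded by an assignment to it. **Semantics.** Fix $\epsilon>0$ rational. An input is a map $u\in\mathcal U=\mathsf{DOM}^{\mathcal I}$ and an output is a map $o\in\mathcal V=\mathsf{DOM}^{\mathcal O}$. A state is a triple $(\alpha,\beta,G)$: $\alpha$ is a partial map giving the values of finite-domain variables, $\beta$ is a partial map recording for each assigned real variable either the distribution (with its parameters) it was sampled from or the expression assigned to it, in which every variable that has itself been assigned an expression is replaced by the recorded expression, and $G$ is a set of Boolean expressions. Execution starts with $\alpha=u$, $\beta$ and $G$ empty; assignments and samplings update $\alpha$ and $\beta$, and a conditional on $B$ executes the first branch with $B$ added to $G$ and the second branch with the flipped comparison $\neg B$ added to $G$. This gives a finite set of final states. The probability of a final state $(\alpha,\beta,G)$ is $0$ if some comparison between finite-domain variables in $G$ is false under $\alpha$; otherwise it is the probability that all other comparisons in $G$ hold when finite-domain variables take their values under $\alpha$, the sampled real variables are independent random variables with the distributions recorded in $\beta$, and the other real variables have the values of their recorded expressions. $\Pr(\epsilon,u,o,\mathsf P)$ is the sum of the probabilities of the final states with $\alpha(y)=o(y)$ for all $y\in\mathcal O$. **Differential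 privacy.** For $\Phi\subseteq\mathcal U\times\mathcal U$, $\mathsf P$ with privacy parameter $\epsilon$ is $(\epsilon_{\mathsf{prv}},\delta)$-differentially private with respect to $\Phi$ if for all $(u,u')\in\Phi$ and $F\subseteq\mathcal V$, $$\sum_{o\in F}\Pr(\epsilon,u,o,\mathsf P)\le e^{\epsilon_{\mathsf{prv}}}\sum_{o\in F}\Pr(\epsilon,u',o,\mathsf P)+\delta .$$ The set of critical error parameters is $$\mathrm{Crit}(\mathsf P,\epsilon,\epsilon_{\mathsf{prv}},\Phi)=\Big\{\textstyle\sum_{o\in\mathcal V}\max\big(\Pr(\epsilon,u,o,\mathsf P)-e^{\epsilon_{\mathsf{prv}}}\Pr(\epsilon,u',o,\mathsf P),\,0\big)\;:\;(u,u')\in\Phi\Big\}.$$ An instance of the differential privacy problem is a tuple $(\mathsf P,\Phi,\epsilon,\epsilon_{\mathsf{prv}},\delta)$ of a DiPGauss program $\mathsf P$ (with its domain), a relation $\Phi\subseteq\mathcal U\times\mathcal U$, and rational numbers $\epsilon>0$, $\epsilon_{\mathsf{prv}}>0$, $\delta\in[0,1]$, presented by a standard injective Gödel number. **Theorem.** 1.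 The set of instances $(\mathsf P,\Phi,\epsilon,\epsilon_{\mathsf{prv}},\delta)$ such that $\mathsf P$ with privacy parameter $\epsilon$ is *not* $(\epsilon_{\mathsf{prv}},\delta)$-differentially private with respect to $\Phi$ is recursively enumerable. 2. Every set $\mathrm{Crit}(\mathsf P,\epsilon,\epsilon_{\mathsf{prv}},\Phi)$ is finite, and checking $(\epsilon_{\mathsf{prv}},\delta)$-differential privacy is decidable for all $\delta$ outside it: there is a single algorithm (a partial computable function from instances to truth values) that, on every instance, answers correctly whether $\mathsf P$ is $(\epsilon_{\mathsf{prv}},\delta)$-differentially private with respect to $\Phi$ whenever it halts, and that halts on every instance with $\delta\notin\mathrm{Crit}(\mathsf P,\epsilon,\epsilon_{\mathsf{prv}},\Phi)$. -/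

import Mathlib

open MeasureTheory ProbabilityTheory

namespace DiPGauss

/-! ## Expressions and statements

Real random variables and finite-domain variables are two disjoint sorts of variables, both named
by natural numbers. -/

/-- Positive rational numbers. -/
abbrev PosRat : Type := {q : ℚ // 0 < q}

/-- The comparison symbols `=, ≤, <, ≥, >, ≠`. -/
inductive Cmp : Type
  | eq | le | lt | ge | gt | ne
  deriving DecidableEq

/-- The relation on the reals denoted by a comparison symbol. -/
def Cmp.Holds : Cmp → ℝ → ℝ → Prop
  | .eq, a, b => a = b
  | .le, a, b => a ≤ b
  | .lt, a, b => a < b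
  | .ge, a, b => a ≥ b
  | .gt, a, b => a > b
  | .ne, a, b => a ≠ b

/-- The flipped comparison. -/
def Cmp.neg : Cmp → Cmp
  | .eq => .ne
  | .le => .gt
  | .lt => .ge
  | .ge => .lt
  | .gt => .le
  | .ne => .eq

/-- Real expressions `R ::= r | q R | R + R | R + q`. -/
inductive RExp : Type
  | var (r : ℕ)
  | smul (q : ℚ) (R : RExp)
  | add (R₁ R₂ : RExp)
  | addConst (R : RExp) (q : ℚ)
  deriving DecidableEq

/-- Boolean expressions `B ::= R ~ R | R ~ x | x ~ x`. -/
inductive BExp : Type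
  | realReal (R₁ : RExp) (c : Cmp) (R₂ : RExp)
  | realDom (R : RExp) (c : Cmp) (x : ℕ)
  | domDom (x : ℕ) (c : Cmp) (y : ℕ)
  deriving DecidableEq

/-- The two families of distributions. -/
inductive Family : Type
  | gaussian | laplace
  deriving DecidableEq

/-- Program statements. `sample k r x a` is `r ← Gauss(x, a/ε)` when `k = gaussian` and
`r ← Lap(x, a/ε)` when `k = laplace`. -/
inductive Stmt : Type
  | assignDom (x : ℕ) (d : ℚ)
  | sample (k : Family) (r x : ℕ) (a : PosRat)
  | assignReal (r : ℕ) (R : RExp)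
  | ite (B : BExp) (S₁ S₂ : Stmt)
  | skip
  | seq (S₁ S₂ : Stmt)
  deriving DecidableEq

/-- The value of a real expression under a valuation of the real variables. -/
def RExp.eval (v : ℕ → ℝ) : RExp → ℝ
  | .var r => v r
  | .smul q R => (q : ℝ) * R.eval v
  | .add R₁ R₂ => R₁.eval v + R₂.eval v
  | .addConst R q => R.eval v + (q : ℝ)

/-- Negation of a Boolean expression, by flipping the comparison. -/
def BExp.neg : BExp → BExp
  | .realReal R₁ c R₂ => .realReal R₁ c.neg R₂
  | .realDom R c x => .realDom R c.neg x
  | .domDom x c y => .domDom x c.neg y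

/-! ## Well-formed programs -/

/-- Reads and writes of variables. -/
inductive Access : Type
  | readDom (x : ℕ) | writeDom (x : ℕ) | readReal (r : ℕ) | writeReal (r : ℕ)
  deriving DecidableEq

/-- The variables occurring in a real expression. -/
def RExp.vars : RExp → List ℕ
  | .var r => [r]
  | .smul _ R => R.vars
  | .add R₁ R₂ => R₁.vars ++ R₂.vars
  | .addConst R _ => R.vars

/-- The reads made by a Boolean expression. -/
def BExp.reads : BExp → List Access
  | .realReal R₁ _ R₂ => (R₁.vars ++ R₂.vars).map .readReal
  | .realDom R _ x => R.vars.map .readReal ++ [.readDom x]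
  | .domDom x _ y => [.readDom x, .readDom y]

/-- The control paths of a statement, each given by its sequence of variable accesses. -/
def Stmt.paths : Stmt → List (List Access)
  | .assignDom x _ => [[.writeDom x]]
  | .sample _ r x _ => [[.readDom x, .writeReal r]]
  | .assignReal r R => [R.vars.map .readReal ++ [.writeReal r]]
  | .ite B S₁ S₂ => (S₁.paths ++ S₂.paths).map (B.reads ++ ·)
  | .skip => [[]]
  | .seq S₁ S₂ => S₁.paths.flatMap fun p => S₂.paths.map fun q => p ++ q

/-- The constants assigned to finite-domain variables. -/
def Stmt.consts : Stmt → List ℚ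
  | .assignDom _ d => [d]
  | .sample _ _ _ _ => []
  | .assignReal _ _ => []
  | .ite _ S₁ S₂ => S₁.consts ++ S₂.consts
  | .skip => []
  | .seq S₁ S₂ => S₁.consts ++ S₂.consts

/-- A program: a finite domain `dom` of rationals, disjoint finite sets of input and output
variables, and a statement such that
* the constants assigned to finite-domain variables belong to `dom`;
* along every control path each real variable is assigned at most once;
* along every control path each reference to a non-input variable is preceded by an assignment to
  that variable. -/
structure Program : Type where
  dom : Finset ℚ
  inputs : Finset ℕ
  outputs : Finset ℕ
  body : Stmt
  disjoint : Disjoint inputs outputs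
  consts_mem : ∀ d ∈ body.consts, d ∈ dom
  assign_once : ∀ p ∈ body.paths, ∀ r : ℕ, p.count (.writeReal r) ≤ 1
  dom_defined : ∀ p ∈ body.paths, ∀ (l l' : List Access) (x : ℕ),
    p = l ++ .readDom x :: l' → x ∈ inputs ∨ .writeDom x ∈ l
  real_defined : ∀ p ∈ body.paths, ∀ (l l' : List Access) (r : ℕ),
    p = l ++ .readReal r :: l' → .writeReal r ∈ l

/-- Input valuations. -/
abbrev Program.Input (P : Program) : Type := {x // x ∈ P.inputs} → {d // d ∈ P.dom}

/-- Output valuations. -/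
abbrev Program.Output (P : Program) : Type := {x // x ∈ P.outputs} → {d // d ∈ P.dom}

/-! ## Distributions -/

/-- A family, a mean and a positive scale (the standard deviation of a Gaussian, the scaling
parameter of a Laplace distribution). -/
structure Distr : Type where
  family : Family
  mean : ℚ
  scale : PosRat
  deriving DecidableEq

/-- The density `exp (-|x - μ| / b) / (2 b)` of the Laplace distribution. -/
noncomputable def laplaceDensity (μ b x : ℝ) : ℝ := 1 / (2 * b) * Real.exp (-|x - μ| / b)

/-- The Laplace distribution with mean `μ` and scaling parameter `b`. -/
noncomputable def laplaceReal (μ b : ℝ) : Measure ℝ :=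
  volume.withDensity fun x => ENNReal.ofReal (laplaceDensity μ b x)

theorem isProbabilityMeasure_laplaceReal (μ : ℝ) {b : ℝ} (hb : 0 < b) :
    IsProbabilityMeasure (laplaceReal μ b) := by
  have h1 : IntegrableOn (fun x : ℝ => Real.exp (-|x| / b)) (Set.Ioi 0) := by
    refine (integrableOn_exp_mul_Ioi (a := -(1 / b)) (by simpa using hb) 0).congr_fun ?_
      measurableSet_Ioi
    intro x hx
    simp only [abs_of_pos (Set.mem_Ioi.1 hx)]
    congr 1
    ring
  have h2 : Integrable (fun x : ℝ => Real.exp (-|x| / b)) := by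
    have h1' : IntegrableOn (fun x : ℝ => Real.exp (-|x| / b)) (Set.Iic 0) := by
      have h0 : IntegrableOn (fun x : ℝ => Real.exp (-|x| / b)) (Set.Ici (-0)) := by
        rw [neg_zero, integrableOn_Ici_iff_integrableOn_Ioi]
        exact h1
      simpa using h0.comp_neg_Iic
    rw [← integrableOn_univ, ← Set.Iic_union_Ioi (a := (0 : ℝ))]
    exact h1'.union h1
  have h3 : ∫ x : ℝ, Real.exp (-|x| / b) = 2 * b := by
    rw [integral_comp_abs (f := fun x => Real.exp (-x / b))]
    have : ∀ x : ℝ, Real.exp (-x / b) = Real.exp (-(1 / b) * x) := by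
      intro x
      congr 1
      ring
    simp only [this]
    rw [integral_exp_mul_Ioi (by simpa using hb) 0]
    simp
  have h4 : Integrable (laplaceDensity μ b) := (h2.comp_sub_right μ).const_mul _
  constructor
  rw [laplaceReal, withDensity_apply _ MeasurableSet.univ, Measure.restrict_univ,
    ← ofReal_integral_eq_lintegral_ofReal h4
      (Filter.Eventually.of_forall fun x => by unfold laplaceDensity; positivity)]
  have h5 : ∫ x, laplaceDensity μ b x = 1 := by
    unfold laplaceDensity
    rw [integral_const_mul, integral_sub_right_eq_self (fun x : ℝ => Real.exp (-|x| / b)) μ, h3]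
    field_simp
  rw [h5, ENNReal.ofReal_one]

/-- The law with the given family, mean and scale. -/
noncomputable def Distr.law (D : Distr) : Measure ℝ :=
  match D.family with
  | .gaussian => gaussianReal (D.mean : ℝ) (Real.toNNReal ((D.scale.1 : ℝ) ^ 2))
  | .laplace => laplaceReal (D.mean : ℝ) (D.scale.1 : ℝ)

instance (D : Distr) : IsProbabilityMeasure D.law := by
  obtain ⟨f, m, s⟩ := D
  cases f
  · exact inferInstanceAs (IsProbabilityMeasure (gaussianReal _ _))
  · exact isProbabilityMeasure_laplaceReal _ (by exact_mod_cast s.2)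

/-! ## States and final states -/

/-- A state `(α, β, G)`: the values of the finite-domain variables, the distributions or expressions
recorded for the real variables, and the set of conditions collected so far. -/
@[ext] structure State : Type where
  α : ℕ → Option ℚ
  β : ℕ → Option (Distr ⊕ RExp)
  G : Set BExp

/-- Replace every dependent variable by the expression recorded for it. -/
def RExp.subst (β : ℕ → Option (Distr ⊕ RExp)) : RExp → RExp
  | .var r => match β r with
    | some (.inr R) => R
    | _ => .var r
  | .smul q R => .smul q (R.subst β)
  | .add R₁ R₂ => .add (R₁.subst β) (R₂.subst β)
  | .addConst R q => .addConst (R.subst β) q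

/-- The value of a finite-domain variable. The default is never used for a variable that has been
assigned. -/
def State.domVal (τ : State) (x : ℕ) : ℚ := (τ.α x).getD 0

/-- The final states reached from a state when the privacy parameter is `ε`. -/
noncomputable def Stmt.finals (ε : PosRat) : Stmt → State → Finset State
  | .assignDom x d, τ => {⟨Function.update τ.α x (some d), τ.β, τ.G⟩}
  | .sample k r x a, τ =>
      {⟨τ.α, Function.update τ.β r
          (some (.inl ⟨k, τ.domVal x, ⟨a.1 / ε.1, div_pos a.2 ε.2⟩⟩)), τ.G⟩}
  | .assignReal r R, τ => {⟨τ.α, Function.update τ.β r (some (.inr (R.subst τ.β))), τ.G⟩}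
  | .ite B S₁ S₂, τ =>
      open Classical in
      S₁.finals ε ⟨τ.α, τ.β, insert B τ.G⟩ ∪ S₂.finals ε ⟨τ.α, τ.β, insert B.neg τ.G⟩
  | .skip, τ => {τ}
  | .seq S₁ S₂, τ => open Classical in (S₁.finals ε τ).biUnion fun τ' => S₂.finals ε τ'

/-- The initial state on input `u`. -/
def Program.init (P : Program) (u : P.Input) : State where
  α := fun x => if h : x ∈ P.inputs then some (u ⟨x, h⟩).1 else none
  β := fun _ => none
  G := ∅

/-- The final states on input `u` with output `o`. -/
noncomputable def Program.run (P : Program) (ε : PosRat) (u : P.Input) (o : P.Output) :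
    Finset State :=
  open Classical in
  (P.body.finals ε (P.init u)).filter fun τ => ∀ y : {y // y ∈ P.outputs}, τ.α y = some (o y).1

/-! ## Probabilities -/

/-- The joint law of the family of independent random variables `X r`, where `r` ranges over the
independent variables of the state. The other coordinates are irrelevant and are set to `0`. -/
noncomputable def State.law (τ : State) : Measure (ℕ → ℝ) :=
  Measure.infinitePi fun r => match τ.β r with
    | some (.inl D) => D.law
    | _ => Measure.dirac 0

/-- The value of the real variable `r` when the independent random variables take the values `ω`. -/
def State.rand (τ : State) (ω : ℕ → ℝ) (r : ℕ) : ℝ :=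
  match τ.β r with
  | some (.inl _) => ω r
  | some (.inr R) => R.eval ω
  | none => 0

/-- All the collected conditions that compare two finite-domain variables hold. -/
def State.EvalConst (τ : State) : Prop :=
  ∀ (x : ℕ) (c : Cmp) (y : ℕ), BExp.domDom x c y ∈ τ.G →
    c.Holds (τ.domVal x : ℝ) (τ.domVal y : ℝ)

/-- All the collected conditions that involve real variables hold when the independent random
variables take the values `ω`. -/
def State.EvalRand (τ : State) (ω : ℕ → ℝ) : Prop :=
  (∀ (R : RExp) (c : Cmp) (R' : RExp), BExp.realReal R c R' ∈ τ.G →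
    c.Holds (R.eval (τ.rand ω)) (R'.eval (τ.rand ω))) ∧
  (∀ (R : RExp) (c : Cmp) (x : ℕ), BExp.realDom R c x ∈ τ.G →
    c.Holds (R.eval (τ.rand ω)) (τ.domVal x : ℝ))

/-- The probability of a state. -/
noncomputable def State.prob (τ : State) : ℝ :=
  open Classical in if τ.EvalConst then τ.law.real {ω | τ.EvalRand ω} else 0

/-- The probability that `P` with privacy parameter `ε` outputs `o` on input `u`. -/
noncomputable def Program.prob (P : Program) (ε : PosRat) (u : P.Input) (o : P.Output) : ℝ :=
  ∑ τ ∈ P.run ε u o, τ.prob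

/-! ## Differential privacy -/

/-- `P` with privacy parameter `ε` is `(εprv, δ)`-differentially private with respect to `Φ`. -/
def Program.IsDP (P : Program) (Φ : Finset (P.Input × P.Input)) (ε : PosRat) (εprv δ : ℝ) : Prop :=
  ∀ (F : Finset P.Output) (u u' : P.Input), (u, u') ∈ Φ →
    ∑ o ∈ F, P.prob ε u o ≤ Real.exp εprv * ∑ o ∈ F, P.prob ε u' o + δ

/-- `δ_{u,u'} = ∑ₒ max (Pr(ε,u,o,P) - exp(εprv) Pr(ε,u',o,P)) 0`. -/
noncomputable def Program.deltaAdj (P : Program) (ε : PosRat) (εprv : ℝ) (u u' : P.Input) : ℝ :=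
  ∑ o : P.Output, max (P.prob ε u o - Real.exp εprv * P.prob ε u' o) 0

/-- The set of critical error parameters. -/
def Program.crit (P : Program) (ε : PosRat) (εprv : ℝ) (Φ : Finset (P.Input × P.Input)) : Set ℝ :=
  {δ | ∃ u u' : P.Input, (u, u') ∈ Φ ∧ δ = P.deltaAdj ε εprv u u'}

/-- An instance of the differential privacy problem. -/
structure Problem : Type where
  prog : Program
  adj : Finset (prog.Input × prog.Input)
  ε : PosRat
  εprv : PosRat
  δ : ℚ
  δ_nonneg : 0 ≤ δ
  δ_le_one : δ ≤ 1

/-- The question asked by an instance of the differential privacy problem. -/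
def Problem.IsDP (x : Problem) : Prop := x.prog.IsDP x.adj x.ε (x.εprv.1 : ℝ) (x.δ : ℝ)

/-- The critical error parameters of an instance. -/
def Problem.crit (x : Problem) : Set ℝ := x.prog.crit x.ε (x.εprv.1 : ℝ) x.adj

/-! ## Codes

Instances are presented to algorithms through explicit Gödel numbers: constructors are tagged, tuples
are coded with the pairing function `Nat.pair`, a rational by its numerator and denominator, and
a finite set by the increasing list of the codes of its elements. -/

/-- The code of a rational number. -/
def ratCode (q : ℚ) : ℕ := Nat.pair (Encodable.encode q.num) q.den

/-- The code of a finite set of natural numbers. -/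
def setCode (s : Finset ℕ) : ℕ := Encodable.encode (s.sort (· ≤ ·))

def Cmp.code : Cmp → ℕ
  | .eq => 0
  | .le => 1
  | .lt => 2
  | .ge => 3
  | .gt => 4
  | .ne => 5

def RExp.code : RExp → ℕ
  | .var r => Nat.pair 0 r
  | .smul q R => Nat.pair 1 (Nat.pair (ratCode q) R.code)
  | .add R₁ R₂ => Nat.pair 2 (Nat.pair R₁.code R₂.code)
  | .addConst R q => Nat.pair 3 (Nat.pair R.code (ratCode q))

def BExp.code : BExp → ℕ
  | .realReal R₁ c R₂ => Nat.pair 0 (Nat.pair R₁.code (Nat.pair c.code R₂.code))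
  | .realDom R c x => Nat.pair 1 (Nat.pair R.code (Nat.pair c.code x))
  | .domDom x c y => Nat.pair 2 (Nat.pair x (Nat.pair c.code y))

def Family.code : Family → ℕ
  | .gaussian => 0
  | .laplace => 1

def Stmt.code : Stmt → ℕ
  | .assignDom x d => Nat.pair 0 (Nat.pair x (ratCode d))
  | .sample k r x a => Nat.pair 1 (Nat.pair k.code (Nat.pair r (Nat.pair x (ratCode a.1))))
  | .assignReal r R => Nat.pair 2 (Nat.pair r R.code)
  | .ite B S₁ S₂ => Nat.pair 3 (Nat.pair B.code (Nat.pair S₁.code S₂.code))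
  | .skip => Nat.pair 4 0
  | .seq S₁ S₂ => Nat.pair 5 (Nat.pair S₁.code S₂.code)

def Program.code (P : Program) : ℕ :=
  Nat.pair (setCode (P.dom.image ratCode))
    (Nat.pair (setCode P.inputs) (Nat.pair (setCode P.outputs) P.body.code))

/-- An input valuation is coded as its graph. -/
def Program.inputCode (P : Program) (u : P.Input) : ℕ :=
  setCode (P.inputs.attach.image fun x => Nat.pair x.1 (ratCode (u x).1))

/-- The code of an instance of the differential privacy problem. -/
def Problem.code (x : Problem) : ℕ :=
  Nat.pair x.prog.code (Nat.pair
    (setCode (x.adj.image fun p => Nat.pair (x.prog.inputCode p.1) (x.prog.inputCode p.2)))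
    (Nat.pair (ratCode x.ε.1) (Nat.pair (ratCode x.εprv.1) (ratCode x.δ))))

/-! Distinct instances have distinct codes. -/

theorem ratCode_injective : Function.Injective ratCode := by
  intro p q h
  obtain ⟨h1, h2⟩ := Nat.pair_eq_pair.1 h
  exact Rat.ext (Encodable.encode_injective h1) h2

theorem setCode_injective : Function.Injective setCode := by
  intro s t h
  have := congrArg List.toFinset (Encodable.encode_injective h)
  simpa using this

theorem Cmp.code_injective : Function.Injective Cmp.code := by
  intro a b h
  cases a <;> cases b <;> simp_all [Cmp.code]

theorem RExp.code_injective : Function.Injective RExp.code := by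
  intro R
  induction R with
  | var r => intro R' h; cases R' <;> simp_all [RExp.code, Nat.pair_eq_pair]
  | smul q R ih =>
    intro R' h
    cases R' <;> simp_all [RExp.code, Nat.pair_eq_pair]
    exact ⟨ratCode_injective h.1, ih rfl⟩
  | add R₁ R₂ ih₁ ih₂ =>
    intro R' h
    cases R' <;> simp_all [RExp.code, Nat.pair_eq_pair]
    exact ⟨ih₁ rfl, ih₂ rfl⟩
  | addConst R q ih =>
    intro R' h
    cases R' <;> simp_all [RExp.code, Nat.pair_eq_pair]
    exact ⟨ih rfl, ratCode_injective h.2⟩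

theorem BExp.code_injective : Function.Injective BExp.code := by
  intro B B' h
  cases B <;> cases B' <;> simp_all [BExp.code, Nat.pair_eq_pair]
  · exact ⟨RExp.code_injective h.1, Cmp.code_injective h.2.1, RExp.code_injective h.2.2⟩
  · exact ⟨RExp.code_injective h.1, Cmp.code_injective h.2.1⟩
  · exact Cmp.code_injective h.2.1

theorem Family.code_injective : Function.Injective Family.code := by
  intro a b h
  cases a <;> cases b <;> simp_all [Family.code]

theorem Stmt.code_injective : Function.Injective Stmt.code := by
  intro S
  induction S with
  | assignDom x d =>
    intro S' h
    cases S' <;> simp_all [Stmt.code, Nat.pair_eq_pair]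
    exact ratCode_injective h.2
  | sample k r x a =>
    intro S' h
    cases S' <;> simp_all [Stmt.code, Nat.pair_eq_pair]
    exact ⟨Family.code_injective h.1, Subtype.ext (ratCode_injective h.2.2.2)⟩
  | assignReal r R =>
    intro S' h
    cases S' <;> simp_all [Stmt.code, Nat.pair_eq_pair]
    exact RExp.code_injective h.2
  | ite B S₁ S₂ ih₁ ih₂ =>
    intro S' h
    cases S' <;> simp_all [Stmt.code, Nat.pair_eq_pair]
    exact ⟨BExp.code_injective h.1, ih₁ rfl, ih₂ rfl⟩
  | skip => intro S' h; cases S' <;> simp_all [Stmt.code, Nat.pair_eq_pair]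
  | seq S₁ S₂ ih₁ ih₂ =>
    intro S' h
    cases S' <;> simp_all [Stmt.code, Nat.pair_eq_pair]
    exact ⟨ih₁ rfl, ih₂ rfl⟩

theorem Program.code_injective : Function.Injective Program.code := by
  rintro ⟨d, i, o, S, _, _, _, _, _⟩ ⟨d', i', o', S', _, _, _, _, _⟩ h
  simp only [Program.code, Nat.pair_eq_pair] at h
  obtain ⟨h1, h2, h3, h4⟩ := h
  obtain rfl := Finset.image_injective ratCode_injective (setCode_injective h1)
  obtain rfl := setCode_injective h2
  obtain rfl := setCode_injective h3
  obtain rfl := Stmt.code_injective h4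
  rfl

theorem Program.inputCode_injective (P : Program) : Function.Injective P.inputCode := by
  intro u v h
  have h' := setCode_injective h
  funext x
  have hx : Nat.pair x.1 (ratCode (u x).1) ∈
      P.inputs.attach.image fun x => Nat.pair x.1 (ratCode (v x).1) := by
    rw [← h']
    exact Finset.mem_image_of_mem _ (Finset.mem_attach _ x)
  obtain ⟨y, -, hy⟩ := Finset.mem_image.1 hx
  obtain ⟨h1, h2⟩ := Nat.pair_eq_pair.1 hy
  obtain rfl := Subtype.ext h1
  exact Subtype.ext (ratCode_injective h2).symm

theorem Problem.code_injective : Function.Injective Problem.code := by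
  rintro ⟨P, Φ, e, f, d, _, _⟩ ⟨P', Φ', e', f', d', _, _⟩ h
  simp only [Problem.code, Nat.pair_eq_pair] at h
  obtain ⟨h1, h2, h3, h4, h5⟩ := h
  obtain rfl := Program.code_injective h1
  have hinj : Function.Injective fun p : P.Input × P.Input =>
      Nat.pair (P.inputCode p.1) (P.inputCode p.2) := by
    intro p q hpq
    obtain ⟨ha, hb⟩ := Nat.pair_eq_pair.1 hpq
    exact Prod.ext (P.inputCode_injective ha) (P.inputCode_injective hb)
  obtain rfl := Finset.image_injective hinj (setCode_injective h2)
  obtain rfl := Subtype.ext (ratCode_injective h3)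
  obtain rfl := Subtype.ext (ratCode_injective h4)
  obtain rfl := ratCode_injective h5
  rfl

end DiPGauss

/-! Write Δ(u, u') for `deltaAdj`. Testing privacy on the set F of outputs where Pr(u) - exp(εprv)
Pr(u') is nonnegative, which is the worst set, shows that privacy means Δ(u, u') ≤ δ for all pairs
in Φ (`Program.isDP_iff`). The critical parameters are these finitely many numbers. It therefore
suffices to compute rational lower and upper bounds for Δ(u, u') at each precision m that converge
as m grows. Failure of privacy means that some lower bound exceeds δ at some precision, which is a
recursively enumerable condition. If δ is not critical, privacy means that all Δ(u, u') are strictly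
below δ, and this is witnessed by upper bounds. Searching for either witness is the algorithm. If
privacy holds with some Δ(u, u') equal to δ, neither witness exists.

The core is the probability of one final state. Its conditions compare the sign of affine functions
of independent Gaussian and Laplace variables. Cover a growing box by cells of mesh 1/(m+1). On a
cell whose corner value exceeds the oscillation of the affine function the sign is constant, so the
truth value of the condition is known. Summing rational lower bounds for the masses of the cells
where the conjunction is known to be true, or known to be false, gives lower bounds for the event
and for its complement, hence two-sided bounds (`lowerQ_le`). They converge (`tendsto_lowerQ`) for
two reasons. A nonconstant affine function of independent atomless variables is almost surely
nonzero (`ae_gap_ne_zero`), so almost every point ends up in decided cells. The masses of all cells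
are approximated with total error tending to zero (`tendsto_weightError`), by dominated convergence
applied to step functions below the density.

The masses need rational lower bounds for exp(-T), given by (1 - T/N)^N, and for the Gaussian
normalization, obtained from Wallis products (`wallisProd_sq_le`, `tendsto_wallisProd_sq`).

The semantics collects final states in a finite set while the algorithm runs over the list of
control paths. The two sums agree because two paths with the same final state have taken opposite
branches of some test, so that state contains a condition together with its negation and has
probability zero (`Stmt.sum_finals`).

Finally, everything is primitive recursive in the given codes. The codes of expressions and
statements are made the official encodings of their types, structural recursion becomes
course-of-values recursion on codes, and the numbers that are codes of instances are recognized by a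
primitive recursive test (`validProblem_iff`). -/

namespace DiPGauss

/-! ## Primitive recursive functions and `fun_prop` -/

attribute [fun_prop] Primrec
attribute [fun_prop] Primrec.id Primrec.const Primrec.comp Primrec.pair

section PrimrecToolkit

variable {α β γ σ : Type*} [Primcodable α] [Primcodable β] [Primcodable γ] [Primcodable σ]

@[fun_prop] theorem primrec_fst {f : α → β × γ} (hf : Primrec f) : Primrec fun a => (f a).1 :=
  Primrec.fst.comp hf

@[fun_prop] theorem primrec_snd {f : α → β × γ} (hf : Primrec f) : Primrec fun a => (f a).2 :=
  Primrec.snd.comp hf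

@[fun_prop] theorem primrec_nat_succ {f : α → ℕ} (hf : Primrec f) :
    Primrec fun a => Nat.succ (f a) := Primrec.succ.comp hf

@[fun_prop] theorem primrec_nat_add {f g : α → ℕ} (hf : Primrec f) (hg : Primrec g) :
    Primrec fun a => f a + g a := Primrec.nat_add.comp hf hg

@[fun_prop] theorem primrec_nat_sub {f g : α → ℕ} (hf : Primrec f) (hg : Primrec g) :
    Primrec fun a => f a - g a := Primrec.nat_sub.comp hf hg

@[fun_prop] theorem primrec_nat_mul {f g : α → ℕ} (hf : Primrec f) (hg : Primrec g) :
    Primrec fun a => f a * g a := Primrec.nat_mul.comp hf hg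

@[fun_prop] theorem primrec_nat_div {f g : α → ℕ} (hf : Primrec f) (hg : Primrec g) :
    Primrec fun a => f a / g a := Primrec.nat_div.comp hf hg

@[fun_prop] theorem primrec_nat_mod {f g : α → ℕ} (hf : Primrec f) (hg : Primrec g) :
    Primrec fun a => f a % g a := Primrec.nat_mod.comp hf hg

@[fun_prop] theorem primrec_nat_pair {f g : α → ℕ} (hf : Primrec f) (hg : Primrec g) :
    Primrec fun a => Nat.pair (f a) (g a) := Primrec₂.natPair.comp hf hg

@[fun_prop] theorem primrec_nat_unpair {f : α → ℕ} (hf : Primrec f) :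
    Primrec fun a => Nat.unpair (f a) := Primrec.unpair.comp hf

@[fun_prop] theorem primrec_decide_nat_le {f g : α → ℕ} (hf : Primrec f) (hg : Primrec g) :
    Primrec fun a => decide (f a ≤ g a) := Primrec.nat_le.decide.comp hf hg

@[fun_prop] theorem primrec_decide_eq [DecidableEq β] {f g : α → β} (hf : Primrec f)
    (hg : Primrec g) : Primrec fun a => decide (f a = g a) := Primrec.eq.decide.comp hf hg

@[fun_prop] theorem primrec_decide_ne [DecidableEq β] {f g : α → β} (hf : Primrec f)
    (hg : Primrec g) : Primrec fun a => decide (f a ≠ g a) :=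
  (Primrec.not.comp (Primrec.eq.decide.comp hf hg)).of_eq fun a => by simp

@[fun_prop] theorem primrec_and {f g : α → Bool} (hf : Primrec f) (hg : Primrec g) :
    Primrec fun a => (f a && g a) := Primrec.and.comp hf hg

@[fun_prop] theorem primrec_or {f g : α → Bool} (hf : Primrec f) (hg : Primrec g) :
    Primrec fun a => (f a || g a) := Primrec.or.comp hf hg

@[fun_prop] theorem primrec_not {f : α → Bool} (hf : Primrec f) :
    Primrec fun a => !(f a) := Primrec.not.comp hf

@[fun_prop] theorem primrec_bool_beq {f g : α → Bool} (hf : Primrec f) (hg : Primrec g) :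
    Primrec fun a => (f a == g a) := Primrec.beq.comp hf hg

@[fun_prop] theorem primrec_cond {c : α → Bool} {f g : α → β} (hc : Primrec c) (hf : Primrec f)
    (hg : Primrec g) : Primrec fun a => cond (c a) (f a) (g a) := Primrec.cond hc hf hg

@[fun_prop] theorem primrec_encode {f : α → β} (hf : Primrec f) :
    Primrec fun a => Encodable.encode (f a) := Primrec.encode.comp hf

@[fun_prop] theorem primrec_decode {f : α → ℕ} (hf : Primrec f) :
    Primrec fun a => (Encodable.decode (f a) : Option β) := Primrec.decode.comp hf

@[fun_prop] theorem primrec_some {f : α → β} (hf : Primrec f) :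
    Primrec fun a => some (f a) := Primrec.option_some.comp hf

@[fun_prop] theorem primrec_getD {f : α → Option β} {g : α → β} (hf : Primrec f)
    (hg : Primrec g) : Primrec fun a => (f a).getD (g a) := Primrec.option_getD.comp hf hg

@[fun_prop] theorem primrec_option_map {f : α → Option β} {g : α → β → γ} (hf : Primrec f)
    (hg : Primrec fun p : α × β => g p.1 p.2) : Primrec fun a => (f a).map (g a) :=
  Primrec.option_map hf hg

@[fun_prop] theorem primrec_option_bind {f : α → Option β} {g : α → β → Option γ}
    (hf : Primrec f) (hg : Primrec fun p : α × β => g p.1 p.2) :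
    Primrec fun a => (f a).bind (g a) := Primrec.option_bind hf hg

@[fun_prop] theorem primrec_option_elim {o : α → Option β} {d : α → σ} {g : α → β → σ}
    (ho : Primrec o) (hd : Primrec d) (hg : Primrec fun p : α × β => g p.1 p.2) :
    Primrec fun a => (o a).elim (d a) (g a) :=
  (Primrec.option_casesOn ho hd hg).of_eq fun a => by cases o a <;> rfl

@[fun_prop] theorem primrec_inl {f : α → β} (hf : Primrec f) :
    Primrec fun a => (Sum.inl (f a) : β ⊕ γ) := Primrec.sumInl.comp hf

@[fun_prop] theorem primrec_inr {f : α → γ} (hf : Primrec f) :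
    Primrec fun a => (Sum.inr (f a) : β ⊕ γ) := Primrec.sumInr.comp hf

@[fun_prop] theorem primrec_sum_elim {s : α → β ⊕ γ} {f : α → β → σ} {g : α → γ → σ}
    (hs : Primrec s) (hf : Primrec fun p : α × β => f p.1 p.2)
    (hg : Primrec fun p : α × γ => g p.1 p.2) : Primrec fun a => Sum.elim (f a) (g a) (s a) :=
  (Primrec.sumCasesOn hs hf hg).of_eq fun a => by cases s a <;> rfl

@[fun_prop] theorem primrec_cons {f : α → β} {g : α → List β} (hf : Primrec f) (hg : Primrec g) :
    Primrec fun a => f a :: g a := Primrec.list_cons.comp hf hg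

@[fun_prop] theorem primrec_append {f g : α → List β} (hf : Primrec f) (hg : Primrec g) :
    Primrec fun a => f a ++ g a := Primrec.list_append.comp hf hg

@[fun_prop] theorem primrec_map {f : α → List β} {g : α → β → γ} (hf : Primrec f)
    (hg : Primrec fun p : α × β => g p.1 p.2) : Primrec fun a => (f a).map (g a) :=
  Primrec.list_map hf hg

@[fun_prop] theorem primrec_flatMap {f : α → List β} {g : α → β → List γ} (hf : Primrec f)
    (hg : Primrec fun p : α × β => g p.1 p.2) : Primrec fun a => (f a).flatMap (g a) :=
  Primrec.list_flatMap hf hg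

@[fun_prop] theorem primrec_foldl {f : α → List β} {g : α → γ} {h : α → γ → β → γ}
    (hf : Primrec f) (hg : Primrec g)
    (hh : Primrec fun p : α × γ × β => h p.1 p.2.1 p.2.2) :
    Primrec fun a => (f a).foldl (h a) (g a) :=
  Primrec.list_foldl (h := fun a p => h a p.1 p.2) hf hg hh

@[fun_prop] theorem primrec_foldr {f : α → List β} {g : α → γ} {h : α → β → γ → γ}
    (hf : Primrec f) (hg : Primrec g)
    (hh : Primrec fun p : α × β × γ => h p.1 p.2.1 p.2.2) :
    Primrec fun a => (f a).foldr (h a) (g a) :=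
  Primrec.list_foldr (h := fun a p => h a p.1 p.2) hf hg hh

@[fun_prop] theorem primrec_length {f : α → List β} (hf : Primrec f) :
    Primrec fun a => (f a).length := Primrec.list_length.comp hf

@[fun_prop] theorem primrec_range {f : α → ℕ} (hf : Primrec f) :
    Primrec fun a => List.range (f a) := Primrec.list_range.comp hf

@[fun_prop] theorem primrec_list_getD {f : α → List β} {n : α → ℕ} {d : β} (hf : Primrec f)
    (hn : Primrec n) : Primrec fun a => (f a).getD (n a) d :=
  (Primrec.list_getD d).comp hf hn

@[fun_prop] theorem primrec_lookup [DecidableEq β] {k : α → β} {f : α → List (β × γ)}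
    (hk : Primrec k) (hf : Primrec f) : Primrec fun a => (f a).lookup (k a) :=
  (Primrec.listLookup.comp hk hf).of_eq fun a => by
    congr 1

@[fun_prop] theorem primrec_all {f : α → List β} {p : α → β → Bool} (hf : Primrec f)
    (hp : Primrec fun q : α × β => p q.1 q.2) : Primrec fun a => (f a).all (p a) := by
  have h : Primrec fun a => (f a).foldr (fun b s => p a b && s) true := by fun_prop
  refine h.of_eq fun a => ?_
  induction f a with
  | nil => rfl
  | cons b l ih => simp only [List.foldr_cons, List.all_cons, ih]

@[fun_prop] theorem primrec_any {f : α → List β} {p : α → β → Bool} (hf : Primrec f)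
    (hp : Primrec fun q : α × β => p q.1 q.2) : Primrec fun a => (f a).any (p a) := by
  have h : Primrec fun a => (f a).foldr (fun b s => p a b || s) false := by fun_prop
  refine h.of_eq fun a => ?_
  induction f a with
  | nil => rfl
  | cons b l ih => simp only [List.foldr_cons, List.any_cons, ih]

@[fun_prop] theorem primrec_filter {f : α → List β} {p : α → β → Bool} (hf : Primrec f)
    (hp : Primrec fun q : α × β => p q.1 q.2) : Primrec fun a => (f a).filter (p a) := by
  have h : Primrec fun a => (f a).foldr (fun b s => cond (p a b) (b :: s) s) [] := by fun_prop
  refine h.of_eq fun a => ?_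
  induction f a with
  | nil => rfl
  | cons b l ih => simp only [List.foldr_cons, List.filter_cons, ih]; cases p a b <;> rfl

@[fun_prop] theorem primrec_decide_mem [DecidableEq β] {b : α → β} {f : α → List β}
    (hb : Primrec b) (hf : Primrec f) : Primrec fun a => decide (b a ∈ f a) := by
  have h : Primrec fun a => (f a).any (fun c => decide (b a = c)) := by fun_prop
  refine h.of_eq fun a => ?_
  simp only [List.any_eq, decide_eq_true_eq, exists_eq_right']

@[fun_prop] theorem primrec_nat_list_sum {f : α → List ℕ} (hf : Primrec f) :
    Primrec fun a => (f a).sum := by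
  have h : Primrec fun a => (f a).foldr (fun b s => b + s) 0 := by fun_prop
  exact h.of_eq fun a => rfl

@[fun_prop] theorem primrec_iterate {n : α → ℕ} {g : α → β → β} {x : α → β} (hn : Primrec n)
    (hg : Primrec fun p : α × β => g p.1 p.2) (hx : Primrec x) :
    Primrec fun a => (g a)^[n a] (x a) := Primrec.nat_iterate hn hx hg

@[fun_prop] theorem primrec_decide_list_pairwise_lt {f : α → List ℕ} (hf : Primrec f) :
    Primrec fun a => decide ((f a).Pairwise (· < ·)) := by
  have h : Primrec fun a => ((f a).foldr
      (fun b s => (s.1 && s.2.all (fun c => decide (b < c)), b :: s.2)) (true, [])).1 := by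
    fun_prop
  refine h.of_eq fun a => ?_
  have key : ∀ l : List ℕ, (l.foldr
      (fun b (s : Bool × List ℕ) => (s.1 && s.2.all (fun c => decide (b < c)), b :: s.2))
      (true, [])) = (decide (l.Pairwise (· < ·)), l) := by
    intro l
    induction l with
    | nil => simp
    | cons b l ih =>
      rw [List.foldr_cons, ih]
      simp only [List.pairwise_cons, Prod.mk.injEq, and_true]
      rw [Bool.eq_iff_iff]
      simp [and_comm]
  rw [key]

/-- Course-of-values recursion with a parameter. -/
theorem primrec_strongRec (f : α → ℕ → σ) (g : α → List σ → σ)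
    (hg : Primrec fun p : α × List σ => g p.1 p.2)
    (H : ∀ a n, g a ((List.range n).map (f a)) = f a n) : Primrec fun p : α × ℕ => f p.1 p.2 :=
  Primrec.nat_strong_rec f (g := fun a l => some (g a l)) (Primrec.option_some.comp hg)
    fun a n => by rw [H]

end PrimrecToolkit

/-! ## Codes as primitive recursive encodings -/

open Classical in
/-- An injective code with primitive recursive range makes a type primitively encodable. -/
noncomputable abbrev primcodableOfCode {α : Type*} (c : α → ℕ) (hc : Function.Injective c)
    (v : ℕ → Bool) (hv : Primrec v) (hvc : ∀ n, v n = true ↔ ∃ a, c a = n) : Primcodable α where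
  encode := c
  decode n := if h : ∃ a, c a = n then some h.choose else none
  encodek a := by
    have h : ∃ b, c b = c a := ⟨a, rfl⟩
    rw [dif_pos h, hc h.choose_spec]
  prim := by
    -- Decoding followed by encoding returns a code unchanged (shifted by one for `some`), so only
    -- the recognizer `v` has to be computed; the choice in `decode` is harmless.
    have h : Primrec fun n => cond (v n) (n + 1) 0 := by fun_prop
    refine (Primrec.nat_iff.1 h).of_eq fun n => ?_
    by_cases hn : ∃ a, c a = n
    · rw [dif_pos hn, (hvc n).2 hn]
      simp only [Encodable.encode_some, cond_true, hn.choose_spec, Nat.succ_eq_add_one]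
    · rw [dif_neg hn, Bool.eq_false_iff.2 (fun h => hn ((hvc n).1 h))]
      rfl

/-- Bounded maximization is primitive recursive. The bound a + b also covers gcd(a, 0) = a and
gcd(0, b) = b, and for a = b = 0 it leaves only the value 0. -/
theorem nat_gcd_eq_findGreatest (a b : ℕ) :
    Nat.gcd a b = Nat.findGreatest (fun d => a % d = 0 ∧ b % d = 0) (a + b) := by
  rcases Nat.eq_zero_or_pos (a + b) with h | h
  · obtain ⟨rfl, rfl⟩ : a = 0 ∧ b = 0 := by omega
    rfl
  · have hg : 0 < Nat.gcd a b := Nat.gcd_pos_iff.2 (by omega)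
    have hle : Nat.gcd a b ≤ a + b := by
      rcases Nat.eq_zero_or_pos a with rfl | ha
      · simp
      · exact (Nat.gcd_le_left b ha).trans (Nat.le_add_right _ _)
    symm
    rw [Nat.findGreatest_eq_iff]
    refine ⟨hle, fun _ => ⟨Nat.mod_eq_zero_of_dvd (Nat.gcd_dvd_left a b),
      Nat.mod_eq_zero_of_dvd (Nat.gcd_dvd_right a b)⟩, ?_⟩
    rintro n hn - ⟨h1, h2⟩
    exact absurd (Nat.le_of_dvd hg
      (Nat.dvd_gcd (Nat.dvd_of_mod_eq_zero h1) (Nat.dvd_of_mod_eq_zero h2))) (not_le.2 hn)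

section

variable {α : Type*} [Primcodable α]

@[fun_prop] theorem primrec_nat_gcd {f g : α → ℕ} (hf : Primrec f) (hg : Primrec g) :
    Primrec fun a => Nat.gcd (f a) (g a) := by
  have h : Primrec fun a => Nat.findGreatest (fun d => f a % d = 0 ∧ g a % d = 0) (f a + g a) := by
    refine Primrec.nat_findGreatest (p := fun a d => f a % d = 0 ∧ g a % d = 0) (by fun_prop) ?_
    apply PrimrecPred.and
    · exact Primrec.eq.comp (by fun_prop) (by fun_prop)
    · exact Primrec.eq.comp (by fun_prop) (by fun_prop)
  exact h.of_eq fun a => (nat_gcd_eq_findGreatest _ _).symm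

end

/-! ### Rational numbers -/

theorem encode_int_natCast (a : ℕ) : Encodable.encode (a : ℤ) = 2 * a := by
  exact rfl

/-- The integer -(k+1) has code 2k + 1; truncated subtraction makes the same formula correct for a =
0. -/
theorem encode_int_neg_natCast (a : ℕ) : Encodable.encode (-(a : ℤ)) = 2 * a - 1 := by
  cases a with
  | zero => rfl
  | succ a => exact rfl

/-- The code of the rational number `(a - b) / d`. -/
def ratMkCode (a b d : ℕ) : ℕ :=
  let g := Nat.gcd ((a - b) + (b - a)) d
  cond (decide (d = 0)) (Nat.pair 0 1)
    (Nat.pair (cond (decide (b ≤ a)) (2 * ((a - b) / g)) (2 * ((b - a) / g) - 1)) (d / g))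

theorem ratCode_div_of_pos (k : ℕ) (d : ℕ) (hd : 0 < d) :
    (((k : ℚ) / d).num = ((k / Nat.gcd k d : ℕ) : ℤ)) ∧ ((k : ℚ) / d).den = d / Nat.gcd k d := by
  have hg : 0 < Nat.gcd k d := Nat.gcd_pos_of_pos_right _ hd
  have hcop : Nat.Coprime (k / Nat.gcd k d) (d / Nat.gcd k d) := Nat.coprime_div_gcd_div_gcd hg
  have hd' : 0 < d / Nat.gcd k d := Nat.div_pos (Nat.le_of_dvd hd (Nat.gcd_dvd_right _ _)) hg
  have hq : (k : ℚ) / d = ((k / Nat.gcd k d : ℕ) : ℤ) / ((d / Nat.gcd k d : ℕ) : ℤ) := by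
    rw [Int.cast_natCast, Int.cast_natCast, Nat.cast_div (Nat.gcd_dvd_left _ _) (by positivity),
      Nat.cast_div (Nat.gcd_dvd_right _ _) (by positivity)]
    have : (Nat.gcd k d : ℚ) ≠ 0 := by positivity
    have : (d : ℚ) ≠ 0 := by positivity
    field_simp
  rw [hq]
  constructor
  · exact Rat.num_div_eq_of_coprime (by exact_mod_cast hd')
      (by rwa [Int.natAbs_natCast, Int.natAbs_natCast])
  · have := Rat.den_div_eq_of_coprime (a := ((k / Nat.gcd k d : ℕ) : ℤ))
      (b := ((d / Nat.gcd k d : ℕ) : ℤ)) (by exact_mod_cast hd')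
      (by rwa [Int.natAbs_natCast, Int.natAbs_natCast])
    exact_mod_cast this

/-- One of the two truncated differences in `ratMkCode` vanishes, so their sum is |a - b| and
dividing by the gcd gives lowest terms. For d = 0 both sides are the code of 0 = 0/1. -/
theorem ratCode_mk (a b d : ℕ) : ratCode (((a : ℚ) - b) / d) = ratMkCode a b d := by
  unfold ratMkCode ratCode
  rcases Nat.eq_zero_or_pos d with rfl | hd
  · simp
    rfl
  · simp only [decide_eq_false hd.ne', cond_false]
    rcases le_total b a with h | h
    · have h1 : b - a = 0 := Nat.sub_eq_zero_of_le h
      have h2 := ratCode_div_of_pos (a - b) d hd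
      rw [Nat.cast_sub h] at h2
      rw [h1, h2.1, h2.2, encode_int_natCast, decide_eq_true h]
      rfl
    · have h1 : a - b = 0 := Nat.sub_eq_zero_of_le h
      have h2 := ratCode_div_of_pos (b - a) d hd
      rw [Nat.cast_sub h] at h2
      have h3 : ((a : ℚ) - b) / d = -(((b : ℚ) - a) / d) := by ring
      rw [h1, h3, Rat.num_neg_eq_neg_num, Rat.den_neg_eq_den, h2.1, h2.2, encode_int_neg_natCast,
        zero_add]
      rcases eq_or_lt_of_le h with rfl | h'
      · simp
      · rw [decide_eq_false (not_le.2 h')]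
        rfl

/-- Recognizes the codes of rational numbers. -/
def isRatCode (n : ℕ) : Bool :=
  decide (n.unpair.2 ≠ 0) && decide (Nat.gcd ((n.unpair.1 + 1) / 2) n.unpair.2 = 1)

/-- The codes 2a and 2a - 1 of a and -a both become a after adding one and halving; this is how
`isRatCode` tests coprimality. -/
theorem natAbs_eq_encode (z : ℤ) : z.natAbs = (Encodable.encode z + 1) / 2 := by
  rcases Int.eq_nat_or_neg z with ⟨a, rfl | rfl⟩
  · rw [encode_int_natCast]; simp; omega
  · rw [encode_int_neg_natCast]; simp; omega

theorem isRatCode_iff (n : ℕ) : isRatCode n = true ↔ ∃ q, ratCode q = n := by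
  unfold isRatCode
  simp only [ne_eq, Bool.and_eq_true, decide_eq_true_eq]
  constructor
  · rintro ⟨h1, h2⟩
    have hz : Encodable.encode (Denumerable.ofNat ℤ n.unpair.1) = n.unpair.1 :=
      Denumerable.encode_ofNat _
    refine ⟨⟨Denumerable.ofNat ℤ n.unpair.1, n.unpair.2, h1, ?_⟩, ?_⟩
    · rw [natAbs_eq_encode, hz]
      exact h2
    · rw [ratCode]
      simp only [hz, Nat.pair_unpair]
  · rintro ⟨q, rfl⟩
    simp only [ratCode, Nat.unpair_pair]
    refine ⟨q.den_nz, ?_⟩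
    rw [← natAbs_eq_encode]
    exact q.reduced

noncomputable instance instPrimcodableRat : Primcodable ℚ :=
  primcodableOfCode ratCode ratCode_injective isRatCode (by unfold isRatCode; fun_prop)
    isRatCode_iff

/-- Being declared later than the standard encoding of ℚ, this instance takes precedence, so that
`Encodable.encode` on rationals is `ratCode` throughout. -/
noncomputable instance instEncodableRatCode : Encodable ℚ := instPrimcodableRat.toEncodable

theorem primrec_ratCode : Primrec ratCode := Primrec.encode (α := ℚ)

section

variable {α : Type*} [Primcodable α]

@[fun_prop] theorem primrec_isRatCode {n : α → ℕ} (hn : Primrec n) :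
    Primrec fun a => isRatCode (n a) := by
  unfold isRatCode; fun_prop

@[fun_prop] theorem primrec_ratCode_comp {f : α → ℚ} (hf : Primrec f) :
    Primrec fun a => ratCode (f a) := primrec_ratCode.comp hf

/-- Sums, products, negatives and inverses of rationals are all reduced to natural number arithmetic
by writing the result with fractions of this shape, the numerator being a difference of two
naturals. -/
theorem primrec_rat_mk {x y d : α → ℕ} (hx : Primrec x) (hy : Primrec y) (hd : Primrec d) :
    Primrec fun a => ((x a : ℚ) - y a) / d a := by
  have h : Primrec fun a => ratMkCode (x a) (y a) (d a) := by unfold ratMkCode; fun_prop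
  exact (Primrec.encode_iff (σ := ℚ)).1 (h.of_eq fun a => (ratCode_mk _ _ _).symm)

@[fun_prop] theorem primrec_rat_den {f : α → ℚ} (hf : Primrec f) :
    Primrec fun a => (f a).den := by
  have h : Primrec fun a => (ratCode (f a)).unpair.2 := by fun_prop
  exact h.of_eq fun a => by simp [ratCode]

@[fun_prop] theorem primrec_rat_num_toNat {f : α → ℚ} (hf : Primrec f) :
    Primrec fun a => (f a).num.toNat := by
  have h : Primrec fun a => cond (decide ((ratCode (f a)).unpair.1 % 2 = 0))
    ((ratCode (f a)).unpair.1 / 2) 0 := by fun_prop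
  refine h.of_eq fun a => ?_
  simp only [ratCode, Nat.unpair_pair]
  rcases Int.eq_nat_or_neg (f a).num with ⟨k, hk | hk⟩ <;> rw [hk]
  · rw [encode_int_natCast]; simp
  · rw [encode_int_neg_natCast]
    rcases k with _ | k
    · rfl
    · rw [decide_eq_false (by omega)]
      simp; omega

@[fun_prop] theorem primrec_rat_neg_num_toNat {f : α → ℚ} (hf : Primrec f) :
    Primrec fun a => (-(f a).num).toNat := by
  have h : Primrec fun a => cond (decide ((ratCode (f a)).unpair.1 % 2 = 0))
    0 (((ratCode (f a)).unpair.1 + 1) / 2) := by fun_prop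
  refine h.of_eq fun a => ?_
  simp only [ratCode, Nat.unpair_pair]
  rcases Int.eq_nat_or_neg (f a).num with ⟨k, hk | hk⟩ <;> rw [hk]
  · rw [encode_int_natCast]; simp
  · rw [encode_int_neg_natCast]
    rcases k with _ | k
    · rfl
    · rw [decide_eq_false (by omega)]
      simp; omega

theorem rat_eq_toNat_sub_toNat_div (q : ℚ) :
    q = ((q.num.toNat : ℚ) - ((-q.num).toNat : ℚ)) / q.den := by
  have h : ((q.num.toNat : ℚ) - ((-q.num).toNat : ℚ)) = q.num := by
    exact_mod_cast Int.toNat_sub_toNat_neg q.num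
  rw [h, Rat.num_div_den]

@[fun_prop] theorem primrec_rat_natCast {f : α → ℕ} (hf : Primrec f) :
    Primrec fun a => (f a : ℚ) :=
  (primrec_rat_mk hf (Primrec.const 0) (Primrec.const 1)).of_eq fun a => by simp

@[fun_prop] theorem primrec_rat_neg {f : α → ℚ} (hf : Primrec f) : Primrec fun a => -f a := by
  have h : Primrec fun a => (((-(f a).num).toNat : ℚ) - ((f a).num.toNat : ℚ)) / (f a).den :=
    primrec_rat_mk (by fun_prop) (by fun_prop) (by fun_prop)
  refine h.of_eq fun a => ?_
  conv_rhs => rw [rat_eq_toNat_sub_toNat_div (f a)]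
  ring

@[fun_prop] theorem primrec_rat_add {f g : α → ℚ} (hf : Primrec f) (hg : Primrec g) :
    Primrec fun a => f a + g a := by
  have h : Primrec fun a =>
      ((((f a).num.toNat * (g a).den + (g a).num.toNat * (f a).den : ℕ) : ℚ) -
        (((-(f a).num).toNat * (g a).den + (-(g a).num).toNat * (f a).den : ℕ) : ℚ)) /
        (((f a).den * (g a).den : ℕ) : ℚ) :=
    primrec_rat_mk (by fun_prop) (by fun_prop) (by fun_prop)
  refine h.of_eq fun a => ?_
  conv_rhs => rw [rat_eq_toNat_sub_toNat_div (f a), rat_eq_toNat_sub_toNat_div (g a)]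
  have h1 : ((f a).den : ℚ) ≠ 0 := by exact_mod_cast (f a).den_nz
  have h2 : ((g a).den : ℚ) ≠ 0 := by exact_mod_cast (g a).den_nz
  push_cast
  field_simp
  ring

@[fun_prop] theorem primrec_rat_sub {f g : α → ℚ} (hf : Primrec f) (hg : Primrec g) :
    Primrec fun a => f a - g a := by
  have h : Primrec fun a => f a + -g a := by fun_prop
  exact h.of_eq fun a => (sub_eq_add_neg _ _).symm

@[fun_prop] theorem primrec_rat_mul {f g : α → ℚ} (hf : Primrec f) (hg : Primrec g) :
    Primrec fun a => f a * g a := by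
  have h : Primrec fun a =>
      ((((f a).num.toNat * (g a).num.toNat + (-(f a).num).toNat * (-(g a).num).toNat : ℕ) : ℚ) -
        (((f a).num.toNat * (-(g a).num).toNat + (-(f a).num).toNat * (g a).num.toNat : ℕ) : ℚ)) /
        (((f a).den * (g a).den : ℕ) : ℚ) :=
    primrec_rat_mk (by fun_prop) (by fun_prop) (by fun_prop)
  refine h.of_eq fun a => ?_
  conv_rhs => rw [rat_eq_toNat_sub_toNat_div (f a), rat_eq_toNat_sub_toNat_div (g a)]
  have h1 : ((f a).den : ℚ) ≠ 0 := by exact_mod_cast (f a).den_nz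
  have h2 : ((g a).den : ℚ) ≠ 0 := by exact_mod_cast (g a).den_nz
  push_cast
  field_simp
  ring

@[fun_prop] theorem primrec_decide_rat_le {f g : α → ℚ} (hf : Primrec f) (hg : Primrec g) :
    Primrec fun a => decide (f a ≤ g a) := by
  have h : Primrec fun a => decide ((f a - g a).num.toNat ≤ 0) := by fun_prop
  refine h.of_eq fun a => ?_
  rw [decide_eq_decide, Nat.le_zero, Int.toNat_eq_zero, Rat.num_nonpos, sub_nonpos]

@[fun_prop] theorem primrec_decide_rat_lt {f g : α → ℚ} (hf : Primrec f) (hg : Primrec g) :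
    Primrec fun a => decide (f a < g a) := by
  have h : Primrec fun a => !decide (g a ≤ f a) := by fun_prop
  refine h.of_eq fun a => ?_
  rw [← decide_not, decide_eq_decide, not_le]

-- One fraction serves positive and the other negative arguments. The unwanted one has denominator
-- zero and hence value zero, so their sum is the inverse without a case distinction.
@[fun_prop] theorem primrec_rat_inv {f : α → ℚ} (hf : Primrec f) :
    Primrec fun a => (f a)⁻¹ := by
  have h1 : Primrec fun a => (((f a).den : ℚ) - ((0 : ℕ) : ℚ)) / ((f a).num.toNat : ℚ) :=
    primrec_rat_mk (by fun_prop) (by fun_prop) (by fun_prop)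
  have h2 : Primrec fun a => (((0 : ℕ) : ℚ) - ((f a).den : ℚ)) / ((-(f a).num).toNat : ℚ) :=
    primrec_rat_mk (by fun_prop) (by fun_prop) (by fun_prop)
  have h : Primrec fun a => (((f a).den : ℚ) - ((0 : ℕ) : ℚ)) / ((f a).num.toNat : ℚ) +
    (((0 : ℕ) : ℚ) - ((f a).den : ℚ)) / ((-(f a).num).toNat : ℚ) := primrec_rat_add h1 h2
  refine h.of_eq fun a => ?_
  conv_rhs => rw [rat_eq_toNat_sub_toNat_div (f a)]
  rcases le_total 0 (f a).num with h0 | h0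
  · have : (-(f a).num).toNat = 0 := Int.toNat_eq_zero.2 (by omega)
    rw [this]; simp
  · have : ((f a).num).toNat = 0 := Int.toNat_eq_zero.2 (by omega)
    rw [this]; simp [neg_div]

@[fun_prop] theorem primrec_rat_div {f g : α → ℚ} (hf : Primrec f) (hg : Primrec g) :
    Primrec fun a => f a / g a := by
  have h : Primrec fun a => f a * (g a)⁻¹ := by fun_prop
  exact h.of_eq fun a => (div_eq_mul_inv _ _).symm

@[fun_prop] theorem primrec_rat_max {f g : α → ℚ} (hf : Primrec f) (hg : Primrec g) :
    Primrec fun a => max (f a) (g a) := by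
  have h : Primrec fun a => cond (decide (f a ≤ g a)) (g a) (f a) := by fun_prop
  refine h.of_eq fun a => ?_
  by_cases hle : f a ≤ g a
  · rw [decide_eq_true hle, max_eq_right hle]; rfl
  · rw [decide_eq_false hle, max_eq_left (not_le.1 hle).le]; rfl

@[fun_prop] theorem primrec_rat_abs {f : α → ℚ} (hf : Primrec f) : Primrec fun a => |f a| := by
  have h : Primrec fun a => max (f a) (-f a) := by fun_prop
  exact h.of_eq fun a => rfl

@[fun_prop] theorem primrec_rat_pow {f : α → ℚ} {n : α → ℕ} (hf : Primrec f) (hn : Primrec n) :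
    Primrec fun a => f a ^ n a := by
  have h : Primrec fun a => (fun x => f a * x)^[n a] 1 := by fun_prop
  refine h.of_eq fun a => ?_
  simp

@[fun_prop] theorem primrec_rat_list_sum {f : α → List ℚ} (hf : Primrec f) :
    Primrec fun a => (f a).sum := by
  have h : Primrec fun a => (f a).foldr (fun b s => b + s) 0 := by fun_prop
  exact h.of_eq fun a => rfl

@[fun_prop] theorem primrec_rat_list_prod {f : α → List ℚ} (hf : Primrec f) :
    Primrec fun a => (f a).prod := by
  have h : Primrec fun a => (f a).foldr (fun b s => b * s) 1 := by fun_prop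
  exact h.of_eq fun a => rfl

end

/-! ### Expression trees -/

noncomputable instance instPrimcodableCmp : Primcodable Cmp :=
  primcodableOfCode Cmp.code Cmp.code_injective (fun n => decide (n < 6)) (by fun_prop) fun n => by
    rw [decide_eq_true_eq]
    constructor
    · intro h
      interval_cases n
      exacts [⟨.eq, rfl⟩, ⟨.le, rfl⟩, ⟨.lt, rfl⟩, ⟨.ge, rfl⟩, ⟨.gt, rfl⟩, ⟨.ne, rfl⟩]
    · rintro ⟨c, rfl⟩
      cases c <;> simp [Cmp.code]

/-- Every function on a finite type is primitive recursive, which settles `Cmp.neg` and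
`Cmp.ofSign`. -/
instance : Finite Cmp := Finite.of_injective (β := Fin 6)
  (fun c => ⟨c.code, by cases c <;> simp [Cmp.code]⟩)
  fun a b h => Cmp.code_injective (by simpa using h)

noncomputable instance instPrimcodableFamily : Primcodable Family :=
  primcodableOfCode Family.code Family.code_injective (fun n => decide (n < 2)) (by fun_prop)
    fun n => by
    rw [decide_eq_true_eq]
    constructor
    · intro h
      interval_cases n
      exacts [⟨.gaussian, rfl⟩, ⟨.laplace, rfl⟩]
    · rintro ⟨c, rfl⟩
      cases c <;> simp [Family.code]

/-- Recursive subterms have smaller codes because their constructors carry nonzero tags. The tag 0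
is used only for constructors without recursive arguments. -/
theorem snd_lt_pair {t a : ℕ} (ht : t ≠ 0) : a < Nat.pair t a :=
  (Nat.right_le_pair 0 a).trans_lt (Nat.pair_lt_pair_left a (Nat.pos_of_ne_zero ht))

theorem unpair_fst_lt_pair {t a : ℕ} (ht : t ≠ 0) : a.unpair.1 < Nat.pair t a :=
  (Nat.unpair_left_le a).trans_lt (snd_lt_pair ht)

theorem unpair_snd_lt_pair {t a : ℕ} (ht : t ≠ 0) : a.unpair.2 < Nat.pair t a :=
  (Nat.unpair_right_le a).trans_lt (snd_lt_pair ht)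

theorem getD_map_range {σ : Type*} (f : ℕ → σ) {n k : ℕ} (h : k < n) (d : σ) :
    ((List.range n).map f).getD k d = f k := by
  simp [List.getD, h]

/-- A function of trees computed from the tag, the argument and the previous values. -/
theorem primrec_treeRec {α σ : Type*} [Primcodable α] [Primcodable σ] (f : α → ℕ → σ)
    (g : α → ℕ → ℕ → List σ → σ)
    (hg : Primrec fun p : α × ℕ × ℕ × List σ => g p.1 p.2.1 p.2.2.1 p.2.2.2)
    (H : ∀ a t s, g a t s ((List.range (Nat.pair t s)).map (f a)) = f a (Nat.pair t s)) :
    Primrec fun p : α × ℕ => f p.1 p.2 := by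
  -- The list of earlier values has length n, so the tag and the argument are read off from that
  -- length.
  refine primrec_strongRec f (fun a l => g a l.length.unpair.1 l.length.unpair.2 l) ?_ ?_
  · exact hg.comp (f := fun p : α × ℕ × ℕ × List σ => g p.1 p.2.1 p.2.2.1 p.2.2.2)
      (g := fun p : α × List σ => (p.1, p.2.length.unpair.1, p.2.length.unpair.2, p.2))
      (by fun_prop)
  · intro a n
    simp only [List.length_map, List.length_range]
    have := H a n.unpair.1 n.unpair.2
    rwa [Nat.pair_unpair] at this

section

variable {α : Type*} [Primcodable α]

theorem exists_rexp_code_pair (t s : ℕ) : (∃ R, RExp.code R = Nat.pair t s) ↔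
    t = 0 ∨ (t = 1 ∧ (∃ q, ratCode q = s.unpair.1) ∧ ∃ R, RExp.code R = s.unpair.2) ∨
    (t = 2 ∧ (∃ R, RExp.code R = s.unpair.1) ∧ ∃ R, RExp.code R = s.unpair.2) ∨
    (t = 3 ∧ (∃ R, RExp.code R = s.unpair.1) ∧ ∃ q, ratCode q = s.unpair.2) := by
  constructor
  · rintro ⟨R, h⟩
    cases R <;> obtain ⟨rfl, rfl⟩ := Nat.pair_eq_pair.1 h <;> simp
  · rintro (rfl | ⟨rfl, ⟨q, hq⟩, R, hR⟩ | ⟨rfl, ⟨R, hR⟩, R', hR'⟩ | ⟨rfl, ⟨R, hR⟩, q, hq⟩)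
    · exact ⟨.var s, rfl⟩
    · exact ⟨.smul q R, by rw [RExp.code, hq, hR, Nat.pair_unpair]⟩
    · exact ⟨.add R R', by rw [RExp.code, hR', hR, Nat.pair_unpair]⟩
    · exact ⟨.addConst R q, by rw [RExp.code, hq, hR, Nat.pair_unpair]⟩

open Classical in
/-- Recognizes the codes of real expressions. -/
noncomputable def isRExpCode (n : ℕ) : Bool := decide (∃ R, RExp.code R = n)

theorem isRExpCode_iff (n : ℕ) : isRExpCode n = true ↔ ∃ R, RExp.code R = n := by
  simp [isRExpCode]

@[fun_prop] theorem primrec_isRExpCode {n : α → ℕ} (hn : Primrec n) :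
    Primrec fun a => isRExpCode (n a) := by
  have h := primrec_treeRec (fun _ : Unit => isRExpCode)
    (fun _ t s l => decide (t = 0) || (decide (t = 1) && (isRatCode s.unpair.1 &&
      l.getD s.unpair.2 false)) || (decide (t = 2) && (l.getD s.unpair.1 false &&
      l.getD s.unpair.2 false)) || (decide (t = 3) && (l.getD s.unpair.1 false &&
      isRatCode s.unpair.2))) (by fun_prop) (by
      intro _ t s
      rw [Bool.eq_iff_iff, isRExpCode_iff, exists_rexp_code_pair]
      by_cases ht : t = 0
      · simp [ht]
      · rw [getD_map_range _ (unpair_fst_lt_pair ht), getD_map_range _ (unpair_snd_lt_pair ht)]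
        simp only [Bool.or_eq_true, Bool.and_eq_true, decide_eq_true_eq, isRExpCode_iff,
          isRatCode_iff]
        tauto)
  exact h.comp (g := fun a => ((), n a)) (by fun_prop)

noncomputable instance instPrimcodableRExp : Primcodable RExp :=
  primcodableOfCode RExp.code RExp.code_injective isRExpCode (by fun_prop) isRExpCode_iff

theorem decode_rexp_code (R : RExp) : (Encodable.decode R.code : Option RExp) = some R :=
  Encodable.encodek R

theorem decode_rat_code (q : ℚ) : (Encodable.decode (ratCode q) : Option ℚ) = some q :=
  Encodable.encodek q

theorem decode_rexp_of_not {n : ℕ} (h : ¬ ∃ R, RExp.code R = n) :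
    (Encodable.decode n : Option RExp) = none :=
  dif_neg h

/-- Structural recursion on real expressions is primitive recursive. -/
theorem primrec_rexp_rec {σ : Type*} [Primcodable σ] {f : α → RExp → σ}
    (fv : α → ℕ → σ) (fs : α → ℚ → σ → σ) (fa : α → σ → σ → σ) (fc : α → σ → ℚ → σ)
    (hfv : Primrec fun p : α × ℕ => fv p.1 p.2)
    (hfs : Primrec fun p : α × ℚ × σ => fs p.1 p.2.1 p.2.2)
    (hfa : Primrec fun p : α × σ × σ => fa p.1 p.2.1 p.2.2)
    (hfc : Primrec fun p : α × σ × ℚ => fc p.1 p.2.1 p.2.2)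
    (hv : ∀ a r, f a (.var r) = fv a r) (hs : ∀ a q R, f a (.smul q R) = fs a q (f a R))
    (ha : ∀ a R R', f a (.add R R') = fa a (f a R) (f a R'))
    (hc : ∀ a R q, f a (.addConst R q) = fc a (f a R) q)
    {x : α → RExp} (hx : Primrec x) : Primrec fun a => f a (x a) := by
  -- The recursion runs over all natural numbers with value `none` off the codes; at the code of an
  -- expression the value is `some`, which is stripped at the end.
  have h := primrec_treeRec (fun a n => (Encodable.decode n : Option RExp).map (f a))
    (fun a t s l => cond (isRExpCode (Nat.pair t s))
      (cond (decide (t = 0)) (some (fv a s))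
      (cond (decide (t = 1)) ((Encodable.decode s.unpair.1 : Option ℚ).bind
        fun q => (l.getD s.unpair.2 none).map fun y => fs a q y)
      (cond (decide (t = 2)) ((l.getD s.unpair.1 none).bind fun y =>
        (l.getD s.unpair.2 none).map fun z => fa a y z)
      ((l.getD s.unpair.1 none).bind fun y =>
        (Encodable.decode s.unpair.2 : Option ℚ).map
        fun q => fc a y q)))) none) (by fun_prop) (by
      intro a t s
      by_cases hR : ∃ R, RExp.code R = Nat.pair t s
      · rw [(isRExpCode_iff _).2 hR]
        obtain ⟨R, hR⟩ := hR
        rw [← hR, decode_rexp_code]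
        cases R with
        | var r =>
          obtain ⟨rfl, rfl⟩ := Nat.pair_eq_pair.1 hR
          simp [hv]
        | smul q R =>
          rw [hR]
          obtain ⟨rfl, rfl⟩ := Nat.pair_eq_pair.1 hR
          rw [getD_map_range _ (unpair_fst_lt_pair one_ne_zero),
            getD_map_range _ (unpair_snd_lt_pair one_ne_zero)]
          simp [decode_rat_code, decode_rexp_code, hs]
        | add R R' =>
          rw [hR]
          obtain ⟨rfl, rfl⟩ := Nat.pair_eq_pair.1 hR
          rw [getD_map_range _ (unpair_fst_lt_pair two_ne_zero),
            getD_map_range _ (unpair_snd_lt_pair two_ne_zero)]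
          simp [decode_rexp_code, ha]
        | addConst R q =>
          rw [hR]
          obtain ⟨rfl, rfl⟩ := Nat.pair_eq_pair.1 hR
          rw [getD_map_range _ (unpair_fst_lt_pair three_ne_zero),
            getD_map_range _ (unpair_snd_lt_pair three_ne_zero)]
          simp [decode_rat_code, decode_rexp_code, hc]
      · rw [Bool.eq_false_iff.2 fun h => hR ((isRExpCode_iff _).1 h), decode_rexp_of_not hR]
        rfl)
  refine Primrec.option_some_iff.1 ?_
  refine (h.comp (g := fun a => (a, RExp.code (x a))) ?_).of_eq fun a => ?_
  · exact Primrec.id.pair (Primrec.encode.comp hx)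
  · simp [decode_rexp_code]

@[fun_prop] theorem primrec_rexp_smul {q : α → ℚ} {R : α → RExp} (hq : Primrec q)
    (hR : Primrec R) : Primrec fun a => RExp.smul (q a) (R a) :=
  Primrec.encode_iff.1 (show Primrec fun a => Nat.pair 1 (Nat.pair (ratCode (q a))
    (Encodable.encode (R a))) by fun_prop)

@[fun_prop] theorem primrec_rexp_var {r : α → ℕ} (hr : Primrec r) :
    Primrec fun a => RExp.var (r a) :=
  Primrec.encode_iff.1 (show Primrec fun a => Nat.pair 0 (r a) by fun_prop)

@[fun_prop] theorem primrec_rexp_add {R R' : α → RExp} (hR : Primrec R)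
    (hR' : Primrec R') : Primrec fun a => RExp.add (R a) (R' a) :=
  Primrec.encode_iff.1 (show Primrec fun a => Nat.pair 2 (Nat.pair (Encodable.encode (R a))
    (Encodable.encode (R' a))) by fun_prop)

@[fun_prop] theorem primrec_rexp_addConst {q : α → ℚ} {R : α → RExp} (hq : Primrec q)
    (hR : Primrec R) : Primrec fun a => RExp.addConst (R a) (q a) :=
  Primrec.encode_iff.1 (show Primrec fun a => Nat.pair 3 (Nat.pair (Encodable.encode (R a))
    (ratCode (q a))) by fun_prop)

@[fun_prop] theorem primrec_rexp_vars {R : α → RExp} (hR : Primrec R) :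
    Primrec fun a => (R a).vars :=
  primrec_rexp_rec (f := fun _ R => R.vars) (fun _ r => [r]) (fun _ _ l => l)
    (fun _ l l' => l ++ l') (fun _ l _ => l) (by fun_prop) (by fun_prop) (by fun_prop)
    (by fun_prop) (fun _ _ => rfl) (fun _ _ _ => rfl) (fun _ _ _ => rfl) (fun _ _ _ => rfl) hR

/-! ### Boolean expressions -/

/-- A Boolean expression as an element of a sum type. -/
def BExp.toSum : BExp → (RExp × Cmp × RExp) ⊕ (RExp × Cmp × ℕ) ⊕ (ℕ × Cmp × ℕ)
  | .realReal R c R' => .inl (R, c, R')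
  | .realDom R c x => .inr (.inl (R, c, x))
  | .domDom x c y => .inr (.inr (x, c, y))

/-- The inverse of `BExp.toSum`. -/
def BExp.ofSum : (RExp × Cmp × RExp) ⊕ (RExp × Cmp × ℕ) ⊕ (ℕ × Cmp × ℕ) → BExp
  | .inl (R, c, R') => .realReal R c R'
  | .inr (.inl (R, c, x)) => .realDom R c x
  | .inr (.inr (x, c, y)) => .domDom x c y

theorem BExp.ofSum_toSum (B : BExp) : BExp.ofSum B.toSum = B := by cases B <;> rfl

/-- Decodes a Boolean expression, as an element of a sum type. -/
noncomputable def decodeBExpSum (n : ℕ) :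
    Option ((RExp × Cmp × RExp) ⊕ (RExp × Cmp × ℕ) ⊕ (ℕ × Cmp × ℕ)) :=
  let s := n.unpair.2
  cond (decide (n.unpair.1 = 0))
    ((Encodable.decode s : Option (RExp × Cmp × RExp)).map Sum.inl)
  (cond (decide (n.unpair.1 = 1))
    ((Encodable.decode s : Option (RExp × Cmp × ℕ)).map fun y => Sum.inr (Sum.inl y))
  (cond (decide (n.unpair.1 = 2))
    ((Encodable.decode s : Option (ℕ × Cmp × ℕ)).map fun y => Sum.inr (Sum.inr y)) none))

theorem primrec_decodeBExpSum : Primrec decodeBExpSum := by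
  unfold decodeBExpSum
  fun_prop

/-- A Boolean expression is coded as a tag paired with the standard encoding of the tuple of its
parts, so each identification below is definitional. -/
theorem decodeBExpSum_code (B : BExp) : decodeBExpSum B.code = some B.toSum := by
  cases B with
  | realReal R c R' =>
    have : BExp.code (.realReal R c R') = Nat.pair 0 (Encodable.encode (R, c, R')) := rfl
    rw [this]
    simp [decodeBExpSum, BExp.toSum]
  | realDom R c x =>
    have : BExp.code (.realDom R c x) = Nat.pair 1 (Encodable.encode (R, c, x)) := rfl
    rw [this]
    simp [decodeBExpSum, BExp.toSum]
  | domDom x c y =>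
    have : BExp.code (.domDom x c y) = Nat.pair 2 (Encodable.encode (x, c, y)) := rfl
    rw [this]
    simp [decodeBExpSum, BExp.toSum]

theorem primrec_code_ofSum : Primrec fun s => (BExp.ofSum s).code := by
  have h : Primrec fun s : (RExp × Cmp × RExp) ⊕ (RExp × Cmp × ℕ) ⊕ (ℕ × Cmp × ℕ) =>
      Sum.elim (fun y => Nat.pair 0 (Encodable.encode y))
        (fun z => Sum.elim (fun y => Nat.pair 1 (Encodable.encode y))
          (fun y => Nat.pair 2 (Encodable.encode y)) z) s := by fun_prop
  refine h.of_eq fun s => ?_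
  rcases s with ⟨R, c, R'⟩ | ⟨R, c, x⟩ | ⟨x, c, y⟩ <;> rfl

/-- Recognizes the codes of Boolean expressions. -/
noncomputable def isBExpCode (n : ℕ) : Bool :=
  (decodeBExpSum n).elim false fun s => decide ((BExp.ofSum s).code = n)

/-- Re-encoding the decoded candidate and comparing it with n decides membership, so malformed
numbers need no separate analysis. -/
theorem isBExpCode_iff (n : ℕ) : isBExpCode n = true ↔ ∃ B, BExp.code B = n := by
  unfold isBExpCode
  constructor
  · intro h
    cases hs : decodeBExpSum n with
    | none => rw [hs] at h; simp at h
    | some s => rw [hs] at h; exact ⟨_, by simpa using h⟩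
  · rintro ⟨B, rfl⟩
    rw [decodeBExpSum_code]
    simp [BExp.ofSum_toSum]

theorem primrec_isBExpCode : Primrec isBExpCode := by
  unfold isBExpCode
  exact primrec_option_elim primrec_decodeBExpSum (Primrec.const _)
    (primrec_decide_eq (primrec_code_ofSum.comp Primrec.snd) Primrec.fst)

noncomputable instance instPrimcodableBExp : Primcodable BExp :=
  primcodableOfCode BExp.code BExp.code_injective isBExpCode primrec_isBExpCode isBExpCode_iff

@[fun_prop] theorem primrec_bexp_toSum {B : α → BExp} (hB : Primrec B) :
    Primrec fun a => (B a).toSum := by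
  refine Primrec.option_some_iff.1 ((primrec_decodeBExpSum.comp (Primrec.encode.comp hB)).of_eq
    fun a => decodeBExpSum_code _)

@[fun_prop] theorem primrec_bexp_ofSum {s : α → (RExp × Cmp × RExp) ⊕ (RExp × Cmp × ℕ) ⊕
    (ℕ × Cmp × ℕ)} (hs : Primrec s) : Primrec fun a => BExp.ofSum (s a) :=
  Primrec.encode_iff.1 (primrec_code_ofSum.comp hs)

end

/-! ### Statements -/

section

variable {α : Type*} [Primcodable α]

/-- Recognizes the codes of positive rational numbers. -/
noncomputable def isPosRatCode (n : ℕ) : Bool :=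
  (Encodable.decode n : Option ℚ).elim false
    fun q => decide (0 < q) && decide (ratCode q = n)

theorem isPosRatCode_iff (n : ℕ) : isPosRatCode n = true ↔ ∃ a : PosRat, ratCode a.1 = n := by
  unfold isPosRatCode
  constructor
  · intro h
    cases hs : (Encodable.decode n : Option ℚ) with
    | none => rw [hs] at h; simp at h
    | some s =>
      rw [hs] at h
      simp only [Option.elim_some, Bool.and_eq_true, decide_eq_true_eq] at h
      exact ⟨⟨s, h.1⟩, h.2⟩
  · rintro ⟨a, rfl⟩
    rw [decode_rat_code]
    simp [a.2]

@[fun_prop] theorem primrec_isPosRatCode {n : α → ℕ} (hn : Primrec n) :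
    Primrec fun a => isPosRatCode (n a) := by
  unfold isPosRatCode
  fun_prop

@[fun_prop] theorem primrec_isBExpCode_comp {n : α → ℕ} (hn : Primrec n) :
    Primrec fun a => isBExpCode (n a) := primrec_isBExpCode.comp hn

theorem exists_stmt_code_pair (t s : ℕ) : (∃ S, Stmt.code S = Nat.pair t s) ↔
    (t = 0 ∧ ∃ d, ratCode d = s.unpair.2) ∨
    (t = 1 ∧ s.unpair.1 < 2 ∧ ∃ a : PosRat, ratCode a.1 = s.unpair.2.unpair.2.unpair.2) ∨
    (t = 2 ∧ ∃ R, RExp.code R = s.unpair.2) ∨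
    (t = 3 ∧ (∃ B, BExp.code B = s.unpair.1) ∧ (∃ S, Stmt.code S = s.unpair.2.unpair.1) ∧
      ∃ S, Stmt.code S = s.unpair.2.unpair.2) ∨
    (t = 4 ∧ s = 0) ∨
    (t = 5 ∧ (∃ S, Stmt.code S = s.unpair.1) ∧ ∃ S, Stmt.code S = s.unpair.2) := by
  constructor
  · rintro ⟨S, h⟩
    cases S with
    | sample k r x a =>
      obtain ⟨rfl, rfl⟩ := Nat.pair_eq_pair.1 h
      refine .inr (.inl ⟨rfl, ?_, a, by simp⟩)
      cases k <;> simp [Family.code]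
    | _ => obtain ⟨rfl, rfl⟩ := Nat.pair_eq_pair.1 h; simp
  · rintro (⟨rfl, d, hd⟩ | ⟨rfl, hk, a, ha⟩ | ⟨rfl, R, hR⟩ | ⟨rfl, ⟨B, hB⟩, ⟨S, hS⟩, S', hS'⟩ |
      ⟨rfl, rfl⟩ | ⟨rfl, ⟨S, hS⟩, S', hS'⟩)
    · exact ⟨.assignDom s.unpair.1 d, by rw [Stmt.code, hd, Nat.pair_unpair]⟩
    · obtain ⟨k, hk⟩ : ∃ k : Family, k.code = s.unpair.1 := by
        generalize s.unpair.1 = m at hk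
        interval_cases m
        exacts [⟨.gaussian, rfl⟩, ⟨.laplace, rfl⟩]
      exact ⟨.sample k s.unpair.2.unpair.1 s.unpair.2.unpair.2.unpair.1 a, by
        rw [Stmt.code, hk, ha, Nat.pair_unpair, Nat.pair_unpair, Nat.pair_unpair]⟩
    · exact ⟨.assignReal s.unpair.1 R, by rw [Stmt.code, hR, Nat.pair_unpair]⟩
    · exact ⟨.ite B S S', by rw [Stmt.code, hB, hS, hS', Nat.pair_unpair, Nat.pair_unpair]⟩
    · exact ⟨.skip, rfl⟩
    · exact ⟨.seq S S', by rw [Stmt.code, hS, hS', Nat.pair_unpair]⟩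

open Classical in
/-- Recognizes the codes of statements. -/
noncomputable def isStmtCode (n : ℕ) : Bool := decide (∃ S, Stmt.code S = n)

theorem isStmtCode_iff (n : ℕ) : isStmtCode n = true ↔ ∃ S, Stmt.code S = n := by
  simp [isStmtCode]

theorem unpair_snd_unpair_fst_lt_pair {t a : ℕ} (ht : t ≠ 0) :
    a.unpair.2.unpair.1 < Nat.pair t a :=
  (Nat.unpair_left_le _).trans_lt (unpair_snd_lt_pair ht)

theorem unpair_snd_unpair_snd_lt_pair {t a : ℕ} (ht : t ≠ 0) :
    a.unpair.2.unpair.2 < Nat.pair t a :=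
  (Nat.unpair_right_le _).trans_lt (unpair_snd_lt_pair ht)

@[fun_prop] theorem primrec_isStmtCode {n : α → ℕ} (hn : Primrec n) :
    Primrec fun a => isStmtCode (n a) := by
  have h := primrec_treeRec (fun _ : Unit => isStmtCode)
    (fun _ t s l => (decide (t = 0) && isRatCode s.unpair.2) ||
      ((decide (t = 1) && (decide (s.unpair.1 < 2) && isPosRatCode s.unpair.2.unpair.2.unpair.2)) ||
      ((decide (t = 2) && isRExpCode s.unpair.2) ||
      ((decide (t = 3) && (isBExpCode s.unpair.1 && (l.getD s.unpair.2.unpair.1 false &&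
        l.getD s.unpair.2.unpair.2 false))) ||
      ((decide (t = 4) && decide (s = 0)) ||
      (decide (t = 5) && (l.getD s.unpair.1 false && l.getD s.unpair.2 false)))))))
      (by fun_prop) (by
      intro _ t s
      rw [Bool.eq_iff_iff, isStmtCode_iff, exists_stmt_code_pair]
      by_cases ht : t = 0
      · simp [ht, isRatCode_iff]
      · rw [getD_map_range _ (unpair_fst_lt_pair ht), getD_map_range _ (unpair_snd_lt_pair ht),
          getD_map_range _ (unpair_snd_unpair_fst_lt_pair ht),
          getD_map_range _ (unpair_snd_unpair_snd_lt_pair ht)]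
        simp only [Bool.or_eq_true, Bool.and_eq_true, decide_eq_true_eq, isRExpCode_iff,
          isRatCode_iff, isPosRatCode_iff, isBExpCode_iff, isStmtCode_iff])
  exact h.comp (g := fun a => ((), n a)) (by fun_prop)

noncomputable instance instPrimcodableStmt : Primcodable Stmt :=
  primcodableOfCode Stmt.code Stmt.code_injective isStmtCode (by fun_prop) isStmtCode_iff

theorem decode_stmt_code (S : Stmt) : (Encodable.decode S.code : Option Stmt) = some S :=
  Encodable.encodek S

theorem decode_stmt_of_not {n : ℕ} (h : ¬ ∃ S, Stmt.code S = n) :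
    (Encodable.decode n : Option Stmt) = none :=
  dif_neg h

/-- Structural recursion on statements is primitive recursive. -/
theorem primrec_stmt_rec {σ : Type*} [Primcodable σ] {f : α → Stmt → σ}
    (fd : α → ℕ × ℚ → σ) (fs : α → Family × ℕ × ℕ × ℚ → σ) (fr : α → ℕ × RExp → σ)
    (fi : α → BExp → σ → σ → σ) (fk : α → σ) (fq : α → σ → σ → σ)
    (hfd : Primrec fun p : α × ℕ × ℚ => fd p.1 p.2)
    (hfs : Primrec fun p : α × Family × ℕ × ℕ × ℚ => fs p.1 p.2)
    (hfr : Primrec fun p : α × ℕ × RExp => fr p.1 p.2)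
    (hfi : Primrec fun p : α × BExp × σ × σ => fi p.1 p.2.1 p.2.2.1 p.2.2.2)
    (hfk : Primrec fk)
    (hfq : Primrec fun p : α × σ × σ => fq p.1 p.2.1 p.2.2)
    (hd : ∀ a x d, f a (.assignDom x d) = fd a (x, d))
    (hs : ∀ a k r x c, f a (.sample k r x c) = fs a (k, r, x, c.1))
    (hr : ∀ a r R, f a (.assignReal r R) = fr a (r, R))
    (hi : ∀ a B S S', f a (.ite B S S') = fi a B (f a S) (f a S'))
    (hk : ∀ a, f a .skip = fk a)
    (hq : ∀ a S S', f a (.seq S S') = fq a (f a S) (f a S'))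
    {x : α → Stmt} (hx : Primrec x) : Primrec fun a => f a (x a) := by
  have h := primrec_treeRec (fun a n => (Encodable.decode n : Option Stmt).map (f a))
    (fun a t s l => cond (isStmtCode (Nat.pair t s))
      (cond (decide (t = 0)) ((Encodable.decode s : Option (ℕ × ℚ)).map fun y => fd a y)
      (cond (decide (t = 1)) ((Encodable.decode s : Option (Family × ℕ × ℕ × ℚ)).map
        fun y => fs a y)
      (cond (decide (t = 2)) ((Encodable.decode s : Option (ℕ × RExp)).map fun y => fr a y)
      (cond (decide (t = 3)) ((Encodable.decode s.unpair.1 : Option BExp).bind fun B =>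
        (l.getD s.unpair.2.unpair.1 none).bind fun y =>
        (l.getD s.unpair.2.unpair.2 none).map fun z => fi a B y z)
      (cond (decide (t = 4)) (some (fk a))
      ((l.getD s.unpair.1 none).bind fun y =>
        (l.getD s.unpair.2 none).map fun z => fq a y z)))))) none) (by fun_prop) (by
      intro a t s
      by_cases hS : ∃ S, Stmt.code S = Nat.pair t s
      · rw [(isStmtCode_iff _).2 hS]
        obtain ⟨S, hS⟩ := hS
        rw [← hS, decode_stmt_code]
        cases S with
        | assignDom x d =>
          obtain ⟨rfl, rfl⟩ := Nat.pair_eq_pair.1 hS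
          have : Nat.pair x (ratCode d) = Encodable.encode (x, d) := rfl
          rw [this, Encodable.encodek]
          simp [hd]
        | sample k r x c =>
          obtain ⟨rfl, rfl⟩ := Nat.pair_eq_pair.1 hS
          have : Nat.pair k.code (Nat.pair r (Nat.pair x (ratCode c.1))) =
            Encodable.encode (k, r, x, c.1) := rfl
          rw [this, Encodable.encodek]
          simp [hs]
        | assignReal r R =>
          obtain ⟨rfl, rfl⟩ := Nat.pair_eq_pair.1 hS
          have : Nat.pair r R.code = Encodable.encode (r, R) := rfl
          rw [this, Encodable.encodek]
          simp [hr]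
        | ite B S S' =>
          rw [hS]
          obtain ⟨rfl, rfl⟩ := Nat.pair_eq_pair.1 hS
          rw [getD_map_range _ (unpair_snd_unpair_fst_lt_pair three_ne_zero),
            getD_map_range _ (unpair_snd_unpair_snd_lt_pair three_ne_zero)]
          have : B.code = Encodable.encode B := rfl
          simp [decode_stmt_code, hi, this]
        | skip =>
          obtain ⟨rfl, rfl⟩ := Nat.pair_eq_pair.1 hS
          simp [hk]
        | seq S S' =>
          rw [hS]
          obtain ⟨rfl, rfl⟩ := Nat.pair_eq_pair.1 hS
          rw [getD_map_range _ (unpair_fst_lt_pair (by norm_num)),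
            getD_map_range _ (unpair_snd_lt_pair (by norm_num))]
          simp [decode_stmt_code, hq]
      · rw [Bool.eq_false_iff.2 fun h => hS ((isStmtCode_iff _).1 h), decode_stmt_of_not hS]
        rfl)
  refine Primrec.option_some_iff.1 ?_
  refine (h.comp (g := fun a => (a, Stmt.code (x a))) ?_).of_eq fun a => ?_
  · exact Primrec.id.pair (Primrec.encode.comp hx)
  · simp [decode_stmt_code]

end

/-! ## The approximation algorithm -/

/-- Assignments of rational values to variables. -/
abbrev Asg : Type := List (ℕ × ℚ)

/-- Recorded distributions (family, mean, scale) or expressions. -/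
abbrev Entry : Type := (Family × ℚ × ℚ) ⊕ RExp

/-- Instructions on a control path: assignment, sampling, real assignment, test. -/
abbrev Instr : Type := (ℕ × ℚ) ⊕ (Family × ℕ × ℕ × ℚ) ⊕ (ℕ × RExp) ⊕ BExp

/-- Finitary presentations of states. -/
abbrev SymState : Type := Asg × List (ℕ × Entry) × List BExp

/-- The sequences of instructions along the control paths of a statement. -/
def Stmt.instrPaths : Stmt → List (List Instr)
  | .assignDom x d => [[.inl (x, d)]]
  | .sample k r x a => [[.inr (.inl (k, r, x, a.1))]]
  | .assignReal r R => [[.inr (.inr (.inl (r, R)))]]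
  | .ite B S₁ S₂ => S₁.instrPaths.map (fun p => .inr (.inr (.inr B)) :: p) ++
      S₂.instrPaths.map (fun p => .inr (.inr (.inr B.neg)) :: p)
  | .skip => [[]]
  | .seq S₁ S₂ => S₁.instrPaths.flatMap fun p => S₂.instrPaths.map fun q => p ++ q

/-- The value of a variable, zero by default. -/
def asgVal (l : Asg) (x : ℕ) : ℚ := (l.lookup x).getD 0

/-- Replaces the variables with a recorded expression. -/
def substEntries (b : List (ℕ × Entry)) : RExp → RExp
  | .var r => (b.lookup r).elim (.var r) (Sum.elim (fun _ => .var r) fun R => R)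
  | .smul q R => .smul q (substEntries b R)
  | .add R₁ R₂ => .add (substEntries b R₁) (substEntries b R₂)
  | .addConst R q => .addConst (substEntries b R) q

/-- Executes an instruction. -/
def symStep (ε : ℚ) (st : SymState) (i : Instr) : SymState :=
  Sum.elim (fun p => (p :: st.1, st.2.1, st.2.2))
    (Sum.elim (fun p => (st.1, (p.2.1, .inl (p.1, asgVal st.1 p.2.2.1, p.2.2.2 / ε)) :: st.2.1,
      st.2.2))
    (Sum.elim (fun p => (st.1, (p.1, .inr (substEntries st.2.1 p.2)) :: st.2.1, st.2.2))
      fun B => (st.1, st.2.1, B :: st.2.2))) i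

/-- Executes a path. -/
def symRun (ε : ℚ) (st : SymState) (p : List Instr) : SymState := p.foldl (symStep ε) st

/-- The value of a real expression under a rational valuation. -/
def RExp.evalQ (v : ℕ → ℚ) : RExp → ℚ
  | .var r => v r
  | .smul q R => q * R.evalQ v
  | .add R₁ R₂ => R₁.evalQ v + R₂.evalQ v
  | .addConst R q => R.evalQ v + q

/-- The value of a real variable when the independent variables have the values `c`. -/
def randQ (b : List (ℕ × Entry)) (c : Asg) (r : ℕ) : ℚ :=
  (b.lookup r).elim 0 (Sum.elim (fun _ => asgVal c r) fun R => R.evalQ (asgVal c))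

/-- The comparison symbol of a Boolean expression. -/
def BExp.cmp (B : BExp) : Cmp :=
  Sum.elim (fun p => p.2.1) (Sum.elim (fun p => p.2.1) fun p => p.2.1) B.toSum

/-- The difference of the two sides of a Boolean expression. -/
def gapQ (st : SymState) (c : Asg) (B : BExp) : ℚ :=
  Sum.elim (fun p => p.1.evalQ (randQ st.2.1 c) - p.2.2.evalQ (randQ st.2.1 c))
    (Sum.elim (fun p => p.1.evalQ (randQ st.2.1 c) - asgVal st.1 p.2.2)
      fun p => asgVal st.1 p.1 - asgVal st.1 p.2.2) B.toSum

/-- Whether a comparison holds, in terms of the difference of its sides being negative and being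
zero. -/
def Cmp.ofSign : Cmp → Bool → Bool → Bool
  | .eq, _, z => z
  | .le, n, z => n || z
  | .lt, n, _ => n
  | .ge, n, _ => !n
  | .gt, n, z => !n && !z
  | .ne, _, z => !z

/-- Whether a Boolean expression holds. -/
def holdsQ (st : SymState) (c : Asg) (B : BExp) : Bool :=
  B.cmp.ofSign (decide (gapQ st c B < 0)) (decide (gapQ st c B = 0))

/-- The variables with a recorded distribution. -/
def sampledVars (b : List (ℕ × Entry)) : List ℕ :=
  (List.range (1 + (b.map fun p => p.1).sum)).filter fun v =>
    (b.lookup v).elim false (Sum.elim (fun _ => true) fun _ => false)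

/-- A Lipschitz constant of the difference of the two sides. -/
def spreadQ (st : SymState) (B : BExp) : ℚ :=
  ((sampledVars st.2.1).map fun v => |gapQ st [(v, 1)] B - gapQ st [] B|).sum

/-- The sign of the difference of the two sides is constant on the cell of mesh `1 / (m + 1)`
with corner `c`. -/
def decidedQ (st : SymState) (m : ℕ) (c : Asg) (B : BExp) : Bool :=
  decide (spreadQ st B = 0) || decide (spreadQ st B / ((m + 1 : ℕ) : ℚ) < |gapQ st c B|)

/-- All assignments of values from a list to the given variables. -/
def assigns (ys : List ℕ) (vals : List ℚ) : List Asg :=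
  ys.foldr (fun y acc => vals.flatMap fun d => acc.map fun l => (y, d) :: l) [[]]

/-- The grid of mesh `1 / (m + 1)` in `[-(m + 1), m + 1)`. -/
def grid (m : ℕ) : List ℚ :=
  (List.range (2 * ((m + 1) * (m + 1)))).map fun i : ℕ =>
    (i : ℚ) / ((m + 1 : ℕ) : ℚ) - ((m + 1 : ℕ) : ℚ)

/-- The scale, made positive. -/
def fixScale (s : ℚ) : ℚ := cond (decide (0 < s)) s 1

/-- The negative logarithm of the density, up to a constant. -/
def rateQ (k : Family) (μ s x : ℚ) : ℚ :=
  cond (decide (k = .gaussian)) ((x - μ) ^ 2 / (2 * s ^ 2)) (|x - μ| / s)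

/-- A lower bound for `exp (-T)`. -/
def expNegLow (N : ℕ) (T : ℚ) : ℚ := max 0 (1 - T / (N : ℚ)) ^ N

/-- The product of `(2 i + 1) / (2 i + 2)` over `i < n`. -/
def wallisProd (n : ℕ) : ℚ :=
  ((List.range n).map fun i => ((2 * i + 1 : ℕ) : ℚ) / ((2 * i + 2 : ℕ) : ℚ)).prod

/-- A lower bound for the normalizing factor of the density. -/
def normLow (k : Family) (s : ℚ) (N : ℕ) : ℚ :=
  cond (decide (k = .gaussian)) (wallisProd (2 * (N * N)) * (N : ℚ) / s) (1 / (2 * s))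

/-- A lower bound for the probability of the cell of mesh `1 / (m + 1)` with corner `x`. -/
def weight (e : Family × ℚ × ℚ) (m : ℕ) (x : ℚ) : ℚ :=
  normLow e.1 (fixScale e.2.2) (m + 1) *
    expNegLow (m + 1) (max (rateQ e.1 e.2.1 (fixScale e.2.2) x)
      (rateQ e.1 e.2.1 (fixScale e.2.2) (x + 1 / ((m + 1 : ℕ) : ℚ)))) / ((m + 1 : ℕ) : ℚ)

/-- The weight of a coordinate of a cell. -/
def entryWeight (b : List (ℕ × Entry)) (m : ℕ) (p : ℕ × ℚ) : ℚ :=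
  (b.lookup p.1).elim 0 (Sum.elim (fun e => weight e m p.2) fun _ => 0)

/-- The cell with corner `c` is decided, and there the conjunction of all conditions has the given
truth value. -/
def goodCell (t : Bool) (st : SymState) (m : ℕ) (c : Asg) : Bool :=
  st.2.2.all (fun B => decidedQ st m c B) && (st.2.2.all (fun B => holdsQ st c B) == t)

/-- A lower bound for the probability that the conjunction of all conditions has the given truth
value. -/
def lowerQ (t : Bool) (st : SymState) (m : ℕ) : ℚ :=
  ((assigns (sampledVars st.2.1) (grid m)).map fun c =>
    cond (goodCell t st m c) ((c.map fun p => entryWeight st.2.1 m p).prod) 0).sum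

/-- Bounds for the probability of a state from below and from above. -/
def probQ (up : Bool) (st : SymState) (m : ℕ) : ℚ :=
  cond up (1 - lowerQ false st m) (lowerQ true st m)

/-- Bounds for the exponential function from below and from above. -/
def expQ (up : Bool) (s : ℚ) (m : ℕ) : ℚ :=
  cond up ((1 - s / ((m + 1 + s.num.toNat : ℕ) : ℚ)) ^ (m + 1 + s.num.toNat))⁻¹
    ((1 + s / ((m + 1 : ℕ) : ℚ)) ^ (m + 1))

/-- The state has the given output. -/
def hasOutput (o : Asg) (st : SymState) : Bool :=
  o.all fun p => decide (st.1.lookup p.1 = some p.2)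

/-- Bounds for the probability of an output. -/
def outputQ (up : Bool) (S : Stmt) (ε : ℚ) (u o : Asg) (m : ℕ) : ℚ :=
  (S.instrPaths.map fun p => cond (hasOutput o (symRun ε (u, [], []) p))
    (probQ up (symRun ε (u, [], []) p) m) 0).sum

/-- Bounds for `deltaAdj`. -/
def deltaQ (up : Bool) (S : Stmt) (outs : List Asg) (ε εprv : ℚ) (u u' : Asg) (m : ℕ) : ℚ :=
  (outs.map fun o => max (outputQ up S ε u o m -
    expQ (!up) εprv m * outputQ (!up) S ε u' o m) 0).sum

/-- The data of an instance of the differential privacy problem: domain, inputs, outputs, body,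
adjacency relation, `ε`, `εprv` and `δ`. -/
abbrev RawProblem : Type :=
  (List ℚ × List ℕ × List ℕ × Stmt) × List (Asg × Asg) × ℚ × ℚ × ℚ

/-- At precision `m` the instance is recognized as not differentially private. -/
def notDPQ (r : RawProblem) (m : ℕ) : Bool :=
  r.2.1.any fun p => decide (r.2.2.2.2 < deltaQ false r.1.2.2.2 (assigns r.1.2.2.1 r.1.1)
    r.2.2.1 r.2.2.2.1 p.1 p.2 m)

/-- At precision `m` the instance is recognized as differentially private. -/
def isDPQ (r : RawProblem) (m : ℕ) : Bool :=
  r.2.1.all fun p => decide (deltaQ true r.1.2.2.2 (assigns r.1.2.2.1 r.1.1)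
    r.2.2.1 r.2.2.2.1 p.1 p.2 m < r.2.2.2.2)

/-! ### The algorithm is primitive recursive -/

section

variable {α : Type*} [Primcodable α]

@[fun_prop] theorem primrec_cmp_neg {c : α → Cmp} (hc : Primrec c) :
    Primrec fun a => (c a).neg := (Primrec.dom_finite Cmp.neg).comp hc

@[fun_prop] theorem primrec_bexp_neg {B : α → BExp} (hB : Primrec B) :
    Primrec fun a => (B a).neg := by
  have h : Primrec fun a => BExp.ofSum (Sum.elim (fun p => .inl (p.1, p.2.1.neg, p.2.2))
    (fun z => Sum.elim (fun p => .inr (.inl (p.1, p.2.1.neg, p.2.2)))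
      (fun p => .inr (.inr (p.1, p.2.1.neg, p.2.2))) z) (B a).toSum) := by fun_prop
  refine h.of_eq fun a => ?_
  cases B a <;> rfl

@[fun_prop] theorem primrec_instrPaths {S : α → Stmt} (hS : Primrec S) :
    Primrec fun a => (S a).instrPaths :=
  primrec_stmt_rec (f := fun _ S => S.instrPaths) (fun _ p => [[.inl p]])
    (fun _ p => [[.inr (.inl p)]]) (fun _ p => [[.inr (.inr (.inl p))]])
    (fun _ B l l' => l.map (fun p => .inr (.inr (.inr B)) :: p) ++
      l'.map (fun p => .inr (.inr (.inr B.neg)) :: p)) (fun _ => [[]])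
    (fun _ l l' => l.flatMap fun p => l'.map fun q => p ++ q)
    (by fun_prop) (by fun_prop) (by fun_prop) (by fun_prop) (by fun_prop) (by fun_prop)
    (fun _ _ _ => rfl) (fun _ _ _ _ _ => rfl) (fun _ _ _ => rfl) (fun _ _ _ _ => rfl)
    (fun _ => rfl) (fun _ _ _ => rfl) hS

@[fun_prop] theorem primrec_asgVal {l : α → Asg} {x : α → ℕ} (hl : Primrec l) (hx : Primrec x) :
    Primrec fun a => asgVal (l a) (x a) := by
  unfold asgVal; fun_prop

@[fun_prop] theorem primrec_substEntries {b : α → List (ℕ × Entry)} {R : α → RExp}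
    (hb : Primrec b) (hR : Primrec R) : Primrec fun a => substEntries (b a) (R a) :=
  primrec_rexp_rec (f := fun a R => substEntries (b a) R)
    (fun a r => ((b a).lookup r).elim (.var r) fun e => Sum.elim (fun _ => .var r) (fun R => R) e)
    (fun _ q R => .smul q R) (fun _ R R' => .add R R') (fun _ R q => .addConst R q)
    (by fun_prop) (by fun_prop) (by fun_prop) (by fun_prop) (fun _ _ => rfl) (fun _ _ _ => rfl)
    (fun _ _ _ => rfl) (fun _ _ _ => rfl) hR

@[fun_prop] theorem primrec_symStep {ε : α → ℚ} {st : α → SymState} {i : α → Instr}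
    (hε : Primrec ε) (hst : Primrec st) (hi : Primrec i) :
    Primrec fun a => symStep (ε a) (st a) (i a) := by
  have h : Primrec fun a => Sum.elim (fun p => (p :: (st a).1, (st a).2.1, (st a).2.2))
    (fun z => Sum.elim (fun p => ((st a).1, (p.2.1, Sum.inl (p.1, asgVal (st a).1 p.2.2.1,
      p.2.2.2 / ε a)) :: (st a).2.1, (st a).2.2))
    (fun z => Sum.elim (fun p => ((st a).1, (p.1, Sum.inr (substEntries (st a).2.1 p.2)) ::
      (st a).2.1, (st a).2.2))
      (fun B => ((st a).1, (st a).2.1, B :: (st a).2.2)) z) z) (i a) := by fun_prop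
  exact h

@[fun_prop] theorem primrec_symRun {ε : α → ℚ} {st : α → SymState} {p : α → List Instr}
    (hε : Primrec ε) (hst : Primrec st) (hp : Primrec p) :
    Primrec fun a => symRun (ε a) (st a) (p a) := by
  unfold symRun; fun_prop

@[fun_prop] theorem primrec_evalQ {v : α → ℕ → ℚ} {R : α → RExp}
    (hv : Primrec fun p : α × ℕ => v p.1 p.2) (hR : Primrec R) :
    Primrec fun a => (R a).evalQ (v a) :=
  primrec_rexp_rec (f := fun a R => R.evalQ (v a)) (fun a r => v a r) (fun _ q y => q * y)
    (fun _ y z => y + z) (fun _ y q => y + q)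
    (by fun_prop) (by fun_prop) (by fun_prop) (by fun_prop) (fun _ _ => rfl) (fun _ _ _ => rfl)
    (fun _ _ _ => rfl) (fun _ _ _ => rfl) hR

@[fun_prop] theorem primrec_randQ {b : α → List (ℕ × Entry)} {c : α → Asg} {r : α → ℕ}
    (hb : Primrec b) (hc : Primrec c) (hr : Primrec r) :
    Primrec fun a => randQ (b a) (c a) (r a) := by
  have h : Primrec fun a => ((b a).lookup (r a)).elim 0 fun e =>
    Sum.elim (fun _ => asgVal (c a) (r a)) (fun R => R.evalQ (fun x => asgVal (c a) x)) e := by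
    fun_prop
  exact h

@[fun_prop] theorem primrec_bexp_cmp {B : α → BExp} (hB : Primrec B) :
    Primrec fun a => (B a).cmp := by
  have h : Primrec fun a => Sum.elim (fun p => p.2.1)
    (fun z => Sum.elim (fun p => p.2.1) (fun p => p.2.1) z) (B a).toSum := by fun_prop
  exact h

@[fun_prop] theorem primrec_gapQ {st : α → SymState} {c : α → Asg} {B : α → BExp}
    (hst : Primrec st) (hc : Primrec c) (hB : Primrec B) :
    Primrec fun a => gapQ (st a) (c a) (B a) := by
  have h : Primrec fun a => Sum.elim
    (fun p => p.1.evalQ (fun x => randQ (st a).2.1 (c a) x) -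
      p.2.2.evalQ (fun x => randQ (st a).2.1 (c a) x))
    (fun z => Sum.elim
      (fun p => p.1.evalQ (fun x => randQ (st a).2.1 (c a) x) - asgVal (st a).1 p.2.2)
      (fun p => asgVal (st a).1 p.1 - asgVal (st a).1 p.2.2) z) (B a).toSum := by fun_prop
  exact h

@[fun_prop] theorem primrec_ofSign {c : α → Cmp} {n z : α → Bool} (hc : Primrec c)
    (hn : Primrec n) (hz : Primrec z) : Primrec fun a => (c a).ofSign (n a) (z a) :=
  (Primrec.dom_finite fun p : Cmp × Bool × Bool => p.1.ofSign p.2.1 p.2.2).comp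
    (hc.pair (hn.pair hz))

@[fun_prop] theorem primrec_holdsQ {st : α → SymState} {c : α → Asg} {B : α → BExp}
    (hst : Primrec st) (hc : Primrec c) (hB : Primrec B) :
    Primrec fun a => holdsQ (st a) (c a) (B a) := by
  unfold holdsQ; fun_prop

@[fun_prop] theorem primrec_sampledVars {b : α → List (ℕ × Entry)} (hb : Primrec b) :
    Primrec fun a => sampledVars (b a) := by
  have h : Primrec fun a => (List.range (1 + ((b a).map fun p => p.1).sum)).filter fun v =>
    ((b a).lookup v).elim false fun e => Sum.elim (fun _ => true) (fun _ => false) e := by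
    fun_prop
  exact h

@[fun_prop] theorem primrec_spreadQ {st : α → SymState} {B : α → BExp}
    (hst : Primrec st) (hB : Primrec B) : Primrec fun a => spreadQ (st a) (B a) := by
  unfold spreadQ; fun_prop

@[fun_prop] theorem primrec_decidedQ {st : α → SymState} {m : α → ℕ} {c : α → Asg} {B : α → BExp}
    (hst : Primrec st) (hm : Primrec m) (hc : Primrec c) (hB : Primrec B) :
    Primrec fun a => decidedQ (st a) (m a) (c a) (B a) := by
  unfold decidedQ; fun_prop

@[fun_prop] theorem primrec_assigns {ys : α → List ℕ} {vals : α → List ℚ}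
    (hys : Primrec ys) (hvals : Primrec vals) : Primrec fun a => assigns (ys a) (vals a) := by
  unfold assigns; fun_prop

@[fun_prop] theorem primrec_grid {m : α → ℕ} (hm : Primrec m) : Primrec fun a => grid (m a) := by
  unfold grid; fun_prop

@[fun_prop] theorem primrec_fixScale {s : α → ℚ} (hs : Primrec s) :
    Primrec fun a => fixScale (s a) := by
  unfold fixScale; fun_prop

@[fun_prop] theorem primrec_rateQ {k : α → Family} {μ s x : α → ℚ} (hk : Primrec k)
    (hμ : Primrec μ) (hs : Primrec s) (hx : Primrec x) :
    Primrec fun a => rateQ (k a) (μ a) (s a) (x a) := by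
  unfold rateQ; fun_prop

@[fun_prop] theorem primrec_expNegLow {N : α → ℕ} {T : α → ℚ} (hN : Primrec N)
    (hT : Primrec T) : Primrec fun a => expNegLow (N a) (T a) := by
  unfold expNegLow; fun_prop

@[fun_prop] theorem primrec_wallisProd {n : α → ℕ} (hn : Primrec n) :
    Primrec fun a => wallisProd (n a) := by
  unfold wallisProd; fun_prop

@[fun_prop] theorem primrec_normLow {k : α → Family} {s : α → ℚ} {N : α → ℕ} (hk : Primrec k)
    (hs : Primrec s) (hN : Primrec N) : Primrec fun a => normLow (k a) (s a) (N a) := by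
  unfold normLow; fun_prop

@[fun_prop] theorem primrec_weight {e : α → Family × ℚ × ℚ} {m : α → ℕ} {x : α → ℚ}
    (he : Primrec e) (hm : Primrec m) (hx : Primrec x) :
    Primrec fun a => weight (e a) (m a) (x a) := by
  unfold weight; fun_prop

@[fun_prop] theorem primrec_entryWeight {b : α → List (ℕ × Entry)} {m : α → ℕ} {p : α → ℕ × ℚ}
    (hb : Primrec b) (hm : Primrec m) (hp : Primrec p) :
    Primrec fun a => entryWeight (b a) (m a) (p a) := by
  have h : Primrec fun a => ((b a).lookup (p a).1).elim 0 fun e =>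
    Sum.elim (fun e => weight e (m a) (p a).2) (fun _ => 0) e := by fun_prop
  exact h

@[fun_prop] theorem primrec_goodCell {t : α → Bool} {st : α → SymState} {m : α → ℕ} {c : α → Asg}
    (ht : Primrec t) (hst : Primrec st) (hm : Primrec m) (hc : Primrec c) :
    Primrec fun a => goodCell (t a) (st a) (m a) (c a) := by
  unfold goodCell; fun_prop

@[fun_prop] theorem primrec_lowerQ {t : α → Bool} {st : α → SymState} {m : α → ℕ}
    (ht : Primrec t) (hst : Primrec st) (hm : Primrec m) :
    Primrec fun a => lowerQ (t a) (st a) (m a) := by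
  unfold lowerQ; fun_prop

@[fun_prop] theorem primrec_probQ {t : α → Bool} {st : α → SymState} {m : α → ℕ}
    (ht : Primrec t) (hst : Primrec st) (hm : Primrec m) :
    Primrec fun a => probQ (t a) (st a) (m a) := by
  unfold probQ; fun_prop

@[fun_prop] theorem primrec_expQ {t : α → Bool} {s : α → ℚ} {m : α → ℕ}
    (ht : Primrec t) (hs : Primrec s) (hm : Primrec m) :
    Primrec fun a => expQ (t a) (s a) (m a) := by
  unfold expQ; fun_prop

@[fun_prop] theorem primrec_hasOutput {o : α → Asg} {st : α → SymState}
    (ho : Primrec o) (hst : Primrec st) : Primrec fun a => hasOutput (o a) (st a) := by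
  unfold hasOutput; fun_prop

@[fun_prop] theorem primrec_outputQ {t : α → Bool} {S : α → Stmt} {ε : α → ℚ} {u o : α → Asg}
    {m : α → ℕ} (ht : Primrec t) (hS : Primrec S) (hε : Primrec ε) (hu : Primrec u)
    (ho : Primrec o) (hm : Primrec m) :
    Primrec fun a => outputQ (t a) (S a) (ε a) (u a) (o a) (m a) := by
  unfold outputQ; fun_prop

@[fun_prop] theorem primrec_deltaQ {t : α → Bool} {S : α → Stmt} {outs : α → List Asg}
    {ε εprv : α → ℚ} {u u' : α → Asg} {m : α → ℕ} (ht : Primrec t) (hS : Primrec S)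
    (houts : Primrec outs) (hε : Primrec ε) (hεprv : Primrec εprv) (hu : Primrec u)
    (hu' : Primrec u') (hm : Primrec m) :
    Primrec fun a => deltaQ (t a) (S a) (outs a) (ε a) (εprv a) (u a) (u' a) (m a) := by
  unfold deltaQ; fun_prop

@[fun_prop] theorem primrec_notDPQ {r : α → RawProblem} {m : α → ℕ} (hr : Primrec r)
    (hm : Primrec m) : Primrec fun a => notDPQ (r a) (m a) := by
  unfold notDPQ; fun_prop

@[fun_prop] theorem primrec_isDPQ {r : α → RawProblem} {m : α → ℕ} (hr : Primrec r)
    (hm : Primrec m) : Primrec fun a => isDPQ (r a) (m a) := by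
  unfold isDPQ; fun_prop

end

open Filter Topology

/-! ## One-dimensional approximation -/

/-- Symbolic entries carry no proof that the scale is positive. Repairing the scale makes every
entry denote a distribution; scales arising from programs are not changed by the repair. -/
theorem fixScale_pos (s : ℚ) : 0 < fixScale s := by
  unfold fixScale
  by_cases h : 0 < s
  · rw [decide_eq_true h]; exact h
  · rw [decide_eq_false h]; exact one_pos

/-- The distribution of an entry. -/
def entryDistr (e : Family × ℚ × ℚ) : Distr := ⟨e.1, e.2.1, ⟨fixScale e.2.2, fixScale_pos _⟩⟩

/-- The negative logarithm of the density, up to a constant. -/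
noncomputable def rate (k : Family) (μ s x : ℝ) : ℝ :=
  match k with
  | .gaussian => (x - μ) ^ 2 / (2 * s ^ 2)
  | .laplace => |x - μ| / s

/-- The normalizing factor of the density. -/
noncomputable def normFactor (k : Family) (s : ℝ) : ℝ :=
  match k with
  | .gaussian => (√(2 * Real.pi * s ^ 2))⁻¹
  | .laplace => 1 / (2 * s)

theorem rateQ_cast (k : Family) (μ s x : ℚ) : ((rateQ k μ s x : ℚ) : ℝ) = rate k μ s x := by
  cases k <;> simp [rateQ, rate]

theorem normFactor_nonneg (k : Family) {s : ℝ} (hs : 0 < s) : 0 ≤ normFactor k s := by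
  cases k <;> simp only [normFactor] <;> positivity

theorem continuous_rate (k : Family) (μ s : ℝ) : Continuous (rate k μ s) := by
  cases k
  · exact ((continuous_id.sub continuous_const).pow 2).div_const _
  · exact ((continuous_id.sub continuous_const).abs).div_const _

/-- For both families the rate is an increasing function of |y - μ|, and this distance is largest at
an endpoint of an interval. Hence two evaluations bound the density from below on a cell. -/
theorem rate_le_max (k : Family) (μ : ℝ) {s x y z : ℝ} (hs : 0 < s) (h1 : x ≤ y) (h2 : y ≤ z) :
    rate k μ s y ≤ max (rate k μ s x) (rate k μ s z) := by
  have key : |y - μ| ≤ max |x - μ| |z - μ| := by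
    apply abs_le_max_abs_abs <;> linarith
  have mono : ∀ a b : ℝ, |a - μ| ≤ |b - μ| → rate k μ s a ≤ rate k μ s b := by
    intro a b hab
    cases k
    · simp only [rate]
      have := sq_le_sq.2 hab
      gcongr
    · simp only [rate]
      gcongr
  rcases le_max_iff.1 key with h | h
  · exact le_max_of_le_left (mono _ _ h)
  · exact le_max_of_le_right (mono _ _ h)

/-- The density of an entry. -/
noncomputable def entryDensity (e : Family × ℚ × ℚ) (x : ℝ) : ℝ :=
  normFactor e.1 (fixScale e.2.2) * Real.exp (-rate e.1 e.2.1 (fixScale e.2.2) x)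

theorem fixScale_cast_pos (s : ℚ) : (0 : ℝ) < fixScale s := by exact_mod_cast fixScale_pos s

theorem entryDensity_nonneg (e : Family × ℚ × ℚ) (x : ℝ) : 0 ≤ entryDensity e x :=
  mul_nonneg (normFactor_nonneg _ (fixScale_cast_pos _)) (Real.exp_pos _).le

theorem continuous_entryDensity (e : Family × ℚ × ℚ) : Continuous (entryDensity e) :=
  continuous_const.mul (Real.continuous_exp.comp (continuous_rate _ _ _).neg)

/-- A common density formula for the two families; the later estimates on cells do not distinguish
them. -/
theorem law_eq_withDensity (e : Family × ℚ × ℚ) :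
    (entryDistr e).law = volume.withDensity fun x => ENNReal.ofReal (entryDensity e x) := by
  obtain ⟨k, μ, s⟩ := e
  have hs := fixScale_cast_pos s
  cases k
  · have hv : Real.toNNReal ((fixScale s : ℝ) ^ 2) ≠ 0 := by
      rw [ne_eq, Real.toNNReal_eq_zero, not_le]; positivity
    simp only [Distr.law, entryDistr]
    rw [gaussianReal_of_var_ne_zero _ hv]
    congr 1
    funext x
    simp only [gaussianPDF, gaussianPDFReal, entryDensity, normFactor, rate]
    rw [Real.coe_toNNReal _ (by positivity), neg_div]
  · simp only [Distr.law, entryDistr, laplaceReal]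
    congr 1
    funext x
    simp only [laplaceDensity, entryDensity, normFactor, rate, neg_div]

theorem lintegral_entryDensity (e : Family × ℚ × ℚ) :
    ∫⁻ x, ENNReal.ofReal (entryDensity e x) = 1 := by
  have h : (entryDistr e).law Set.univ = 1 := measure_univ
  rwa [law_eq_withDensity, withDensity_apply _ MeasurableSet.univ, Measure.restrict_univ] at h

theorem integrable_entryDensity (e : Family × ℚ × ℚ) : Integrable (entryDensity e) := by
  refine ⟨(continuous_entryDensity e).aestronglyMeasurable, ?_⟩
  rw [hasFiniteIntegral_iff_ofReal (ae_of_all _ (entryDensity_nonneg e)), lintegral_entryDensity]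
  exact ENNReal.one_lt_top

theorem integral_entryDensity (e : Family × ℚ × ℚ) : ∫ x, entryDensity e x = 1 := by
  rw [integral_eq_lintegral_of_nonneg_ae (ae_of_all _ (entryDensity_nonneg e))
    (continuous_entryDensity e).aestronglyMeasurable, lintegral_entryDensity, ENNReal.toReal_one]

/-! ### Bounds for the exponential function and for the normalizing factor -/

theorem expNegLow_nonneg (N : ℕ) (T : ℚ) : 0 ≤ expNegLow N T := by
  unfold expNegLow; positivity

/-- The inequality (1 - T/N)^N ≤ exp(-T) is used for T ≤ N. Beyond that the base is cut off at 0,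
and N ≠ 0 makes the power 0. -/
theorem expNegLow_le {N : ℕ} (hN : N ≠ 0) {T : ℚ} :
    ((expNegLow N T : ℚ) : ℝ) ≤ Real.exp (-(T : ℝ)) := by
  unfold expNegLow
  push_cast
  rcases le_total (T : ℝ) N with h | h
  · rw [max_eq_right]
    · exact Real.one_sub_div_pow_le_exp_neg h
    · rw [sub_nonneg]
      exact div_le_one_of_le₀ h (by positivity)
  · rw [max_eq_left, zero_pow hN]
    · positivity
    · rw [sub_nonpos, one_le_div (by positivity)]
      exact h

theorem tendsto_expNegLow {T : ℕ → ℚ} {t : ℝ} (hT : Tendsto (fun m => (T m : ℝ)) atTop (𝓝 t)) :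
    Tendsto (fun m => ((expNegLow (m + 1) (T m) : ℚ) : ℝ)) atTop (𝓝 (Real.exp (-t))) := by
  -- The index is shifted so that the exponent n goes with T(n - 1); adding one back gives the
  -- exponent m + 1 with T(m).
  have h1 : Tendsto (fun n : ℕ => (n : ℝ) * (-(T (n - 1) : ℝ) / n)) atTop (𝓝 (-t)) := by
    have h2 : Tendsto (fun n : ℕ => -(T (n - 1) : ℝ)) atTop (𝓝 (-t)) :=
      (hT.comp (tendsto_sub_atTop_nat 1)).neg
    refine h2.congr' ?_
    filter_upwards [eventually_ge_atTop 1] with n hn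
    have : (n : ℝ) ≠ 0 := by positivity
    field_simp
  have h3 := (tendsto_add_atTop_iff_nat 1).2 (Real.tendsto_one_add_pow_exp_of_tendsto h1)
  refine h3.congr' ?_
  have h4 : ∀ᶠ m in atTop, (T m : ℝ) < t + 1 := hT.eventually_lt_const (by linarith)
  -- Eventually T(m) < t + 1 < M ≤ m, so the cut-off at 0 is inactive.
  obtain ⟨M, hM⟩ := exists_nat_gt (t + 1)
  filter_upwards [h4, eventually_ge_atTop M] with m hm hmM
  unfold expNegLow
  push_cast
  have hmM' : (M : ℝ) ≤ m := by exact_mod_cast hmM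
  rw [max_eq_right]
  · ring
  · rw [sub_nonneg, div_le_one (by positivity)]
    linarith

theorem wallisProd_succ (n : ℕ) :
    wallisProd (n + 1) = wallisProd n * (((2 * n + 1 : ℕ) : ℚ) / ((2 * n + 2 : ℕ) : ℚ)) := by
  unfold wallisProd
  rw [List.range_succ, List.map_append, List.prod_append]
  simp

theorem wallisProd_pos (n : ℕ) : 0 < wallisProd n := by
  induction n with
  | zero => simp [wallisProd]
  | succ n ih => rw [wallisProd_succ]; positivity

/-- The i-th factor of the inverse Wallis product is the square of (2i+1)/(2i+2) times
(2i+3)/(2i+1), and the second ratios telescope to 2n + 1. This brings in π through rational numbers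
only. -/
theorem wallisProd_sq (n : ℕ) :
    ((wallisProd n : ℚ) : ℝ) ^ 2 * (2 * n + 1) = (Real.Wallis.W n)⁻¹ := by
  induction n with
  | zero => simp [wallisProd, Real.Wallis.W]
  | succ n ih =>
    rw [Real.Wallis.W_succ, mul_inv, ← ih, wallisProd_succ]
    push_cast
    have h1 : (2 * (n : ℝ) + 1) ≠ 0 := by positivity
    have h2 : (2 * (n : ℝ) + 2) ≠ 0 := by positivity
    have h3 : (2 * (n : ℝ) + 3) ≠ 0 := by positivity
    field_simp
    ring

/-- The lower bound on the Wallis product gives the factor 4n(n+1)/(2n+1)², which is at most 1. The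
estimate must hold at every n, since `normLow` has to be a true lower bound and not only an
approximation. -/
theorem wallisProd_sq_le (n : ℕ) : ((wallisProd n : ℚ) : ℝ) ^ 2 * n ≤ Real.pi⁻¹ := by
  have hW := Real.Wallis.le_W n
  have hpi := Real.pi_pos
  have hn : (0 : ℝ) < 2 * n + 1 := by positivity
  have h1 : ((wallisProd n : ℚ) : ℝ) ^ 2 = (Real.Wallis.W n)⁻¹ / (2 * n + 1) := by
    rw [← wallisProd_sq]; field_simp
  have h2 : (Real.Wallis.W n)⁻¹ ≤ ((2 * (n : ℝ) + 1) / (2 * n + 2) * (Real.pi / 2))⁻¹ :=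
    inv_anti₀ (by positivity) hW
  rw [h1]
  calc (Real.Wallis.W n)⁻¹ / (2 * n + 1) * n
      ≤ ((2 * (n : ℝ) + 1) / (2 * n + 2) * (Real.pi / 2))⁻¹ / (2 * n + 1) * n := by gcongr
    _ = (4 * n * (n + 1) / (2 * n + 1) ^ 2) * Real.pi⁻¹ := by
        have : (2 * (n : ℝ) + 2) ≠ 0 := by positivity
        field_simp
        ring
    _ ≤ 1 * Real.pi⁻¹ := by
        gcongr
        rw [div_le_one (by positivity)]
        nlinarith
    _ = Real.pi⁻¹ := one_mul _

theorem tendsto_wallisProd_sq :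
    Tendsto (fun n : ℕ => ((wallisProd n : ℚ) : ℝ) ^ 2 * n) atTop (𝓝 Real.pi⁻¹) := by
  have h1 : Tendsto (fun n : ℕ => (Real.Wallis.W n)⁻¹) atTop (𝓝 (Real.pi / 2)⁻¹) :=
    Real.Wallis.tendsto_W_nhds_pi_div_two.inv₀ (by positivity)
  have h2 : Tendsto (fun n : ℕ => (1 / 2 - 1 / 2 * (1 / ((2 * n + 1 : ℕ) : ℝ)))) atTop
      (𝓝 (1 / 2 - 1 / 2 * 0)) := by
    refine tendsto_const_nhds.sub (tendsto_const_nhds.mul ?_)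
    refine tendsto_const_div_atTop_nhds_zero_nat 1 |>.comp ?_
    exact tendsto_atTop_mono (fun n => by simp only [id_eq]; omega) tendsto_id
  have h3 := h1.mul h2
  have h4 : (Real.pi / 2)⁻¹ * (1 / 2 - 1 / 2 * 0) = Real.pi⁻¹ := by
    have := Real.pi_pos
    field_simp
    ring
  rw [h4] at h3
  refine h3.congr fun n => ?_
  rw [← wallisProd_sq]
  push_cast
  have : (2 * (n : ℝ) + 1) ≠ 0 := by positivity
  field_simp
  ring

/-- The product at n behaves like 1/√(πn). At n = 2N² this is 1/(N√(2π)), so multiplying by N/s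
approximates 1/(s√(2π)) without extracting a square root. -/
theorem normLow_gaussian_sq (s : ℚ) (N : ℕ) :
    ((normLow .gaussian s N : ℚ) : ℝ) ^ 2 =
      (((wallisProd (2 * (N * N)) : ℚ) : ℝ) ^ 2 * ((2 * (N * N) : ℕ) : ℝ)) * (1 / (2 * (s : ℝ) ^ 2)) := by
  simp only [normLow, decide_true, cond_true]
  push_cast
  rcases eq_or_ne s 0 with rfl | h
  · simp
  · field_simp

theorem normLow_nonneg (k : Family) {s : ℚ} (hs : 0 < s) (N : ℕ) : 0 ≤ normLow k s N := by
  have := wallisProd_pos (2 * (N * N))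
  cases k <;> simp [normLow] <;> positivity

theorem normFactor_gaussian_sq {s : ℝ} (hs : 0 < s) :
    normFactor .gaussian s ^ 2 = Real.pi⁻¹ * (1 / (2 * s ^ 2)) := by
  have := Real.pi_pos
  simp only [normFactor]
  rw [inv_pow, Real.sq_sqrt (by positivity)]
  field_simp

theorem normLow_le (k : Family) {s : ℚ} (hs : 0 < s) (N : ℕ) :
    ((normLow k s N : ℚ) : ℝ) ≤ normFactor k s := by
  have hs' : (0 : ℝ) < s := by exact_mod_cast hs
  cases k
  · refine (pow_le_pow_iff_left₀ (by exact_mod_cast normLow_nonneg _ hs N)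
      (normFactor_nonneg _ hs') two_ne_zero).1 ?_
    rw [normLow_gaussian_sq, normFactor_gaussian_sq hs']
    have := wallisProd_sq_le (2 * (N * N))
    gcongr
  · simp [normLow, normFactor]

theorem tendsto_normLow (k : Family) {s : ℚ} (hs : 0 < s) :
    Tendsto (fun m => ((normLow k s (m + 1) : ℚ) : ℝ)) atTop (𝓝 (normFactor k s)) := by
  have hs' : (0 : ℝ) < s := by exact_mod_cast hs
  cases k
  · have h1 : Tendsto (fun m : ℕ => ((normLow .gaussian s (m + 1) : ℚ) : ℝ) ^ 2) atTop
        (𝓝 (normFactor .gaussian s ^ 2)) := by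
      rw [normFactor_gaussian_sq hs']
      simp only [normLow_gaussian_sq]
      refine Tendsto.mul_const _ ?_
      refine tendsto_wallisProd_sq.comp (tendsto_atTop_mono (fun n => ?_) tendsto_id)
      simp only [id_eq]
      nlinarith
    have h2 := (Real.continuous_sqrt.tendsto _).comp h1
    rw [Real.sqrt_sq (normFactor_nonneg _ hs')] at h2
    refine h2.congr fun m => ?_
    exact Real.sqrt_sq (by exact_mod_cast normLow_nonneg _ hs _)
  · simp [normLow, normFactor]

/-! ### Cells -/

/-- The mesh of the grid of precision `m`. -/
noncomputable def mesh (m : ℕ) : ℝ := 1 / ((m + 1 : ℕ) : ℝ)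

theorem mesh_pos (m : ℕ) : 0 < mesh m := by unfold mesh; positivity

theorem tendsto_mesh : Tendsto mesh atTop (𝓝 0) := by
  have := tendsto_one_div_add_atTop_nhds_zero_nat (𝕜 := ℝ)
  refine this.congr fun m => ?_
  simp [mesh]

/-- The corner of the cell of precision `m` containing a real number. -/
noncomputable def corner (m : ℕ) (y : ℝ) : ℚ :=
  (⌊((m + 1 : ℕ) : ℝ) * y⌋ : ℚ) / ((m + 1 : ℕ) : ℚ)

theorem corner_cast (m : ℕ) (y : ℝ) :
    (corner m y : ℝ) = (⌊((m + 1 : ℕ) : ℝ) * y⌋ : ℝ) / ((m + 1 : ℕ) : ℝ) := by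
  simp [corner]

theorem corner_le (m : ℕ) (y : ℝ) : (corner m y : ℝ) ≤ y := by
  rw [corner_cast, div_le_iff₀ (by positivity), mul_comm y]
  exact Int.floor_le _

theorem lt_corner_add (m : ℕ) (y : ℝ) : y < corner m y + mesh m := by
  rw [corner_cast, mesh, ← add_div, lt_div_iff₀ (by positivity), mul_comm y]
  exact Int.lt_floor_add_one _

theorem abs_sub_corner_le (m : ℕ) (y : ℝ) : |y - corner m y| ≤ mesh m := by
  rw [abs_le]
  have h1 := corner_le m y
  have h2 := lt_corner_add m y
  have h3 := mesh_pos m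
  constructor <;> linarith

theorem tendsto_corner (y : ℝ) : Tendsto (fun m => (corner m y : ℝ)) atTop (𝓝 y) := by
  refine tendsto_of_tendsto_of_tendsto_of_le_of_le (g := fun m => y - mesh m) ?_
    tendsto_const_nhds (fun m => ?_) fun m => corner_le m y
  · simpa using (tendsto_const_nhds (x := y)).sub tendsto_mesh
  · have := lt_corner_add m y
    simp only
    linarith

theorem grid_eq (m i : ℕ) : ((i : ℚ) / ((m + 1 : ℕ) : ℚ) - ((m + 1 : ℕ) : ℚ)) =
    (((i : ℤ) - (m + 1) * (m + 1) : ℤ) : ℚ) / ((m + 1 : ℕ) : ℚ) := by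
  have : ((m + 1 : ℕ) : ℚ) ≠ 0 := by positivity
  field_simp
  push_cast
  ring

theorem mem_grid {m : ℕ} {x : ℚ} : x ∈ grid m ↔ ∃ z : ℤ, -((m + 1) * (m + 1)) ≤ z ∧
    z < (m + 1) * (m + 1) ∧ x = (z : ℚ) / ((m + 1 : ℕ) : ℚ) := by
  unfold grid
  simp only [List.mem_map, List.mem_range]
  constructor
  · rintro ⟨i, hi, rfl⟩
    refine ⟨(i : ℤ) - (m + 1) * (m + 1), by omega, ?_, grid_eq m i⟩
    zify at hi
    linarith
  · rintro ⟨z, h1, h2, rfl⟩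
    refine ⟨(z + (m + 1) * (m + 1)).toNat, ?_, ?_⟩
    · zify
      rw [Int.toNat_of_nonneg (by linarith)]
      linarith
    · rw [grid_eq, Int.toNat_of_nonneg (by linarith)]
      congr 2
      ring

theorem nodup_grid (m : ℕ) : (grid m).Nodup := by
  unfold grid
  refine List.Nodup.map (fun i j hij => ?_) List.nodup_range
  have h : ((m + 1 : ℕ) : ℚ) ≠ 0 := by positivity
  simp only [sub_left_inj] at hij
  rw [div_left_inj' h] at hij
  exact_mod_cast hij

theorem corner_eq_of_mem {m : ℕ} {x : ℚ} (hx : x ∈ grid m) {y : ℝ}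
    (hy : y ∈ Set.Ico (x : ℝ) (x + mesh m)) : corner m y = x := by
  obtain ⟨z, -, -, rfl⟩ := mem_grid.1 hx
  have h : ((m + 1 : ℕ) : ℝ) ≠ 0 := by positivity
  have h0 : (0 : ℝ) < ((m + 1 : ℕ) : ℝ) := by positivity
  rw [corner]
  congr 2
  rw [Int.floor_eq_iff]
  obtain ⟨h1, h2⟩ := hy
  rw [mesh] at h2
  push_cast at h1 h2 h h0 ⊢
  rw [← add_div, lt_div_iff₀ h0] at h2
  rw [div_le_iff₀ h0] at h1
  constructor <;> linarith

theorem corner_mem_grid {m : ℕ} {y : ℝ} (hy : |y| < m + 1) : corner m y ∈ grid m := by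
  rw [abs_lt] at hy
  refine mem_grid.2 ⟨_, ?_, ?_, rfl⟩
  · rw [Int.le_floor]
    push_cast
    nlinarith
  · rw [Int.floor_lt]
    push_cast
    nlinarith

theorem corner_eq_iff {m : ℕ} {x : ℚ} (hx : x ∈ grid m) {y : ℝ} :
    corner m y = x ↔ y ∈ Set.Ico (x : ℝ) (x + mesh m) := by
  refine ⟨?_, corner_eq_of_mem hx⟩
  rintro rfl
  exact ⟨corner_le m y, lt_corner_add m y⟩

/-! ### Weights of cells -/

/-- The lower bound for the density on a cell. -/
noncomputable def lowDensity (e : Family × ℚ × ℚ) (m : ℕ) (x : ℚ) : ℝ :=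
  ((normLow e.1 (fixScale e.2.2) (m + 1) *
    expNegLow (m + 1) (max (rateQ e.1 e.2.1 (fixScale e.2.2) x)
      (rateQ e.1 e.2.1 (fixScale e.2.2) (x + 1 / ((m + 1 : ℕ) : ℚ)))) : ℚ) : ℝ)

theorem weight_cast (e : Family × ℚ × ℚ) (m : ℕ) (x : ℚ) :
    ((weight e m x : ℚ) : ℝ) = lowDensity e m x * mesh m := by
  unfold weight lowDensity mesh
  push_cast
  ring

theorem weight_nonneg (e : Family × ℚ × ℚ) (m : ℕ) (x : ℚ) : 0 ≤ weight e m x := by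
  unfold weight
  have h1 := normLow_nonneg e.1 (fixScale_pos e.2.2) (m + 1)
  have h2 := expNegLow_nonneg (m + 1) (max (rateQ e.1 e.2.1 (fixScale e.2.2) x)
      (rateQ e.1 e.2.1 (fixScale e.2.2) (x + 1 / ((m + 1 : ℕ) : ℚ))))
  positivity

theorem lowDensity_nonneg (e : Family × ℚ × ℚ) (m : ℕ) (x : ℚ) : 0 ≤ lowDensity e m x := by
  unfold lowDensity
  have h1 := normLow_nonneg e.1 (fixScale_pos e.2.2) (m + 1)
  have h2 := expNegLow_nonneg (m + 1) (max (rateQ e.1 e.2.1 (fixScale e.2.2) x)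
      (rateQ e.1 e.2.1 (fixScale e.2.2) (x + 1 / ((m + 1 : ℕ) : ℚ))))
  positivity

theorem maxRate_cast (e : Family × ℚ × ℚ) (m : ℕ) (x : ℚ) :
    ((max (rateQ e.1 e.2.1 (fixScale e.2.2) x)
      (rateQ e.1 e.2.1 (fixScale e.2.2) (x + 1 / ((m + 1 : ℕ) : ℚ))) : ℚ) : ℝ) =
    max (rate e.1 e.2.1 (fixScale e.2.2) x) (rate e.1 e.2.1 (fixScale e.2.2) (x + mesh m)) := by
  rw [Rat.cast_max, rateQ_cast, rateQ_cast, mesh]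
  push_cast
  rfl

theorem lowDensity_le (e : Family × ℚ × ℚ) (m : ℕ) (x : ℚ) {y : ℝ}
    (hy : y ∈ Set.Ico (x : ℝ) (x + mesh m)) : lowDensity e m x ≤ entryDensity e y := by
  unfold lowDensity entryDensity
  rw [Rat.cast_mul]
  refine mul_le_mul (normLow_le _ (fixScale_pos _) _) ?_
    (by exact_mod_cast expNegLow_nonneg _ _) (normFactor_nonneg _ (fixScale_cast_pos _))
  refine (expNegLow_le (Nat.succ_ne_zero m)).trans (Real.exp_le_exp.2 (neg_le_neg ?_))
  rw [maxRate_cast]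
  exact rate_le_max _ _ (fixScale_cast_pos _) hy.1 hy.2.le

theorem volume_cell (m : ℕ) (x : ℚ) :
    volume (Set.Ico (x : ℝ) (x + mesh m)) = ENNReal.ofReal (mesh m) := by
  rw [Real.volume_Ico]; congr 1; ring

theorem weight_le (e : Family × ℚ × ℚ) (m : ℕ) (x : ℚ) :
    ((weight e m x : ℚ) : ℝ) ≤ (entryDistr e).law.real (Set.Ico (x : ℝ) (x + mesh m)) := by
  rw [weight_cast, measureReal_def, ← ENNReal.ofReal_le_iff_le_toReal (measure_ne_top _ _),
    law_eq_withDensity, withDensity_apply _ measurableSet_Ico,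
    ENNReal.ofReal_mul (lowDensity_nonneg _ _ _), ← volume_cell m x, ← setLIntegral_const]
  exact setLIntegral_mono' measurableSet_Ico fun y hy =>
    ENNReal.ofReal_le_ofReal (lowDensity_le e m x hy)

/-- Both ends of the cell containing y tend to y and the rate is continuous, so taking the larger
rate loses nothing in the limit. -/
theorem tendsto_lowDensity (e : Family × ℚ × ℚ) (y : ℝ) :
    Tendsto (fun m => lowDensity e m (corner m y)) atTop (𝓝 (entryDensity e y)) := by
  unfold lowDensity entryDensity
  simp only [Rat.cast_mul]
  refine (tendsto_normLow _ (fixScale_pos _)).mul (tendsto_expNegLow ?_)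
  simp only [maxRate_cast]
  have hc := continuous_rate e.1 e.2.1 (fixScale e.2.2)
  have h1 := (hc.tendsto y).comp (tendsto_corner y)
  have h2 := (hc.tendsto (y + 0)).comp ((tendsto_corner y).add tendsto_mesh)
  rw [add_zero] at h2
  simpa using h1.max h2

theorem list_sum_map_eq_finset_sum {α M : Type*} [DecidableEq α] [AddCommMonoid M] {l : List α}
    (hl : l.Nodup) (f : α → M) : (l.map f).sum = ∑ x ∈ l.toFinset, f x :=
  (List.sum_toFinset f hl).symm

/-- The weights of the cells of the grid add up to a quantity tending to one. -/
theorem tendsto_sum_weight (e : Family × ℚ × ℚ) :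
    Tendsto (fun m => (((grid m).map fun x => ((weight e m x : ℚ) : ℝ)).sum)) atTop (𝓝 1) := by
  -- `F m` is the step function with the lower density bound on each cell of the grid and 0
  -- elsewhere. Its integral is the sum of the weights, it lies below the density, and it converges
  -- to the density pointwise.
  set F : ℕ → ℝ → ℝ := fun m y => ∑ x ∈ (grid m).toFinset,
    (Set.Ico (x : ℝ) (x + mesh m)).indicator (fun _ => lowDensity e m x) y with hF
  have hFy : ∀ m y, F m y = if corner m y ∈ grid m then lowDensity e m (corner m y) else 0 := by
    intro m y
    simp only [hF]
    have : ∀ x ∈ (grid m).toFinset, (Set.Ico (x : ℝ) (x + mesh m)).indicator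
        (fun _ => lowDensity e m x) y = if corner m y = x then lowDensity e m x else 0 := by
      intro x hx
      rw [Set.indicator_apply]
      simp only [corner_eq_iff (List.mem_toFinset.1 hx)]
    rw [Finset.sum_congr rfl this, Finset.sum_ite_eq]
    simp
  have hintegral : ∀ m, ∫ y, F m y = (((grid m).map fun x => ((weight e m x : ℚ) : ℝ)).sum) := by
    intro m
    simp only [hF]
    rw [integral_finsetSum, list_sum_map_eq_finset_sum (nodup_grid m)]
    · refine Finset.sum_congr rfl fun x _ => ?_
      rw [integral_indicator_const _ measurableSet_Ico, measureReal_def, volume_cell,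
        ENNReal.toReal_ofReal (mesh_pos m).le, weight_cast, smul_eq_mul, mul_comm]
    · intro x _
      refine (integrable_indicator_iff measurableSet_Ico).2 (integrableOn_const ?_)
      rw [volume_cell]
      exact ENNReal.ofReal_ne_top
  have key := tendsto_integral_of_dominated_convergence (F := F) (f := entryDensity e)
    (μ := volume) (entryDensity e) ?_ (integrable_entryDensity e) ?_ ?_
  · rw [integral_entryDensity] at key
    exact key.congr hintegral
  · intro m
    refine Measurable.aestronglyMeasurable ?_
    refine Finset.measurable_sum _ fun x _ => ?_
    exact measurable_const.indicator measurableSet_Ico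
  · intro m
    refine ae_of_all _ fun y => ?_
    rw [hFy]
    split_ifs with h
    · rw [Real.norm_of_nonneg (lowDensity_nonneg _ _ _)]
      exact lowDensity_le e m _ ⟨corner_le m y, lt_corner_add m y⟩
    · rw [norm_zero]
      exact entryDensity_nonneg e y
  · refine ae_of_all _ fun y => ?_
    refine (tendsto_lowDensity e y).congr' ?_
    -- The box grows with m, so every fixed point is eventually covered by the grid.
    obtain ⟨M, hM⟩ := exists_nat_gt |y|
    filter_upwards [eventually_ge_atTop M] with m hm
    have hmM : (M : ℝ) ≤ m := by exact_mod_cast hm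
    rw [hFy, if_pos (corner_mem_grid (by linarith))]

/-! ## Assignments -/

theorem assigns_cons (y : ℕ) (ys : List ℕ) (vals : List ℚ) :
    assigns (y :: ys) vals = vals.flatMap fun d => (assigns ys vals).map fun l => (y, d) :: l := rfl

theorem mem_assigns {ys : List ℕ} {vals : List ℚ} {l : Asg} :
    l ∈ assigns ys vals ↔ l.map Prod.fst = ys ∧ ∀ p ∈ l, p.2 ∈ vals := by
  induction ys generalizing l with
  | nil =>
    simp only [assigns, List.foldr_nil, List.mem_singleton, List.map_eq_nil_iff]
    constructor
    · rintro rfl; simp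
    · exact fun h => h.1
  | cons y ys ih =>
    rw [assigns_cons]
    simp only [List.mem_flatMap, List.mem_map, ih]
    constructor
    · rintro ⟨d, hd, l', ⟨rfl, h⟩, rfl⟩
      simpa using ⟨hd, fun a b hab => h _ hab⟩
    · rintro ⟨h1, h2⟩
      cases l with
      | nil => simp at h1
      | cons p l =>
        simp only [List.map_cons, List.cons.injEq] at h1
        exact ⟨p.2, h2 p (by simp), l, ⟨h1.2, fun q hq => h2 q (by simp [hq])⟩, by rw [← h1.1]⟩

theorem nodup_assigns (ys : List ℕ) {vals : List ℚ} (hv : vals.Nodup) :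
    (assigns ys vals).Nodup := by
  induction ys with
  | nil => simp [assigns]
  | cons y ys ih =>
    rw [assigns_cons, List.nodup_flatMap]
    refine ⟨fun d _ => ih.map fun l l' h => (List.cons.inj h).2, ?_⟩
    refine hv.imp fun {d d'} hdd => ?_
    rw [Function.onFun, List.disjoint_left]
    rintro l hl hl'
    obtain ⟨l₁, -, rfl⟩ := List.mem_map.1 hl
    obtain ⟨l₂, -, h⟩ := List.mem_map.1 hl'
    have := (List.cons.inj h).1
    exact hdd (Prod.ext_iff.1 this).2.symm

/-- Distributivity of products over sums. -/
theorem sum_assigns_prod {R : Type*} [CommSemiring R] (ys : List ℕ) (vals : List ℚ)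
    (g : ℕ × ℚ → R) : ((assigns ys vals).map fun c => (c.map g).prod).sum =
      (ys.map fun y => (vals.map fun d => g (y, d)).sum).prod := by
  induction ys with
  | nil => simp [assigns]
  | cons y ys ih =>
    rw [assigns_cons, List.map_cons, List.prod_cons, ← ih]
    induction vals with
    | nil => simp
    | cons d vals ihv =>
      clear ihv
      -- The list of values also occurs inside the assignments of the remaining variables; freezing
      -- those as `A` lets the induction run over the values of the first variable alone.
      generalize assigns ys (d :: vals) = A
      generalize d :: vals = V
      induction V with
      | nil => simp
      | cons d V ihV =>
        rw [List.flatMap_cons, List.map_append, List.sum_append, ihV, List.map_cons, List.sum_cons,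
          add_mul]
        congr 1
        rw [List.map_map, ← List.sum_map_mul_left]
        simp [Function.comp_def]

theorem lookup_eq_some_of_mem {β : Type*} {l : List (ℕ × β)} (hl : (l.map Prod.fst).Nodup)
    {p : ℕ × β} (hp : p ∈ l) : l.lookup p.1 = some p.2 := by
  induction l with
  | nil => simp at hp
  | cons q l ih =>
    simp only [List.map_cons, List.nodup_cons] at hl
    rcases List.mem_cons.1 hp with rfl | hp
    · exact List.lookup_cons_self
    · have hne : p.1 ≠ q.1 := by
        intro h
        exact hl.1 (h ▸ List.mem_map_of_mem hp)
      rw [← Prod.mk.eta (p := q), List.lookup_cons, beq_false_of_ne hne]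
      exact ih hl.2 hp

theorem mem_of_lookup_eq_some {β : Type*} {l : List (ℕ × β)} {k : ℕ} {e : β}
    (h : l.lookup k = some e) : (k, e) ∈ l := by
  rw [List.lookup_eq_some_iff] at h
  obtain ⟨l₁, l₂, rfl, -⟩ := h
  simp

theorem lookup_map_mk {β : Type*} (S : List ℕ) (f : ℕ → β) (v : ℕ) :
    (S.map fun w => (w, f w)).lookup v = if v ∈ S then some (f v) else none := by
  induction S with
  | nil => simp
  | cons w S ih =>
    rw [List.map_cons, List.lookup_cons, ih]
    by_cases h : v = w
    · subst h; simp
    · rw [beq_false_of_ne h]; simp [h]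

/-! ## States and their symbolic presentations -/

/-- The recorded distribution or expression. -/
def Entry.toReal : Entry → Distr ⊕ RExp := Sum.map entryDistr id

/-- The state presented by a symbolic state. -/
def SymState.toState (st : SymState) : State :=
  ⟨fun x => st.1.lookup x, fun r => (st.2.1.lookup r).map Entry.toReal, {B | B ∈ st.2.2}⟩

/-- Every key is at most the sum of the keys, so a search below that bound finds all variables, and
filtering a range keeps the list free of duplicates. -/
theorem mem_sampledVars {b : List (ℕ × Entry)} {v : ℕ} :
    v ∈ sampledVars b ↔ ∃ e, b.lookup v = some (.inl e) := by
  unfold sampledVars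
  rw [List.mem_filter, List.mem_range]
  constructor
  · rintro ⟨-, h⟩
    rcases hb : b.lookup v with _ | (e | R)
    · rw [hb] at h; simp at h
    · exact ⟨e, rfl⟩
    · rw [hb] at h; simp at h
  · rintro ⟨e, h⟩
    refine ⟨?_, by rw [h]; rfl⟩
    have h1 : v ∈ b.map fun p => p.1 := List.mem_map.2 ⟨_, mem_of_lookup_eq_some h, rfl⟩
    have := List.le_sum_of_mem h1
    omega

theorem nodup_sampledVars (b : List (ℕ × Entry)) : (sampledVars b).Nodup :=
  List.nodup_range.filter _

/-- The valuation of the real variables given by an assignment. -/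
noncomputable def Asg.toReal (c : Asg) (v : ℕ) : ℝ := (asgVal c v : ℝ)

/-- The difference of the two sides of a Boolean expression. -/
noncomputable def State.gap (τ : State) (ω : ℕ → ℝ) : BExp → ℝ
  | .realReal R _ R' => R.eval (τ.rand ω) - R'.eval (τ.rand ω)
  | .realDom R _ x => R.eval (τ.rand ω) - (τ.domVal x : ℝ)
  | .domDom x _ y => (τ.domVal x : ℝ) - (τ.domVal y : ℝ)

/-- A Boolean expression holds when the independent variables have the values `ω`. -/
def State.Sat (τ : State) (ω : ℕ → ℝ) (B : BExp) : Prop := B.cmp.Holds (τ.gap ω B) 0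

theorem Cmp.holds_sub_zero_iff (c : Cmp) (a b : ℝ) : c.Holds (a - b) 0 ↔ c.Holds a b := by
  cases c <;> simp [Cmp.Holds, sub_eq_zero]

theorem Cmp.ofSign_iff (c : Cmp) (x : ℚ) :
    c.ofSign (decide (x < 0)) (decide (x = 0)) = true ↔ c.Holds (x : ℝ) 0 := by
  cases c <;> simp only [Cmp.Holds, Cmp.ofSign, Bool.or_eq_true, Bool.and_eq_true,
    Bool.not_eq_true', decide_eq_true_eq, decide_eq_false_iff_not, Rat.cast_eq_zero, ge_iff_le,
    gt_iff_lt, Rat.cast_nonpos, Rat.cast_lt_zero, Rat.cast_nonneg, Rat.cast_pos, not_lt, ne_eq]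
  · exact le_iff_lt_or_eq.symm
  · exact ⟨fun h => lt_of_le_of_ne h.1 (Ne.symm h.2), fun h => ⟨h.le, h.ne'⟩⟩

/-- Treats comparisons of finite-domain variables and comparisons involving real ones uniformly, as
sign conditions on a difference; the first kind is the case of a constant difference. -/
theorem State.sat_forall_iff (τ : State) (ω : ℕ → ℝ) :
    (∀ B ∈ τ.G, τ.Sat ω B) ↔ τ.EvalConst ∧ τ.EvalRand ω := by
  constructor
  · intro h
    exact ⟨fun x c y hB => (Cmp.holds_sub_zero_iff _ _ _).1 (h _ hB),
      fun R c R' hB => (Cmp.holds_sub_zero_iff _ _ _).1 (h _ hB),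
      fun R c x hB => (Cmp.holds_sub_zero_iff _ _ _).1 (h _ hB)⟩
  · rintro ⟨h1, h2, h3⟩ B hB
    cases B with
    | realReal R c R' => exact (Cmp.holds_sub_zero_iff _ _ _).2 (h2 R c R' hB)
    | realDom R c x => exact (Cmp.holds_sub_zero_iff _ _ _).2 (h3 R c x hB)
    | domDom x c y => exact (Cmp.holds_sub_zero_iff _ _ _).2 (h1 x c y hB)

theorem evalQ_cast (v : ℕ → ℚ) (R : RExp) :
    ((R.evalQ v : ℚ) : ℝ) = R.eval fun r => (v r : ℝ) := by
  induction R with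
  | var r => rfl
  | smul q R ih => simp [RExp.evalQ, RExp.eval, ih]
  | add R R' ih ih' => simp [RExp.evalQ, RExp.eval, ih, ih']
  | addConst R q ih => simp [RExp.evalQ, RExp.eval, ih]

theorem randQ_cast (st : SymState) (c : Asg) (r : ℕ) :
    ((randQ st.2.1 c r : ℚ) : ℝ) = st.toState.rand c.toReal r := by
  unfold randQ State.rand SymState.toState
  rcases h : st.2.1.lookup r with _ | (e | R)
  · simp [h]
  · simp [h, Entry.toReal, Asg.toReal]
  · simp only [Option.elim_some, Sum.elim_inr, h, Option.map_some, Entry.toReal, Sum.map_inr, id_eq]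
    exact evalQ_cast _ R

theorem gapQ_cast (st : SymState) (c : Asg) (B : BExp) :
    ((gapQ st c B : ℚ) : ℝ) = st.toState.gap c.toReal B := by
  have h : (fun r => ((randQ st.2.1 c r : ℚ) : ℝ)) = st.toState.rand c.toReal :=
    funext (randQ_cast st c)
  cases B <;> simp only [gapQ, BExp.toSum, State.gap, Sum.elim_inl, Sum.elim_inr, Rat.cast_sub,
    evalQ_cast, h] <;> rfl

theorem holdsQ_iff (st : SymState) (c : Asg) (B : BExp) :
    holdsQ st c B = true ↔ st.toState.Sat c.toReal B := by
  unfold holdsQ State.Sat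
  rw [← gapQ_cast, Cmp.ofSign_iff]

/-! ### Affine functions of the independent variables -/

/-- A function of the valuation that is affine on the valuations supported by `S`. -/
def IsAffine (S : List ℕ) (L : (ℕ → ℝ) → ℝ) : Prop :=
  ∀ ω : ℕ → ℝ, (∀ v, v ∉ S → ω v = 0) →
    L ω = L 0 + (S.map fun v => ω v * (L (Pi.single v 1) - L 0)).sum

theorem isAffine_const (S : List ℕ) (c : ℝ) : IsAffine S fun _ => c := by
  intro ω _; simp

theorem IsAffine.add {S : List ℕ} {L L' : (ℕ → ℝ) → ℝ} (h : IsAffine S L) (h' : IsAffine S L') :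
    IsAffine S fun ω => L ω + L' ω := by
  intro ω hω
  have e : ∀ v, ω v * (L (Pi.single v 1) + L' (Pi.single v 1) - (L 0 + L' 0)) =
      ω v * (L (Pi.single v 1) - L 0) + ω v * (L' (Pi.single v 1) - L' 0) := fun v => by ring
  simp only [e, List.sum_map_add]
  rw [h ω hω, h' ω hω]
  ring

theorem IsAffine.const_mul {S : List ℕ} {L : (ℕ → ℝ) → ℝ} (h : IsAffine S L) (q : ℝ) :
    IsAffine S fun ω => q * L ω := by
  intro ω hω
  have e : ∀ v, ω v * (q * L (Pi.single v 1) - q * L 0) =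
      q * (ω v * (L (Pi.single v 1) - L 0)) := fun v => by ring
  simp only [e, List.sum_map_mul_left]
  rw [h ω hω]
  ring

theorem IsAffine.sub {S : List ℕ} {L L' : (ℕ → ℝ) → ℝ} (h : IsAffine S L) (h' : IsAffine S L') :
    IsAffine S fun ω => L ω - L' ω := by
  have := h.add (h'.const_mul (-1))
  simpa only [neg_one_mul, ← sub_eq_add_neg] using this

/-- A coordinate outside `S` vanishes on the valuations considered, so it is affine with all
coefficients zero. -/
theorem isAffine_apply {S : List ℕ} (hS : S.Nodup) (w : ℕ) : IsAffine S fun ω => ω w := by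
  intro ω hω
  simp only [Pi.zero_apply, zero_add, sub_zero]
  rw [list_sum_map_eq_finset_sum hS]
  by_cases hw : w ∈ S
  · rw [Finset.sum_eq_single w]
    · simp
    · intro v _ hv
      simp [Ne.symm hv]
    · simp [hw]
  · rw [hω w hw, Finset.sum_eq_zero]
    intro v hv
    have : w ≠ v := by rintro rfl; exact hw (List.mem_toFinset.1 hv)
    simp [this]

theorem IsAffine.eval {S : List ℕ} {f : (ℕ → ℝ) → ℕ → ℝ} (hf : ∀ r, IsAffine S fun ω => f ω r)
    (R : RExp) : IsAffine S fun ω => R.eval (f ω) := by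
  induction R with
  | var r => exact hf r
  | smul q R ih => exact ih.const_mul _
  | add R R' ih ih' => exact ih.add ih'
  | addConst R q ih => exact ih.add (isAffine_const S _)

theorem isAffine_rand {S : List ℕ} (hS : S.Nodup) (τ : State) (r : ℕ) :
    IsAffine S fun ω => τ.rand ω r := by
  unfold State.rand
  rcases τ.β r with _ | (D | R)
  · exact isAffine_const S 0
  · exact isAffine_apply hS r
  · exact IsAffine.eval (isAffine_apply hS) R

theorem isAffine_gap {S : List ℕ} (hS : S.Nodup) (τ : State) (B : BExp) :
    IsAffine S fun ω => τ.gap ω B := by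
  cases B with
  | realReal R c R' =>
    simp only [State.gap]
    exact (IsAffine.eval (isAffine_rand hS τ) R).sub (IsAffine.eval (isAffine_rand hS τ) R')
  | realDom R c x =>
    simp only [State.gap]
    exact (IsAffine.eval (isAffine_rand hS τ) R).sub (isAffine_const S _)
  | domDom x c y => exact isAffine_const S _

/-- The sum of the absolute values of the coefficients. -/
noncomputable def coeffSum (S : List ℕ) (L : (ℕ → ℝ) → ℝ) : ℝ :=
  (S.map fun v => |L (Pi.single v 1) - L 0|).sum

theorem toReal_nil : Asg.toReal [] = 0 := by
  funext v; simp [Asg.toReal, asgVal]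

theorem toReal_single (v : ℕ) : Asg.toReal [(v, 1)] = Pi.single v 1 := by
  funext w
  by_cases h : w = v
  · subst h; simp [Asg.toReal, asgVal]
  · simp only [Asg.toReal, asgVal, List.lookup_cons, beq_false_of_ne h]
    simp [h]

/-- The coefficients of an affine function are its increments from the origin to the unit vectors,
so they are computed by evaluation, without a normal form for expressions. -/
theorem spreadQ_cast (st : SymState) (B : BExp) :
    ((spreadQ st B : ℚ) : ℝ) = coeffSum (sampledVars st.2.1) fun ω => st.toState.gap ω B := by
  unfold spreadQ coeffSum
  rw [Rat.cast_list_sum, List.map_map]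
  congr 1
  refine List.map_congr_left fun v _ => ?_
  simp only [Function.comp_apply, Rat.cast_abs, Rat.cast_sub, gapQ_cast, toReal_nil,
    toReal_single]

/-- The sum of the absolute coefficients is a Lipschitz constant for the supremum distance, the
distance in which a cell has size equal to the mesh. -/
theorem IsAffine.abs_sub_le {S : List ℕ} {L : (ℕ → ℝ) → ℝ} (h : IsAffine S L) {ω ω' : ℕ → ℝ}
    (hω : ∀ v, v ∉ S → ω v = 0) (hω' : ∀ v, v ∉ S → ω' v = 0) {d : ℝ}
    (hd : ∀ v ∈ S, |ω v - ω' v| ≤ d) : |L ω - L ω'| ≤ coeffSum S L * d := by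
  rw [h ω hω, h ω' hω', add_sub_add_left_eq_sub]
  unfold coeffSum
  clear hω hω' h
  induction S with
  | nil => simp
  | cons v S ih =>
    simp only [List.map_cons, List.sum_cons]
    have h1 := ih fun w hw => hd w (by simp [hw])
    have h2 := hd v (by simp)
    have e : ω v * (L (Pi.single v 1) - L 0) - ω' v * (L (Pi.single v 1) - L 0) =
      (ω v - ω' v) * (L (Pi.single v 1) - L 0) := by ring
    calc _ = |(ω v * (L (Pi.single v 1) - L 0) - ω' v * (L (Pi.single v 1) - L 0)) +
          ((S.map fun v => ω v * (L (Pi.single v 1) - L 0)).sum -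
          (S.map fun v => ω' v * (L (Pi.single v 1) - L 0)).sum)| := by congr 1; ring
      _ ≤ |ω v * (L (Pi.single v 1) - L 0) - ω' v * (L (Pi.single v 1) - L 0)| + _ :=
        abs_add_le _ _
      _ ≤ |L (Pi.single v 1) - L 0| * d + (S.map fun v => |L (Pi.single v 1) - L 0|).sum * d := by
        rw [e, abs_mul, mul_comm]
        gcongr
      _ = _ := (add_mul _ _ _).symm

/-! ## The law of the independent variables -/

/-- The law of a coordinate. -/
noncomputable def State.coordLaw (τ : State) (r : ℕ) : Measure ℝ :=
  match τ.β r with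
  | some (.inl D) => D.law
  | _ => Measure.dirac 0

instance (τ : State) (r : ℕ) : IsProbabilityMeasure (τ.coordLaw r) := by
  unfold State.coordLaw
  split <;> infer_instance

theorem State.law_eq (τ : State) : τ.law = Measure.infinitePi τ.coordLaw := rfl

instance (τ : State) : IsProbabilityMeasure τ.law := by
  rw [State.law_eq]; infer_instance

theorem coordLaw_of_lookup {st : SymState} {v : ℕ} {e : Family × ℚ × ℚ}
    (h : st.2.1.lookup v = some (.inl e)) : st.toState.coordLaw v = (entryDistr e).law := by
  simp [State.coordLaw, SymState.toState, h, Entry.toReal]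

theorem coordLaw_of_notMem {st : SymState} {v : ℕ} (h : v ∉ sampledVars st.2.1) :
    st.toState.coordLaw v = Measure.dirac 0 := by
  rw [mem_sampledVars, not_exists] at h
  rcases hv : st.2.1.lookup v with _ | (e | R)
  · simp [State.coordLaw, SymState.toState, hv]
  · exact absurd hv (h e)
  · simp [State.coordLaw, SymState.toState, hv, Entry.toReal]

/-- The coordinates that are not sampled have the Dirac law at 0. Almost every valuation thus lies
where the affine formula is available. -/
theorem ae_supported (st : SymState) :
    ∀ᵐ ω ∂st.toState.law, ∀ v, v ∉ sampledVars st.2.1 → ω v = 0 := by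
  rw [ae_all_iff]
  intro v
  by_cases hv : v ∈ sampledVars st.2.1
  · exact ae_of_all _ fun ω h => absurd hv h
  · have h1 : ∀ᵐ x ∂st.toState.coordLaw v, x = 0 := by
      rw [coordLaw_of_notMem hv]
      exact (ae_dirac_iff (p := fun x : ℝ => x = 0) (measurableSet_singleton 0)).2 rfl
    have h2 := (measurePreserving_eval_infinitePi st.toState.coordLaw v).quasiMeasurePreserving.ae h1
    filter_upwards [h2] with ω hω _ using hω

theorem entryDistr_law_singleton (e : Family × ℚ × ℚ) (x : ℝ) : (entryDistr e).law {x} = 0 := by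
  rw [law_eq_withDensity]
  exact withDensity_absolutelyContinuous _ _ (measure_singleton x)

/-! ### Measurability of conditions and null sets of affine equations -/

theorem measurable_eval {f : (ℕ → ℝ) → ℕ → ℝ} (hf : ∀ r, Measurable fun ω => f ω r) (R : RExp) :
    Measurable fun ω => R.eval (f ω) := by
  induction R with
  | var r => exact hf r
  | smul q R ih => exact ih.const_mul _
  | add R R' ih ih' => exact ih.add ih'
  | addConst R q ih => exact ih.add_const _

theorem measurable_rand (τ : State) (r : ℕ) : Measurable fun ω => τ.rand ω r := by
  unfold State.rand
  rcases τ.β r with _ | (D | R)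
  · exact measurable_const
  · exact measurable_pi_apply r
  · exact measurable_eval measurable_pi_apply R

theorem measurable_gap (τ : State) (B : BExp) : Measurable fun ω => τ.gap ω B := by
  cases B with
  | realReal R c R' =>
    exact (measurable_eval (measurable_rand τ) R).sub (measurable_eval (measurable_rand τ) R')
  | realDom R c x => exact (measurable_eval (measurable_rand τ) R).sub_const _
  | domDom x c y => exact measurable_const

theorem measurableSet_holds (c : Cmp) : MeasurableSet {x : ℝ | c.Holds x 0} := by
  cases c
  · exact measurableSet_eq
  · exact measurableSet_Iic
  · exact measurableSet_Iio
  · exact measurableSet_Ici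
  · exact measurableSet_Ioi
  · exact (measurableSet_eq (a := (0 : ℝ))).compl

/-- The event that all conditions hold. -/
def State.event (τ : State) : Set (ℕ → ℝ) := {ω | ∀ B ∈ τ.G, τ.Sat ω B}

theorem measurableSet_event (st : SymState) : MeasurableSet st.toState.event := by
  have h : st.toState.event = ⋂ B ∈ st.2.2.toFinset, {ω | st.toState.Sat ω B} := by
    ext ω
    simp [State.event, SymState.toState]
  rw [h]
  exact Finset.measurableSet_biInter _ fun B _ =>
    measurable_gap st.toState B (measurableSet_holds B.cmp)

/-- The constant conditions do not depend on ω: if one fails the event is empty, which matches the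
value 0 in the definition. -/
theorem prob_eq (τ : State) : τ.prob = τ.law.real τ.event := by
  unfold State.prob State.event
  simp only [State.sat_forall_iff]
  split_ifs with h
  · simp [h]
  · simp [h]

/-- A nontrivial affine function of independent atomless variables vanishes with probability
zero. -/
theorem measure_linear_eq_zero {ν : ℕ → Measure ℝ} [∀ i, IsProbabilityMeasure (ν i)]
    (S : Finset ℕ) (a : ℕ → ℝ) (c : ℝ) {v : ℕ} (hv : v ∈ S) (ha : a v ≠ 0)
    (hν : ∀ x, ν v {x} = 0) :
    Measure.infinitePi ν {ω | c + ∑ w ∈ S, ω w * a w = 0} = 0 := by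
  have hm : ∀ w, Measurable fun ω : ℕ → ℝ => ω w * a w := fun w =>
    (measurable_pi_apply w).mul_const _
  have hind : iIndepFun (fun w (ω : ℕ → ℝ) => ω w * a w) (Measure.infinitePi ν) :=
    iIndepFun_infinitePi (X := fun w x => x * a w) fun w => measurable_id.mul_const _
  have h1 := hind.indepFun_finsetSum_of_notMem hm (Finset.notMem_erase v S)
  -- The sum of the other terms is independent of the term of v, so the joint law is a product and
  -- it suffices that almost every section is null.
  set X : (ℕ → ℝ) → ℝ := ∑ w ∈ S.erase v, fun ω : ℕ → ℝ => ω w * a w with hX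
  have hXm : Measurable X := by
    have h := Finset.measurable_sum (S.erase v) fun w _ => hm w
    convert h using 1
    funext ω
    rw [hX, Finset.sum_apply]
  have h2 := h1.map_prod_eq_prod_map_map hXm.aemeasurable (hm v).aemeasurable
  have hset : {ω : ℕ → ℝ | c + ∑ w ∈ S, ω w * a w = 0} =
      (fun ω => (X ω, ω v * a v)) ⁻¹' {p : ℝ × ℝ | c + p.1 + p.2 = 0} := by
    ext ω
    simp only [Set.mem_ofPred_eq, Set.mem_preimage, hX, Finset.sum_apply]
    rw [← Finset.sum_erase_add _ _ hv, add_assoc]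
  have hpm : MeasurableSet {p : ℝ × ℝ | c + p.1 + p.2 = 0} :=
    measurableSet_eq_fun ((measurable_fst.const_add c).add measurable_snd) measurable_const
  rw [hset, ← Measure.map_apply (hXm.prodMk (hm v)) hpm, h2, Measure.measure_prod_null hpm]
  refine ae_of_all _ fun x => ?_
  simp only [Pi.zero_apply]
  rw [Measure.map_apply (hm v) (measurable_prodMk_left hpm)]
  -- Once the other terms are fixed, the equation prescribes a single value of the coordinate v, and
  -- the law of v has no atoms.
  have h3 : (fun ω : ℕ → ℝ => ω v * a v) ⁻¹' (Prod.mk x ⁻¹' {p : ℝ × ℝ | c + p.1 + p.2 = 0}) =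
      (Function.eval v : (ℕ → ℝ) → ℝ) ⁻¹' ({-(c + x) / a v} : Set ℝ) := by
    ext ω
    simp only [Set.mem_preimage, Set.mem_ofPred_eq, Set.mem_singleton_iff, Function.eval]
    rw [eq_div_iff ha]
    constructor <;> intro h <;> linarith
  rw [h3, (measurePreserving_eval_infinitePi ν v).measure_preimage
    (measurableSet_singleton _).nullMeasurableSet]
  exact hν _

theorem exists_coeff_ne_zero {S : List ℕ} {L : (ℕ → ℝ) → ℝ} (h : coeffSum S L ≠ 0) :
    ∃ v ∈ S, L (Pi.single v 1) - L 0 ≠ 0 := by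
  by_contra! hc
  apply h
  unfold coeffSum
  rw [List.sum_eq_zero]
  simp only [List.mem_map]
  rintro _ ⟨v, hv, rfl⟩
  rw [hc v hv, abs_zero]

theorem ae_gap_ne_zero (st : SymState) (B : BExp)
    (h : coeffSum (sampledVars st.2.1) (fun ω => st.toState.gap ω B) ≠ 0) :
    ∀ᵐ ω ∂st.toState.law, st.toState.gap ω B ≠ 0 := by
  obtain ⟨v, hv, ha⟩ := exists_coeff_ne_zero h
  have haff := isAffine_gap (nodup_sampledVars st.2.1) st.toState B
  obtain ⟨e, he⟩ := mem_sampledVars.1 hv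
  have hnull := measure_linear_eq_zero (ν := st.toState.coordLaw) (sampledVars st.2.1).toFinset
    (fun v => st.toState.gap (Pi.single v 1) B - st.toState.gap 0 B) (st.toState.gap 0 B)
    (List.mem_toFinset.2 hv) ha (by
      rw [coordLaw_of_lookup he]; exact entryDistr_law_singleton e)
  have hae : ∀ᵐ ω ∂st.toState.law, ¬ (st.toState.gap 0 B + ∑ w ∈ (sampledVars st.2.1).toFinset,
      ω w * (st.toState.gap (Pi.single w 1) B - st.toState.gap 0 B) = 0) := by
    rw [ae_iff]
    simp only [not_not]
    exact hnull
  filter_upwards [hae, ae_supported st] with ω h1 h2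
  have := haff ω h2
  rw [list_sum_map_eq_finset_sum (nodup_sampledVars _)] at this
  simp only at this
  rwa [this]

/-! ## Convergence of the bounds for the probability of a state -/

/-- The corner of the cell containing a valuation. -/
noncomputable def cellOf (S : List ℕ) (m : ℕ) (ω : ℕ → ℝ) : Asg := S.map fun v => (v, corner m (ω v))

theorem cellOf_mem_assigns {S : List ℕ} {m : ℕ} {ω : ℕ → ℝ} :
    cellOf S m ω ∈ assigns S (grid m) ↔ ∀ v ∈ S, corner m (ω v) ∈ grid m := by
  rw [mem_assigns, cellOf]
  simp [Function.comp_def]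

theorem cellOf_toReal_of_mem {S : List ℕ} {m : ℕ} {ω : ℕ → ℝ} {v : ℕ} (hv : v ∈ S) :
    (cellOf S m ω).toReal v = corner m (ω v) := by
  simp [Asg.toReal, asgVal, cellOf, lookup_map_mk, hv]

theorem cellOf_toReal_of_notMem {S : List ℕ} {m : ℕ} {ω : ℕ → ℝ} {v : ℕ} (hv : v ∉ S) :
    (cellOf S m ω).toReal v = 0 := by
  simp [Asg.toReal, asgVal, cellOf, lookup_map_mk, hv]

theorem cellOf_eq_iff {S : List ℕ} {m : ℕ} {c : Asg} (hc : c ∈ assigns S (grid m))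
    (ω : ℕ → ℝ) : cellOf S m ω = c ↔
      ∀ p ∈ c, ω p.1 ∈ Set.Ico (p.2 : ℝ) (p.2 + mesh m) := by
  obtain ⟨rfl, hc'⟩ := mem_assigns.1 hc
  rw [cellOf, List.map_map]
  conv_lhs => rhs; rw [← List.map_id c]
  rw [List.map_inj_left]
  refine forall₂_congr fun p hp => ?_
  rw [← corner_eq_iff (hc' p hp)]
  simp [Prod.ext_iff]

/-- The probability that a coordinate lies in a cell. -/
noncomputable def entryMass (τ : State) (m : ℕ) (p : ℕ × ℚ) : ℝ :=
  (τ.coordLaw p.1).real (Set.Ico (p.2 : ℝ) (p.2 + mesh m))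

/-- A cell is a box in the coordinates of `S`, so its mass under the product law is the product of
the masses of its sides. -/
theorem law_real_cell (τ : State) {S : List ℕ} (hS : S.Nodup) {m : ℕ} {c : Asg}
    (hc : c ∈ assigns S (grid m)) :
    τ.law.real {ω | cellOf S m ω = c} = (c.map (entryMass τ m)).prod := by
  have hset : {ω : ℕ → ℝ | cellOf S m ω = c} = Set.pi (c.map Prod.fst).toFinset
      fun v => Set.Ico (asgVal c v : ℝ) (asgVal c v + mesh m) := by
    ext ω
    rw [Set.mem_ofPred_eq, cellOf_eq_iff hc, Set.mem_pi]
    obtain ⟨rfl, -⟩ := mem_assigns.1 hc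
    have hl : ∀ p ∈ c, asgVal c p.1 = p.2 := fun p hp => by
      rw [asgVal, lookup_eq_some_of_mem hS hp, Option.getD_some]
    constructor
    · intro h v hv
      obtain ⟨p, hp, rfl⟩ := List.mem_map.1 (List.mem_toFinset.1 hv)
      rw [hl p hp]
      exact h p hp
    · intro h p hp
      have := h p.1 (List.mem_toFinset.2 (List.mem_map_of_mem hp))
      rwa [hl p hp] at this
  obtain ⟨rfl, -⟩ := mem_assigns.1 hc
  have hl : ∀ p ∈ c, asgVal c p.1 = p.2 := fun p hp => by
    rw [asgVal, lookup_eq_some_of_mem hS hp, Option.getD_some]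
  have hpi := Measure.infinitePi_pi (μ := τ.coordLaw) (s := (c.map Prod.fst).toFinset)
    (t := fun v => Set.Ico (asgVal c v : ℝ) (asgVal c v + mesh m)) fun _ _ => measurableSet_Ico
  rw [hset, State.law_eq, measureReal_def, hpi, ENNReal.toReal_prod, List.prod_toFinset _ hS,
    List.map_map]
  congr 1
  refine List.map_congr_left fun p hp => ?_
  simp only [Function.comp_apply, entryMass, hl p hp, measureReal_def]

theorem measurableSet_cell {S : List ℕ} {m : ℕ} {c : Asg} (hc : c ∈ assigns S (grid m)) :
    MeasurableSet {ω : ℕ → ℝ | cellOf S m ω = c} := by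
  have : {ω : ℕ → ℝ | cellOf S m ω = c} = ⋂ p ∈ c.toFinset,
      (fun ω : ℕ → ℝ => ω p.1) ⁻¹' Set.Ico (p.2 : ℝ) (p.2 + mesh m) := by
    ext ω
    simp [cellOf_eq_iff hc]
  rw [this]
  exact Finset.measurableSet_biInter _ fun p _ => measurable_pi_apply _ measurableSet_Ico

/-- The union of the cells of the grid that satisfy a condition. -/
def cellUnion (S : List ℕ) (m : ℕ) (g : Asg → Bool) : Set (ℕ → ℝ) :=
  {ω | cellOf S m ω ∈ assigns S (grid m) ∧ g (cellOf S m ω) = true}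

theorem cellUnion_eq (S : List ℕ) (m : ℕ) (g : Asg → Bool) :
    cellUnion S m g = ⋃ c ∈ ((assigns S (grid m)).filter g).toFinset, {ω | cellOf S m ω = c} := by
  ext ω
  simp [cellUnion]

theorem measurableSet_cellUnion (S : List ℕ) (m : ℕ) (g : Asg → Bool) :
    MeasurableSet (cellUnion S m g) := by
  rw [cellUnion_eq]
  refine Finset.measurableSet_biUnion _ fun c hc => measurableSet_cell ?_
  exact (List.mem_filter.1 (List.mem_toFinset.1 hc)).1

theorem sum_map_filter_eq {α M : Type*} [AddCommMonoid M] (l : List α) (g : α → Bool) (f : α → M) :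
    ((l.filter g).map f).sum = (l.map fun c => cond (g c) (f c) 0).sum := by
  induction l with
  | nil => rfl
  | cons a l ih =>
    rw [List.filter_cons, List.map_cons, List.sum_cons, ← ih]
    cases g a <;> simp

theorem law_real_cellUnion (τ : State) {S : List ℕ} (hS : S.Nodup) (m : ℕ) (g : Asg → Bool) :
    τ.law.real (cellUnion S m g) =
      ((assigns S (grid m)).map fun c => cond (g c) ((c.map (entryMass τ m)).prod) 0).sum := by
  rw [cellUnion_eq, measureReal_biUnion_finset]
  · rw [← sum_map_filter_eq,
      list_sum_map_eq_finset_sum ((nodup_assigns S (nodup_grid m)).filter _)]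
    exact Finset.sum_congr rfl fun c hc => law_real_cell τ hS
      (List.mem_filter.1 (List.mem_toFinset.1 hc)).1
  · intro c _ c' _ hcc
    rw [Function.onFun, Set.disjoint_left]
    rintro ω (h : _ = _) (h' : _ = _)
    exact hcc (h.symm.trans h')
  · intro c hc
    exact measurableSet_cell (List.mem_filter.1 (List.mem_toFinset.1 hc)).1

/-! ### Comparison of rational weights with masses of cells -/

theorem entryWeight_nonneg (b : List (ℕ × Entry)) (m : ℕ) (p : ℕ × ℚ) : 0 ≤ entryWeight b m p := by
  unfold entryWeight
  rcases b.lookup p.1 with _ | (e | R)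
  · exact le_refl _
  · exact weight_nonneg e m p.2
  · exact le_refl _

theorem entryWeight_le (st : SymState) (m : ℕ) (p : ℕ × ℚ) :
    ((entryWeight st.2.1 m p : ℚ) : ℝ) ≤ entryMass st.toState m p := by
  unfold entryWeight
  rcases h : st.2.1.lookup p.1 with _ | (e | R)
  · simp only [Option.elim_none, Rat.cast_zero]
    exact measureReal_nonneg
  · simp only [Option.elim_some, Sum.elim_inl, entryMass]
    rw [coordLaw_of_lookup h]
    exact weight_le e m p.2
  · simp only [Option.elim_some, Sum.elim_inr, Rat.cast_zero]
    exact measureReal_nonneg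

theorem prod_entryWeight_le (st : SymState) (m : ℕ) (c : Asg) :
    (c.map fun p => ((entryWeight st.2.1 m p : ℚ) : ℝ)).prod ≤
      (c.map (entryMass st.toState m)).prod :=
  List.prod_map_le_prod_map₀ _ _ (fun p _ => by exact_mod_cast entryWeight_nonneg _ _ _)
    fun p _ => entryWeight_le st m p

/-- The error of the approximation of the law by the weights. -/
noncomputable def weightError (st : SymState) (m : ℕ) : ℝ :=
  1 - ((sampledVars st.2.1).map fun v =>
    ((grid m).map fun d => ((entryWeight st.2.1 m (v, d) : ℚ) : ℝ)).sum).prod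

theorem tendsto_weightError (st : SymState) : Tendsto (weightError st) atTop (𝓝 0) := by
  have h := tendsto_list_prod (f := fun v m =>
    ((grid m).map fun d => ((entryWeight st.2.1 m (v, d) : ℚ) : ℝ)).sum) (x := atTop)
    (a := fun _ => (1 : ℝ)) (sampledVars st.2.1) (fun v hv => by
      obtain ⟨e, he⟩ := mem_sampledVars.1 hv
      simp only [entryWeight, he, Option.elim_some, Sum.elim_inl]
      exact tendsto_sum_weight e)
  have h2 : ((sampledVars st.2.1).map fun _ => (1 : ℝ)).prod = 1 := by simp
  rw [h2] at h
  have h3 := (tendsto_const_nhds (x := (1 : ℝ))).sub h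
  rw [sub_self] at h3
  exact h3

theorem lowerQ_cast (t : Bool) (st : SymState) (m : ℕ) : ((lowerQ t st m : ℚ) : ℝ) =
    ((assigns (sampledVars st.2.1) (grid m)).map fun c => cond (goodCell t st m c)
      ((c.map fun p => ((entryWeight st.2.1 m p : ℚ) : ℝ)).prod) 0).sum := by
  unfold lowerQ
  rw [Rat.cast_list_sum, List.map_map]
  congr 1
  refine List.map_congr_left fun c _ => ?_
  simp only [Function.comp_apply]
  cases goodCell t st m c
  · simp
  · simp [Rat.cast_list_prod, Function.comp_def]

theorem lowerQ_le_cellUnion (t : Bool) (st : SymState) (m : ℕ) : ((lowerQ t st m : ℚ) : ℝ) ≤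
    st.toState.law.real (cellUnion (sampledVars st.2.1) m (goodCell t st m)) := by
  rw [lowerQ_cast, law_real_cellUnion _ (nodup_sampledVars _)]
  refine List.sum_le_sum fun c _ => ?_
  cases goodCell t st m c
  · exact le_refl _
  · exact prod_entryWeight_le st m c

/-- No cell is overestimated, so the loss on the good cells is at most the loss on all cells. This
bound does not depend on which cells are good, and the total weight factors over the coordinates by
`sum_assigns_prod`. -/
theorem cellUnion_sub_lowerQ_le (t : Bool) (st : SymState) (m : ℕ) :
    st.toState.law.real (cellUnion (sampledVars st.2.1) m (goodCell t st m)) - (lowerQ t st m : ℝ)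
      ≤ weightError st m := by
  have hall := law_real_cellUnion st.toState (nodup_sampledVars st.2.1) m fun _ => true
  have h1 : st.toState.law.real (cellUnion (sampledVars st.2.1) m fun _ => true) ≤ 1 :=
    measureReal_le_one
  rw [weightError, ← sum_assigns_prod _ _ fun p => ((entryWeight st.2.1 m p : ℚ) : ℝ), lowerQ_cast,
    law_real_cellUnion _ (nodup_sampledVars _)]
  -- The number 1 in `weightError` is replaced by the total mass of the cells of the grid, which is
  -- at most 1.
  refine le_trans ?_ (sub_le_sub_right (hall ▸ h1) _)
  simp only [cond_true]
  have key : ∀ l : List Asg, (l.map fun c => cond (goodCell t st m c)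
      ((c.map (entryMass st.toState m)).prod) 0).sum - (l.map fun c => cond (goodCell t st m c)
      ((c.map fun p => ((entryWeight st.2.1 m p : ℚ) : ℝ)).prod) 0).sum ≤
      (l.map fun c => (c.map (entryMass st.toState m)).prod).sum -
      (l.map fun c => (c.map fun p => ((entryWeight st.2.1 m p : ℚ) : ℝ)).prod).sum := by
    intro l
    induction l with
    | nil => simp
    | cons c l ih =>
      simp only [List.map_cons, List.sum_cons]
      have := prod_entryWeight_le st m c
      cases goodCell t st m c <;> simp only [cond_true, cond_false] <;> linarith
  exact key _

/-- A perturbation smaller than |y| cannot change the sign of y, and every comparison with 0 depends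
on the sign only. -/
theorem holds_congr_of_abs_sub_lt (c : Cmp) {x y : ℝ} (h : x = y ∨ |x - y| < |y|) :
    c.Holds x 0 ↔ c.Holds y 0 := by
  rcases h with rfl | h
  · rfl
  · rcases lt_trichotomy y 0 with hy | rfl | hy
    · rw [abs_of_neg hy, abs_lt] at h
      have hx : x < 0 := by linarith
      cases c <;> simp [Cmp.Holds, hx, hy, hx.le, hy.le, hx.ne, hy.ne, not_le.2 hx, not_le.2 hy,
        not_lt.2 hx.le, not_lt.2 hy.le]
    · simp at h
      exact absurd (abs_nonneg x) (not_le.2 h)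
    · rw [abs_of_pos hy, abs_lt] at h
      have hx : 0 < x := by linarith
      cases c <;> simp [Cmp.Holds, hx, hy, hx.le, hy.le, hx.ne', hy.ne', not_le.2 hx, not_le.2 hy,
        not_lt.2 hx.le, not_lt.2 hy.le]

theorem abs_gap_sub_le (st : SymState) (m : ℕ) (B : BExp) {ω : ℕ → ℝ}
    (hω : ∀ v, v ∉ sampledVars st.2.1 → ω v = 0) :
    |st.toState.gap ω B - st.toState.gap (cellOf (sampledVars st.2.1) m ω).toReal B| ≤
      coeffSum (sampledVars st.2.1) (fun ω => st.toState.gap ω B) * mesh m := by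
  refine (isAffine_gap (nodup_sampledVars st.2.1) st.toState B).abs_sub_le hω
    (fun v hv => cellOf_toReal_of_notMem hv) fun v hv => ?_
  rw [cellOf_toReal_of_mem hv]
  exact abs_sub_corner_le m _

theorem decidedQ_iff (st : SymState) (m : ℕ) (c : Asg) (B : BExp) : decidedQ st m c B = true ↔
    coeffSum (sampledVars st.2.1) (fun ω => st.toState.gap ω B) = 0 ∨
    coeffSum (sampledVars st.2.1) (fun ω => st.toState.gap ω B) * mesh m <
      |st.toState.gap c.toReal B| := by
  unfold decidedQ
  rw [Bool.or_eq_true, decide_eq_true_eq, decide_eq_true_eq, ← spreadQ_cast, ← gapQ_cast, mesh,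
    mul_one_div, Rat.cast_eq_zero]
  refine or_congr Iff.rfl ?_
  rw [← Rat.cast_abs]
  exact_mod_cast (Rat.cast_lt (K := ℝ) (p := spreadQ st B / ((m + 1 : ℕ) : ℚ))).symm

theorem holdsQ_iff_sat_of_decidedQ (st : SymState) (m : ℕ) (B : BExp) {ω : ℕ → ℝ}
    (hω : ∀ v, v ∉ sampledVars st.2.1 → ω v = 0)
    (hd : decidedQ st m (cellOf (sampledVars st.2.1) m ω) B = true) :
    holdsQ st (cellOf (sampledVars st.2.1) m ω) B = true ↔ st.toState.Sat ω B := by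
  rw [holdsQ_iff, State.Sat, State.Sat]
  refine (holds_congr_of_abs_sub_lt _ ?_).symm
  have h := abs_gap_sub_le st m B hω
  rcases (decidedQ_iff _ _ _ _).1 hd with h0 | h0
  · rw [h0, zero_mul] at h
    exact .inl (sub_eq_zero.1 (abs_nonpos_iff.1 h))
  · exact .inr (h.trans_lt h0)

theorem goodCell_iff (t : Bool) (st : SymState) (m : ℕ) (c : Asg) : goodCell t st m c = true ↔
    (∀ B ∈ st.2.2, decidedQ st m c B = true) ∧
      ((∀ B ∈ st.2.2, holdsQ st c B = true) ↔ t = true) := by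
  unfold goodCell
  rw [Bool.and_eq_true, List.all_eq_true, beq_iff_eq, Bool.eq_iff_iff, List.all_eq_true]

theorem mem_event_iff_of_goodCell (t : Bool) (st : SymState) (m : ℕ) {ω : ℕ → ℝ}
    (hω : ∀ v, v ∉ sampledVars st.2.1 → ω v = 0)
    (hg : goodCell t st m (cellOf (sampledVars st.2.1) m ω) = true) :
    ω ∈ st.toState.event ↔ t = true := by
  obtain ⟨h1, h2⟩ := (goodCell_iff _ _ _ _).1 hg
  rw [← h2]
  exact forall₂_congr fun B hB => (holdsQ_iff_sat_of_decidedQ st m B hω (h1 B hB)).symm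

/-- A constant gap is decided at every precision. Otherwise the gap is almost surely nonzero, while
its oscillation over the cell containing ω tends to 0. -/
theorem eventually_decidedQ (st : SymState) (B : BExp) : ∀ᵐ ω ∂st.toState.law,
    ∀ᶠ m in atTop, decidedQ st m (cellOf (sampledVars st.2.1) m ω) B = true := by
  by_cases h0 : coeffSum (sampledVars st.2.1) (fun ω => st.toState.gap ω B) = 0
  · exact ae_of_all _ fun ω => Eventually.of_forall fun m => (decidedQ_iff _ _ _ _).2 (.inl h0)
  · filter_upwards [ae_gap_ne_zero st B h0, ae_supported st] with ω h1 h2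
    set C := coeffSum (sampledVars st.2.1) (fun ω => st.toState.gap ω B)
    -- One C · mesh is lost in passing from ω to the corner and another must still lie below the gap
    -- at the corner; hence the factor 2.
    have h3 : Tendsto (fun m => 2 * (C * mesh m)) atTop (𝓝 0) := by
      simpa using (tendsto_mesh.const_mul C).const_mul 2
    filter_upwards [h3.eventually_lt_const (abs_pos.2 h1)] with m hm
    refine (decidedQ_iff _ _ _ _).2 (.inr ?_)
    have h4 := abs_gap_sub_le st m B h2
    have h5 := abs_sub_abs_le_abs_sub (st.toState.gap ω B)
      (st.toState.gap (cellOf (sampledVars st.2.1) m ω).toReal B)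
    linarith

/-- The event that the conjunction of all conditions has a given truth value. -/
def State.eventOf (τ : State) (t : Bool) : Set (ℕ → ℝ) := cond t τ.event τ.eventᶜ

theorem mem_eventOf {τ : State} {t : Bool} {ω : ℕ → ℝ} :
    ω ∈ τ.eventOf t ↔ (ω ∈ τ.event ↔ t = true) := by
  cases t <;> simp [State.eventOf]

theorem measurableSet_eventOf (st : SymState) (t : Bool) :
    MeasurableSet (st.toState.eventOf t) := by
  cases t
  · exact (measurableSet_event st).compl
  · exact measurableSet_event st

/-- The good cells lie in the event only up to a null set, because a cell restricts only the sampled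
coordinates. -/
theorem lowerQ_le (t : Bool) (st : SymState) (m : ℕ) :
    ((lowerQ t st m : ℚ) : ℝ) ≤ st.toState.law.real (st.toState.eventOf t) := by
  refine (lowerQ_le_cellUnion t st m).trans ?_
  rw [measureReal_def, measureReal_def]
  refine ENNReal.toReal_mono (measure_ne_top _ _) (measure_mono_ae ?_)
  filter_upwards [ae_supported st] with ω hω h
  exact mem_eventOf.2 (mem_event_iff_of_goodCell t st m hω h.2)

/-- For almost every ω, at all large precisions, ω lies in the grid and all of the finitely many
conditions are decided in its cell. Then ω belongs to a good cell exactly when it belongs to the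
event, so the indicators converge almost everywhere. -/
theorem tendsto_cellUnion (t : Bool) (st : SymState) : Tendsto (fun m => st.toState.law.real
    (cellUnion (sampledVars st.2.1) m (goodCell t st m))) atTop
    (𝓝 (st.toState.law.real (st.toState.eventOf t))) := by
  refine (ENNReal.tendsto_toReal (measure_ne_top _ _)).comp ?_
  refine tendsto_measure_of_ae_tendsto_indicator atTop (measurableSet_eventOf st t)
    (fun m => measurableSet_cellUnion _ _ _) MeasurableSet.univ (measure_ne_top _ _)
    (Eventually.of_forall fun m => Set.subset_univ _) ?_
  have hdec : ∀ᵐ ω ∂st.toState.law, ∀ B ∈ {B | B ∈ st.2.2}, ∀ᶠ m in atTop,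
      decidedQ st m (cellOf (sampledVars st.2.1) m ω) B = true :=
    (ae_ball_iff (List.finite_toSet st.2.2).countable).2 fun B _ => eventually_decidedQ st B
  filter_upwards [hdec, ae_supported st] with ω h1 h2
  have h3 : ∀ᶠ m in atTop, ∀ B ∈ st.2.2,
      decidedQ st m (cellOf (sampledVars st.2.1) m ω) B = true :=
    (List.finite_toSet st.2.2).eventually_all.2 h1
  have h4 : ∀ᶠ m in atTop, ∀ v ∈ sampledVars st.2.1, corner m (ω v) ∈ grid m := by
    refine (List.finite_toSet (sampledVars st.2.1)).eventually_all.2 fun v _ => ?_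
    obtain ⟨M, hM⟩ := exists_nat_gt |ω v|
    filter_upwards [eventually_ge_atTop M] with m hm
    have hmM : (M : ℝ) ≤ m := by exact_mod_cast hm
    exact corner_mem_grid (by linarith)
  filter_upwards [h3, h4] with m h5 h6
  rw [mem_eventOf]
  constructor
  · exact fun h => mem_event_iff_of_goodCell t st m h2 h.2
  · intro h
    refine ⟨cellOf_mem_assigns.2 h6, (goodCell_iff _ _ _ _).2 ⟨h5, ?_⟩⟩
    rw [← h]
    exact forall₂_congr fun B hB => holdsQ_iff_sat_of_decidedQ st m B h2 (h5 B hB)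

theorem tendsto_lowerQ (t : Bool) (st : SymState) : Tendsto (fun m => ((lowerQ t st m : ℚ) : ℝ))
    atTop (𝓝 (st.toState.law.real (st.toState.eventOf t))) := by
  have h1 := (tendsto_cellUnion t st).sub (tendsto_weightError st)
  rw [sub_zero] at h1
  refine tendsto_of_tendsto_of_tendsto_of_le_of_le h1 tendsto_const_nhds (fun m => ?_)
    fun m => lowerQ_le t st m
  have := cellUnion_sub_lowerQ_le t st m
  simp only
  linarith

/-- Turns lower bounds for the probability that the conditions fail into upper bounds for the
probability of the state. -/
theorem law_real_eventOf_false (st : SymState) :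
    1 - st.toState.law.real (st.toState.eventOf false) = st.toState.prob := by
  rw [prob_eq]
  simp only [State.eventOf, cond_false]
  rw [probReal_compl_eq_one_sub (measurableSet_event st)]
  ring

theorem probQ_false_le (st : SymState) (m : ℕ) :
    ((probQ false st m : ℚ) : ℝ) ≤ st.toState.prob := by
  rw [prob_eq]
  exact lowerQ_le true st m

theorem le_probQ_true (st : SymState) (m : ℕ) :
    st.toState.prob ≤ ((probQ true st m : ℚ) : ℝ) := by
  rw [← law_real_eventOf_false]
  have := lowerQ_le false st m
  simp only [probQ, cond_true, Rat.cast_sub, Rat.cast_one]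
  linarith

theorem tendsto_probQ (t : Bool) (st : SymState) :
    Tendsto (fun m => ((probQ t st m : ℚ) : ℝ)) atTop (𝓝 st.toState.prob) := by
  cases t
  · rw [prob_eq]
    exact tendsto_lowerQ true st
  · rw [← law_real_eventOf_false]
    simp only [probQ, cond_true, Rat.cast_sub, Rat.cast_one]
    exact tendsto_const_nhds.sub (tendsto_lowerQ false st)

/-! ## Approximation of the exponential function -/

theorem expQ_false_nonneg {s : ℚ} (hs : 0 ≤ s) (m : ℕ) : 0 ≤ expQ false s m := by
  unfold expQ
  simp only [cond_false]
  positivity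

theorem expQ_false_le {s : ℚ} (hs : 0 ≤ s) (m : ℕ) : (expQ false s m : ℝ) ≤ Real.exp s := by
  have hs' : (0 : ℝ) ≤ s := by exact_mod_cast hs
  simp only [expQ, cond_false]
  push_cast
  calc (1 + (s : ℝ) / (m + 1)) ^ (m + 1) ≤ Real.exp ((s : ℝ) / (m + 1)) ^ (m + 1) := by
        gcongr
        rw [add_comm]
        exact Real.add_one_le_exp _
    _ = Real.exp s := by
        rw [← Real.exp_nat_mul]
        congr 1
        push_cast
        field_simp

/-- A positive rational is at most its numerator. With this exponent M the base 1 - s/M of the upper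
bound is positive and can be inverted. -/
theorem lt_succ_num_toNat (s : ℚ) (m : ℕ) : (s : ℝ) < ((m + 1 + s.num.toNat : ℕ) : ℝ) := by
  have h1 : s ≤ (s.num.toNat : ℚ) := by
    rcases le_or_gt s 0 with h | h
    · exact h.trans (by positivity)
    · have h2 : (s.num : ℚ) = (s.num.toNat : ℚ) := by
        have : ((s.num.toNat : ℤ)) = s.num := Int.toNat_of_nonneg (Rat.num_nonneg.2 h.le)
        rw [← Int.cast_natCast, this]
      rw [← h2]
      conv_lhs => rw [← Rat.num_div_den s]
      refine div_le_self (by exact_mod_cast Rat.num_nonneg.2 h.le) ?_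
      exact_mod_cast s.den_pos
  have h3 : (s : ℝ) ≤ (s.num.toNat : ℝ) := by exact_mod_cast h1
  push_cast
  have : (0 : ℝ) ≤ m := by positivity
  linarith

/-- Obtained by inverting (1 - s/M)^M ≤ exp(-s). -/
theorem le_expQ_true (s : ℚ) (m : ℕ) : Real.exp s ≤ (expQ true s m : ℝ) := by
  have h := lt_succ_num_toNat s m
  simp only [expQ, cond_true]
  generalize hM : m + 1 + s.num.toNat = M at h
  have hM0 : (0 : ℝ) < M := by
    have : 0 < M := by omega
    exact_mod_cast this
  have h1 := Real.one_sub_div_pow_le_exp_neg h.le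
  have h2 : (0 : ℝ) < (1 - (s : ℝ) / M) ^ M := by
    refine pow_pos ?_ _
    rw [sub_pos, div_lt_one hM0]
    exact h
  rw [Real.exp_neg] at h1
  have := inv_anti₀ h2 h1
  rw [inv_inv] at this
  push_cast
  exact this

theorem tendsto_expQ (t : Bool) (s : ℚ) :
    Tendsto (fun m => (expQ t s m : ℝ)) atTop (𝓝 (Real.exp s)) := by
  cases t
  · have h := (tendsto_add_atTop_iff_nat 1).2 (Real.tendsto_one_add_div_pow_exp (s : ℝ))
    refine h.congr fun m => ?_
    simp only [expQ, cond_false]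
    push_cast
    rfl
  · have h := (tendsto_add_atTop_iff_nat (1 + s.num.toNat)).2
      (Real.tendsto_one_add_div_pow_exp (-(s : ℝ)))
    have h2 := h.inv₀ (Real.exp_ne_zero _)
    rw [Real.exp_neg, inv_inv] at h2
    refine h2.congr fun m => ?_
    simp only [expQ, cond_true]
    push_cast
    rw [neg_div, ← sub_eq_add_neg, add_assoc, add_assoc]

/-! ## Final states and control paths -/

theorem lookup_cons_eq_update {β : Type*} (p : ℕ × β) (l : List (ℕ × β)) :
    (fun x => (p :: l).lookup x) = Function.update (fun x => l.lookup x) p.1 (some p.2) := by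
  funext x
  rw [← Prod.mk.eta (p := p), List.lookup_cons]
  by_cases h : x = p.1
  · subst h; simp
  · rw [beq_false_of_ne h, Function.update_of_ne h]

theorem subst_toState (st : SymState) (R : RExp) :
    R.subst st.toState.β = substEntries st.2.1 R := by
  induction R with
  | var r =>
    simp only [RExp.subst, substEntries, SymState.toState]
    rcases st.2.1.lookup r with _ | (e | R) <;> rfl
  | smul q R ih => simp only [RExp.subst, substEntries, ih]
  | add R₁ R₂ ih₁ ih₂ => simp only [RExp.subst, substEntries, ih₁, ih₂]
  | addConst R q ih => simp only [RExp.subst, substEntries, ih]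

theorem domVal_toState (st : SymState) (x : ℕ) : st.toState.domVal x = asgVal st.1 x := rfl

theorem toState_assignDom (ε : ℚ) (st : SymState) (x : ℕ) (d : ℚ) :
    (symStep ε st (.inl (x, d))).toState =
      ⟨Function.update st.toState.α x (some d), st.toState.β, st.toState.G⟩ :=
  State.ext (lookup_cons_eq_update (x, d) st.1) rfl rfl

theorem toState_β_cons (st : SymState) (r : ℕ) (e : Entry) :
    (SymState.toState (st.1, (r, e) :: st.2.1, st.2.2)).β =
      Function.update st.toState.β r (some e.toReal) := by
  have h := lookup_cons_eq_update (r, e) st.2.1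
  funext v
  have hv := congrFun h v
  simp only [SymState.toState] at hv ⊢
  rw [hv]
  by_cases hr : v = r
  · subst hr; simp
  · rw [Function.update_of_ne hr, Function.update_of_ne hr]

theorem toState_sample (ε : PosRat) (st : SymState) (k : Family) (r x : ℕ) (a : PosRat) :
    (symStep ε.1 st (.inr (.inl (k, r, x, a.1)))).toState =
      ⟨st.toState.α, Function.update st.toState.β r
        (some (.inl ⟨k, st.toState.domVal x, ⟨a.1 / ε.1, div_pos a.2 ε.2⟩⟩)), st.toState.G⟩ := by
  refine State.ext rfl ((toState_β_cons st r _).trans ?_) rfl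
  -- The scale a/ε is positive, so the repair of scales leaves it unchanged.
  have : (⟨fixScale (a.1 / ε.1), fixScale_pos _⟩ : PosRat) = ⟨a.1 / ε.1, div_pos a.2 ε.2⟩ := by
    refine Subtype.ext ?_
    simp [fixScale, div_pos a.2 ε.2]
  simp only [Entry.toReal, Sum.map_inl, entryDistr, domVal_toState, this]

theorem toState_assignReal (ε : ℚ) (st : SymState) (r : ℕ) (R : RExp) :
    (symStep ε st (.inr (.inr (.inl (r, R))))).toState =
      ⟨st.toState.α, Function.update st.toState.β r (some (.inr (R.subst st.toState.β))),
        st.toState.G⟩ := by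
  rw [subst_toState]
  exact State.ext rfl (toState_β_cons st r _) rfl

theorem toState_test (ε : ℚ) (st : SymState) (B : BExp) :
    (symStep ε st (.inr (.inr (.inr B)))).toState =
      ⟨st.toState.α, st.toState.β, insert B st.toState.G⟩ :=
  State.ext rfl rfl (Set.ext fun _ => List.mem_cons)

theorem symRun_append (ε : ℚ) (st : SymState) (p q : List Instr) :
    symRun ε st (p ++ q) = symRun ε (symRun ε st p) q := List.foldl_append

/-- Conditions are never removed during execution, so a contradiction met on the way survives in
every later state. -/
theorem Stmt.subset_of_mem_finals {ε : PosRat} {S : Stmt} {τ τ' : State}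
    (h : τ' ∈ S.finals ε τ) : τ.G ⊆ τ'.G := by
  classical
  induction S generalizing τ τ' with
  | assignDom x d => rw [Finset.mem_singleton.1 h]
  | sample k r x a => rw [Finset.mem_singleton.1 h]
  | assignReal r R => rw [Finset.mem_singleton.1 h]
  | ite B S₁ S₂ ih₁ ih₂ =>
    rcases Finset.mem_union.1 h with h | h
    · exact (Set.subset_insert _ _).trans (ih₁ h)
    · exact (Set.subset_insert _ _).trans (ih₂ h)
  | skip => rw [Finset.mem_singleton.1 h]
  | seq S₁ S₂ ih₁ ih₂ =>
    obtain ⟨σ, h1, h2⟩ := Finset.mem_biUnion.1 h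
    exact (ih₁ h1).trans (ih₂ h2)

/-- Distinct final states differ in the outcome of a test. -/
theorem Stmt.exists_test_of_ne {ε : PosRat} {S : Stmt} {τ τ₁ τ₂ : State}
    (h₁ : τ₁ ∈ S.finals ε τ) (h₂ : τ₂ ∈ S.finals ε τ) (hne : τ₁ ≠ τ₂) :
    ∃ B : BExp, B ∈ τ₁.G ∧ B.neg ∈ τ₂.G ∨ B ∈ τ₂.G ∧ B.neg ∈ τ₁.G := by
  classical
  induction S generalizing τ τ₁ τ₂ with
  | assignDom x d =>
    exact absurd ((Finset.mem_singleton.1 h₁).trans (Finset.mem_singleton.1 h₂).symm) hne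
  | sample k r x a =>
    exact absurd ((Finset.mem_singleton.1 h₁).trans (Finset.mem_singleton.1 h₂).symm) hne
  | assignReal r R =>
    exact absurd ((Finset.mem_singleton.1 h₁).trans (Finset.mem_singleton.1 h₂).symm) hne
  | ite B S₁ S₂ ih₁ ih₂ =>
    rcases Finset.mem_union.1 h₁ with h₁ | h₁ <;> rcases Finset.mem_union.1 h₂ with h₂ | h₂
    · exact ih₁ h₁ h₂ hne
    · exact ⟨B, .inl ⟨subset_of_mem_finals h₁ (Set.mem_insert _ _),
        subset_of_mem_finals h₂ (Set.mem_insert _ _)⟩⟩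
    · exact ⟨B, .inr ⟨subset_of_mem_finals h₂ (Set.mem_insert _ _),
        subset_of_mem_finals h₁ (Set.mem_insert _ _)⟩⟩
    · exact ih₂ h₁ h₂ hne
  | skip =>
    exact absurd ((Finset.mem_singleton.1 h₁).trans (Finset.mem_singleton.1 h₂).symm) hne
  | seq S₁ S₂ ih₁ ih₂ =>
    obtain ⟨σ₁, h1, h1'⟩ := Finset.mem_biUnion.1 h₁
    obtain ⟨σ₂, h2, h2'⟩ := Finset.mem_biUnion.1 h₂
    by_cases h : σ₁ = σ₂
    · subst h
      exact ih₂ h1' h2' hne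
    · obtain ⟨B, hB⟩ := ih₁ h1 h2 h
      exact ⟨B, hB.imp
        (fun hB => ⟨subset_of_mem_finals h1' hB.1, subset_of_mem_finals h2' hB.2⟩)
        fun hB => ⟨subset_of_mem_finals h2' hB.1, subset_of_mem_finals h1' hB.2⟩⟩

/-- Overlaps between the sets are allowed as long as the summand vanishes there. Distinct
intermediate states may share final states, but only contradictory ones. -/
theorem sum_biUnion_of_eq_zero {ι α M : Type*} [DecidableEq ι] [DecidableEq α] [AddCommMonoid M]
    [IsCancelAdd M] (s : Finset ι) (t : ι → Finset α) (f : α → M)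
    (h : ∀ i ∈ s, ∀ j ∈ s, i ≠ j → ∀ x ∈ t i, x ∈ t j → f x = 0) :
    ∑ x ∈ s.biUnion t, f x = ∑ i ∈ s, ∑ x ∈ t i, f x := by
  induction s using Finset.induction_on with
  | empty => simp
  | insert i s hi ih =>
    rw [Finset.sum_insert hi, ← ih fun j hj k hk => h j (Finset.mem_insert_of_mem hj) k
      (Finset.mem_insert_of_mem hk), Finset.biUnion_insert, ← Finset.sum_union_inter]
    rw [Finset.sum_eq_zero (s := t i ∩ s.biUnion t), add_zero]
    intro x hx
    obtain ⟨hx1, hx2⟩ := Finset.mem_inter.1 hx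
    obtain ⟨j, hj, hxj⟩ := Finset.mem_biUnion.1 hx2
    exact h i (Finset.mem_insert_self _ _) j (Finset.mem_insert_of_mem hj)
      (fun hij => hi (hij ▸ hj)) x hx1 hxj

theorem sum_map_flatMap {α β M : Type*} [AddCommMonoid M] (l : List α) (g : α → List β) (f : β → M) :
    ((l.flatMap g).map f).sum = (l.map fun a => ((g a).map f).sum).sum := by
  induction l with
  | nil => rfl
  | cons a l ih =>
    rw [List.flatMap_cons, List.map_append, List.sum_append, ih, List.map_cons, List.sum_cons]

/-- A sum over final states is a sum over control paths, as long as contradictory states do not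
contribute. -/
theorem Stmt.sum_finals (ε : PosRat) (S : Stmt) (st : SymState) (f : State → ℝ)
    (hf : ∀ (τ : State) (B : BExp), B ∈ τ.G → B.neg ∈ τ.G → f τ = 0) :
    ∑ τ ∈ S.finals ε st.toState, f τ =
      (S.instrPaths.map fun p => f (symRun ε.1 st p).toState).sum := by
  induction S generalizing st f with
  | assignDom x d =>
    simp only [finals, Finset.sum_singleton, instrPaths, List.map_cons, List.map_nil,
      List.sum_singleton, symRun, List.foldl_cons, List.foldl_nil, toState_assignDom]
  | sample k r x a =>
    simp only [finals, Finset.sum_singleton, instrPaths, List.map_cons, List.map_nil,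
      List.sum_singleton, symRun, List.foldl_cons, List.foldl_nil, toState_sample]
  | assignReal r R =>
    simp only [finals, Finset.sum_singleton, instrPaths, List.map_cons, List.map_nil,
      List.sum_singleton, symRun, List.foldl_cons, List.foldl_nil, toState_assignReal]
  | ite B S₁ S₂ ih₁ ih₂ =>
    classical
    have h := Finset.sum_union_inter
      (s₁ := S₁.finals ε ⟨st.toState.α, st.toState.β, insert B st.toState.G⟩)
      (s₂ := S₂.finals ε ⟨st.toState.α, st.toState.β, insert B.neg st.toState.G⟩) (f := f)
    -- A final state reached from both branches contains the test and its negation, so it does not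
    -- contribute.
    rw [Finset.sum_eq_zero (s := _ ∩ _), add_zero] at h
    · rw [← toState_test ε.1, ← toState_test ε.1, ih₁ _ f hf, ih₂ _ f hf] at h
      simp only [finals, instrPaths, List.map_append, List.sum_append, List.map_map]
      rw [← toState_test ε.1, ← toState_test ε.1]
      convert h using 1
      rfl
    · intro τ hτ
      obtain ⟨h1, h2⟩ := Finset.mem_inter.1 hτ
      exact hf τ B (subset_of_mem_finals h1 (Set.mem_insert _ _))
        (subset_of_mem_finals h2 (Set.mem_insert _ _))
  | skip =>
    simp only [finals, Finset.sum_singleton, instrPaths, List.map_cons, List.map_nil,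
      List.sum_singleton, symRun, List.foldl_nil]
  | seq S₁ S₂ ih₁ ih₂ =>
    classical
    have h := sum_biUnion_of_eq_zero (S₁.finals ε st.toState) (fun τ' => S₂.finals ε τ') f ?_
    -- The induction hypothesis for the first statement is applied to the inner sum as a function of
    -- the intermediate state. It also vanishes on contradictory states, since contradictions
    -- persist; this is why `f` is arbitrary.
    · rw [ih₁ st (fun τ => ∑ τ' ∈ S₂.finals ε τ, f τ')] at h
      · rw [finals]
        convert h using 1
        rw [instrPaths, sum_map_flatMap]
        congr 1
        refine List.map_congr_left fun p _ => ?_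
        rw [ih₂ _ f hf, List.map_map]
        simp only [Function.comp_def, symRun_append]
      · intro τ B h1 h2
        exact Finset.sum_eq_zero fun τ' hτ' => hf τ' B (subset_of_mem_finals hτ' h1)
          (subset_of_mem_finals hτ' h2)
    · intro τ₁ h₁ τ₂ h₂ hne τ' h₁' h₂'
      obtain ⟨B, hB | hB⟩ := exists_test_of_ne h₁ h₂ hne
      · exact hf τ' B (subset_of_mem_finals h₁' hB.1) (subset_of_mem_finals h₂' hB.2)
      · exact hf τ' B (subset_of_mem_finals h₂' hB.1) (subset_of_mem_finals h₁' hB.2)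

/-! ### Contradictory states and the output probability as a sum over paths -/

theorem State.sat_neg_iff (τ : State) (ω : ℕ → ℝ) (B : BExp) :
    τ.Sat ω B.neg ↔ ¬ τ.Sat ω B := by
  have h1 : τ.gap ω B.neg = τ.gap ω B := by cases B <;> rfl
  have h2 : B.neg.cmp = B.cmp.neg := by cases B <;> rfl
  rw [State.Sat, State.Sat, h1, h2]
  cases B.cmp <;> simp [Cmp.neg, Cmp.Holds]

theorem State.prob_eq_zero_of_contradictory {τ : State} {B : BExp} (h : B ∈ τ.G)
    (h' : B.neg ∈ τ.G) : τ.prob = 0 := by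
  have : τ.event = ∅ := by
    refine Set.eq_empty_of_forall_notMem fun ω hω => ?_
    exact (τ.sat_neg_iff ω B).1 (hω _ h') (hω _ h)
  rw [prob_eq, this, measureReal_empty]

/-- The valuation `u` is presented by the assignment `l`. -/
def Program.Presents (P : Program) (u : P.Input) (l : Asg) : Prop :=
  ∀ x, l.lookup x = if h : x ∈ P.inputs then some (u ⟨x, h⟩).1 else none

/-- The restriction to final states with the given output is moved into the summand, to which
`Stmt.sum_finals` then applies. -/
theorem Program.prob_eq_sum_paths (P : Program) (ε : PosRat) {u : P.Input} {l : Asg}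
    (hl : P.Presents u l) {o : P.Output} {c : Asg}
    (hc : ∀ st, hasOutput c st = true ↔ ∀ y : {y // y ∈ P.outputs}, st.1.lookup y.1 = some (o y).1) :
    P.prob ε u o = (P.body.instrPaths.map fun p => cond (hasOutput c (symRun ε.1 (l, [], []) p))
      (symRun ε.1 (l, [], []) p).toState.prob 0).sum := by
  classical
  have hstart : P.init u = SymState.toState (l, [], []) := by
    refine State.ext (funext fun x => (hl x).symm) rfl (Set.ext fun B => ?_)
    simp [Program.init, SymState.toState]
  have h := P.body.sum_finals ε (l, [], [])
    (fun τ => if ∀ y : {y // y ∈ P.outputs}, τ.α y = some (o y).1 then τ.prob else 0)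
    fun τ B h h' => by rw [State.prob_eq_zero_of_contradictory h h', ite_self]
  rw [Program.prob, Program.run, hstart, Finset.sum_filter]
  convert h using 4 with τ hτ p
  rw [Bool.cond_eq_ite]
  simp only [hc, SymState.toState]
  congr

/-! ## Correctness of the approximations -/

/-- The probability of an output, as a sum over control paths. -/
noncomputable def pathsProb (S : Stmt) (ε : ℚ) (u o : Asg) : ℝ :=
  (S.instrPaths.map fun p => cond (hasOutput o (symRun ε (u, [], []) p))
    (symRun ε (u, [], []) p).toState.prob 0).sum

theorem pathsProb_nonneg (S : Stmt) (ε : ℚ) (u o : Asg) : 0 ≤ pathsProb S ε u o := by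
  refine List.sum_nonneg fun y hy => ?_
  obtain ⟨p, -, rfl⟩ := List.mem_map.1 hy
  cases hasOutput o (symRun ε (u, [], []) p)
  · exact le_rfl
  · rw [cond_true, prob_eq]
    exact measureReal_nonneg

theorem outputQ_cast (t : Bool) (S : Stmt) (ε : ℚ) (u o : Asg) (m : ℕ) :
    (outputQ t S ε u o m : ℝ) = (S.instrPaths.map fun p =>
      cond (hasOutput o (symRun ε (u, [], []) p))
        (probQ t (symRun ε (u, [], []) p) m : ℝ) 0).sum := by
  unfold outputQ
  rw [Rat.cast_list_sum, List.map_map]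
  congr 1
  refine List.map_congr_left fun p _ => ?_
  rw [Function.comp_apply]
  cases hasOutput o (symRun ε (u, [], []) p) <;> simp

theorem outputQ_false_le (S : Stmt) (ε : ℚ) (u o : Asg) (m : ℕ) :
    (outputQ false S ε u o m : ℝ) ≤ pathsProb S ε u o := by
  rw [outputQ_cast]
  refine List.sum_le_sum fun p _ => ?_
  cases hasOutput o (symRun ε (u, [], []) p)
  · exact le_rfl
  · exact probQ_false_le _ m

theorem le_outputQ_true (S : Stmt) (ε : ℚ) (u o : Asg) (m : ℕ) :
    pathsProb S ε u o ≤ (outputQ true S ε u o m : ℝ) := by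
  rw [outputQ_cast]
  refine List.sum_le_sum fun p _ => ?_
  cases hasOutput o (symRun ε (u, [], []) p)
  · exact le_rfl
  · exact le_probQ_true _ m

theorem tendsto_outputQ (t : Bool) (S : Stmt) (ε : ℚ) (u o : Asg) :
    Tendsto (fun m => (outputQ t S ε u o m : ℝ)) atTop (𝓝 (pathsProb S ε u o)) := by
  simp only [outputQ_cast]
  refine tendsto_list_sum _ fun p _ => ?_
  cases hasOutput o (symRun ε (u, [], []) p)
  · exact tendsto_const_nhds
  · exact tendsto_probQ t _

/-- The quantity `deltaAdj`, as a sum over control paths. -/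
noncomputable def pathsDelta (S : Stmt) (outs : List Asg) (ε εprv : ℚ) (u u' : Asg) : ℝ :=
  (outs.map fun o => max (pathsProb S ε u o - Real.exp εprv * pathsProb S ε u' o) 0).sum

theorem deltaQ_cast (t : Bool) (S : Stmt) (outs : List Asg) (ε εprv : ℚ) (u u' : Asg) (m : ℕ) :
    (deltaQ t S outs ε εprv u u' m : ℝ) = (outs.map fun o => max ((outputQ t S ε u o m : ℝ) -
      (expQ (!t) εprv m : ℝ) * (outputQ (!t) S ε u' o m : ℝ)) 0).sum := by
  unfold deltaQ
  rw [Rat.cast_list_sum, List.map_map]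
  congr 1
  refine List.map_congr_left fun o _ => ?_
  simp

/-- The subtracted product is bounded from above in both factors and the first term from below; the
truncation at 0 is monotone. -/
theorem deltaQ_false_le (S : Stmt) (outs : List Asg) (ε εprv : ℚ) (u u' : Asg) (m : ℕ) :
    (deltaQ false S outs ε εprv u u' m : ℝ) ≤ pathsDelta S outs ε εprv u u' := by
  rw [deltaQ_cast]
  refine List.sum_le_sum fun o _ => max_le_max_right _ (sub_le_sub (outputQ_false_le ..) ?_)
  exact mul_le_mul (le_expQ_true _ m) (le_outputQ_true ..) (pathsProb_nonneg ..)
    ((Real.exp_pos _).le.trans (le_expQ_true _ m))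

/-- The opposite choice of bounds. Nonnegativity of εprv makes the lower bound for the exponential
valid and nonnegative, as needed to multiply inequalities. -/
theorem le_deltaQ_true (S : Stmt) (outs : List Asg) (ε : ℚ) {εprv : ℚ} (h : 0 ≤ εprv)
    (u u' : Asg) (m : ℕ) :
    pathsDelta S outs ε εprv u u' ≤ (deltaQ true S outs ε εprv u u' m : ℝ) := by
  rw [deltaQ_cast]
  refine List.sum_le_sum fun o _ => max_le_max_right _ (sub_le_sub (le_outputQ_true ..) ?_)
  refine (mul_le_mul_of_nonneg_left (outputQ_false_le ..) ?_).trans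
    (mul_le_mul_of_nonneg_right (expQ_false_le h m) (pathsProb_nonneg ..))
  exact_mod_cast expQ_false_nonneg h m

theorem tendsto_deltaQ (t : Bool) (S : Stmt) (outs : List Asg) (ε εprv : ℚ) (u u' : Asg) :
    Tendsto (fun m => (deltaQ t S outs ε εprv u u' m : ℝ)) atTop
      (𝓝 (pathsDelta S outs ε εprv u u')) := by
  simp only [deltaQ_cast]
  exact tendsto_list_sum _ fun o _ => ((tendsto_outputQ ..).sub
    ((tendsto_expQ ..).mul (tendsto_outputQ ..))).max tendsto_const_nhds

/-- The assignment of an output valuation. -/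
def Program.outputAsg (P : Program) (ys : List ℕ) (o : P.Output) : Asg :=
  ys.map fun y => (y, if h : y ∈ P.outputs then (o ⟨y, h⟩).1 else 0)

section

variable {P : Program} {dom : List ℚ} {ys : List ℕ}

theorem hasOutput_outputAsg (hys : ∀ y, y ∈ ys ↔ y ∈ P.outputs) (o : P.Output) (st : SymState) :
    hasOutput (P.outputAsg ys o) st = true ↔
      ∀ y : {y // y ∈ P.outputs}, st.1.lookup y.1 = some (o y).1 := by
  simp only [hasOutput, Program.outputAsg, List.all_eq_true, List.mem_map, decide_eq_true_eq,
    forall_exists_index, and_imp, forall_apply_eq_imp_iff₂, Subtype.forall]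
  refine forall_congr' fun y => ⟨fun h hy => ?_, fun h hy => ?_⟩
  · rw [h ((hys y).2 hy), dif_pos hy]
  · rw [h ((hys y).1 hy), dif_pos ((hys y).1 hy)]

/-- Absence of duplicates in both lists makes the assignments correspond bijectively to output
valuations, so no output is counted twice. -/
theorem sum_assigns_outputs (hdom : dom.Nodup) (hmem : ∀ d, d ∈ dom ↔ d ∈ P.dom)
    (hys : ∀ y, y ∈ ys ↔ y ∈ P.outputs) (hnd : ys.Nodup) (f : Asg → ℝ) :
    ((assigns ys dom).map f).sum = ∑ o : P.Output, f (P.outputAsg ys o) := by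
  rw [list_sum_map_eq_finset_sum (nodup_assigns ys hdom)]
  symm
  refine Finset.sum_bij (fun o _ => P.outputAsg ys o) ?_ ?_ ?_ fun _ _ => rfl
  · intro o _
    rw [List.mem_toFinset, mem_assigns]
    refine ⟨by simp [Program.outputAsg, Function.comp_def], fun p hp => ?_⟩
    obtain ⟨y, hy, rfl⟩ := List.mem_map.1 hp
    rw [dif_pos ((hys y).1 hy)]
    exact (hmem _).2 (o _).2
  · intro o _ o' _ h
    funext y
    have hy := List.map_inj_left.1 h y.1 ((hys _).2 y.2)
    simpa using (Prod.ext_iff.1 hy).2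
  · intro c hc
    obtain ⟨h1, h2⟩ := mem_assigns.1 (List.mem_toFinset.1 hc)
    have hl : ∀ p ∈ c, asgVal c p.1 = p.2 := fun p hp => by
      rw [asgVal, lookup_eq_some_of_mem (h1 ▸ hnd) hp, Option.getD_some]
    have h3 : ∀ y ∈ P.outputs, asgVal c y ∈ P.dom := by
      intro y hy
      rw [← hys, ← h1] at hy
      obtain ⟨p, hp, rfl⟩ := List.mem_map.1 hy
      rw [hl p hp, ← hmem]
      exact h2 p hp
    refine ⟨fun y => ⟨asgVal c y.1, h3 _ y.2⟩, Finset.mem_univ _, ?_⟩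
    subst h1
    rw [Program.outputAsg, List.map_map]
    conv_rhs => rw [← List.map_id c]
    refine List.map_congr_left fun p hp => ?_
    simp only [Function.comp_apply, (hys p.1).1 (List.mem_map_of_mem hp), dite_true, hl p hp, id]

theorem pathsDelta_eq_deltaAdj (hdom : dom.Nodup) (hmem : ∀ d, d ∈ dom ↔ d ∈ P.dom)
    (hys : ∀ y, y ∈ ys ↔ y ∈ P.outputs) (hnd : ys.Nodup) (ε : PosRat) (εprv : ℚ)
    {u u' : P.Input} {l l' : Asg} (hl : P.Presents u l) (hl' : P.Presents u' l') :
    pathsDelta P.body (assigns ys dom) ε.1 εprv l l' = P.deltaAdj ε εprv u u' := by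
  rw [pathsDelta, sum_assigns_outputs hdom hmem hys hnd, Program.deltaAdj]
  refine Finset.sum_congr rfl fun o _ => ?_
  rw [P.prob_eq_sum_paths ε hl (hasOutput_outputAsg hys o),
    P.prob_eq_sum_paths ε hl' (hasOutput_outputAsg hys o), pathsProb, pathsProb]

end

/-! ## Differential privacy in terms of the critical error parameters -/

/-- For a fixed pair the defect summed over F is largest when F consists of the outputs with
nonnegative difference, and this maximum is `deltaAdj`. -/
theorem Program.isDP_iff (P : Program) (Φ : Finset (P.Input × P.Input)) (ε : PosRat) (εprv δ : ℝ) :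
    P.IsDP Φ ε εprv δ ↔ ∀ u u' : P.Input, (u, u') ∈ Φ → P.deltaAdj ε εprv u u' ≤ δ := by
  classical
  constructor
  · intro h u u' huu
    have hF := h (Finset.univ.filter fun o => 0 ≤ P.prob ε u o - Real.exp εprv * P.prob ε u' o)
      u u' huu
    rw [Finset.mul_sum, ← sub_le_iff_le_add', ← Finset.sum_sub_distrib, Finset.sum_filter] at hF
    refine le_of_eq_of_le (Finset.sum_congr rfl fun o _ => ?_) hF
    split_ifs with h0
    · exact max_eq_left h0
    · exact max_eq_right (not_le.1 h0).le
  · intro h F u u' huu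
    rw [Finset.mul_sum, ← sub_le_iff_le_add', ← Finset.sum_sub_distrib]
    refine le_trans ?_ (h u u' huu)
    refine (Finset.sum_le_sum fun o _ => le_max_left _ 0).trans ?_
    exact Finset.sum_le_univ_sum_of_nonneg fun o => le_max_right _ _

theorem Program.finite_crit (P : Program) (ε : PosRat) (εprv : ℝ)
    (Φ : Finset (P.Input × P.Input)) : (P.crit ε εprv Φ).Finite := by
  refine (Φ.finite_toSet.image fun p => P.deltaAdj ε εprv p.1 p.2).subset ?_
  rintro _ ⟨u, u', h, rfl⟩
  exact ⟨(u, u'), h, rfl⟩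

/-- The data `r` presents the instance `x`. -/
structure Problem.Presents (x : Problem) (r : RawProblem) : Prop where
  dom_nodup : r.1.1.Nodup
  mem_dom : ∀ d, d ∈ r.1.1 ↔ d ∈ x.prog.dom
  outputs_nodup : r.1.2.2.1.Nodup
  mem_outputs : ∀ y, y ∈ r.1.2.2.1 ↔ y ∈ x.prog.outputs
  body_eq : r.1.2.2.2 = x.prog.body
  adj_sound : ∀ p ∈ r.2.1, ∃ u u', (u, u') ∈ x.adj ∧ x.prog.Presents u p.1 ∧
    x.prog.Presents u' p.2
  adj_complete : ∀ u u', (u, u') ∈ x.adj → ∃ p ∈ r.2.1, x.prog.Presents u p.1 ∧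
    x.prog.Presents u' p.2
  ε_eq : r.2.2.1 = x.ε.1
  εprv_eq : r.2.2.2.1 = x.εprv.1
  δ_eq : r.2.2.2.2 = x.δ

namespace Problem.Presents

variable {x : Problem} {r : RawProblem}

theorem pathsDelta_eq (h : x.Presents r) {u u' : x.prog.Input} {l l' : Asg}
    (hl : x.prog.Presents u l) (hl' : x.prog.Presents u' l') :
    pathsDelta r.1.2.2.2 (assigns r.1.2.2.1 r.1.1) r.2.2.1 r.2.2.2.1 l l' =
      x.prog.deltaAdj x.ε (x.εprv.1 : ℝ) u u' := by
  rw [h.body_eq, h.ε_eq, h.εprv_eq]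
  exact pathsDelta_eq_deltaAdj h.dom_nodup h.mem_dom h.mem_outputs h.outputs_nodup _ _ hl hl'

theorem isDP_iff (h : x.Presents r) : x.IsDP ↔ ∀ p ∈ r.2.1,
    pathsDelta r.1.2.2.2 (assigns r.1.2.2.1 r.1.1) r.2.2.1 r.2.2.2.1 p.1 p.2 ≤ (r.2.2.2.2 : ℝ) := by
  rw [Problem.IsDP, Program.isDP_iff, h.δ_eq]
  constructor
  · intro hx p hp
    obtain ⟨u, u', huu, hu, hu'⟩ := h.adj_sound p hp
    rw [h.pathsDelta_eq hu hu']
    exact hx u u' huu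
  · intro hr u u' huu
    obtain ⟨p, hp, hu, hu'⟩ := h.adj_complete u u' huu
    rw [← h.pathsDelta_eq hu hu']
    exact hr p hp

/-- Failure of privacy is a strict inequality, so convergence from below detects it at a finite
precision; conversely a lower bound above δ is conclusive. -/
theorem exists_notDPQ_iff (h : x.Presents r) : (∃ m, notDPQ r m = true) ↔ ¬ x.IsDP := by
  rw [h.isDP_iff]
  push Not
  simp only [notDPQ, List.any_eq_true, decide_eq_true_eq]
  constructor
  · rintro ⟨m, p, hp, hm⟩
    exact ⟨p, hp, lt_of_lt_of_le (by exact_mod_cast hm) (deltaQ_false_le ..)⟩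
  · rintro ⟨p, hp, hlt⟩
    obtain ⟨m, hm⟩ := ((tendsto_deltaQ false r.1.2.2.2 (assigns r.1.2.2.1 r.1.1) r.2.2.1 r.2.2.2.1
      p.1 p.2).eventually_const_lt hlt).exists
    exact ⟨m, p, hp, by exact_mod_cast hm⟩

theorem isDP_of_isDPQ (h : x.Presents r) {m : ℕ} (hm : isDPQ r m = true) : x.IsDP := by
  rw [h.isDP_iff]
  simp only [isDPQ, List.all_eq_true, decide_eq_true_eq] at hm
  intro p hp
  refine (le_deltaQ_true _ _ _ ?_ _ _ m).trans (by exact_mod_cast (hm p hp).le)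
  rw [h.εprv_eq]
  exact x.εprv.2.le

/-- Off the critical set the inequalities are strict. There are finitely many pairs, so one
precision brings all upper bounds below δ. -/
theorem exists_isDPQ (h : x.Presents r) (hδ : (x.δ : ℝ) ∉ x.crit) (hx : x.IsDP) :
    ∃ m, isDPQ r m = true := by
  have hlt : ∀ p ∈ r.2.1, pathsDelta r.1.2.2.2 (assigns r.1.2.2.1 r.1.1) r.2.2.1 r.2.2.2.1
      p.1 p.2 < (r.2.2.2.2 : ℝ) := by
    intro p hp
    refine lt_of_le_of_ne (h.isDP_iff.1 hx p hp) fun he => hδ ?_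
    obtain ⟨u, u', huu, hu, hu'⟩ := h.adj_sound p hp
    exact ⟨u, u', huu, by rw [← h.pathsDelta_eq hu hu', he, h.δ_eq]⟩
  have hev : ∀ᶠ m in atTop, ∀ p ∈ r.2.1.toFinset, (deltaQ true r.1.2.2.2
      (assigns r.1.2.2.1 r.1.1) r.2.2.1 r.2.2.2.1 p.1 p.2 m : ℝ) < (r.2.2.2.2 : ℝ) := by
    rw [Filter.eventually_all_finset]
    intro p hp
    exact (tendsto_deltaQ ..).eventually_lt_const (hlt p (List.mem_toFinset.1 hp))
  obtain ⟨m, hm⟩ := hev.exists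
  refine ⟨m, ?_⟩
  simp only [isDPQ, List.all_eq_true, decide_eq_true_eq]
  intro p hp
  exact_mod_cast hm p (List.mem_toFinset.2 hp)

end Problem.Presents

/-! ## Codes of finite sets -/

/-- The encoding of a list depends only on the codes of its elements. Hence `setCode`, which encodes
a list of numbers, is also the code of a list of objects. -/
theorem encode_list_map_encode {α : Type*} [Encodable α] (l : List α) :
    Encodable.encode (l.map Encodable.encode) = Encodable.encode l := by
  induction l with
  | nil => rfl
  | cons a l ih => rw [List.map_cons, Encodable.encode_list_cons, ih, Encodable.encode_list_cons]; rfl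

theorem encode_eq_setCode_iff {α : Type*} [Encodable α] {l : List α} {s : Finset ℕ} :
    Encodable.encode l = setCode s ↔ (l.map Encodable.encode).Pairwise (· < ·) ∧
      ∀ n, n ∈ l.map Encodable.encode ↔ n ∈ s := by
  rw [← encode_list_map_encode, setCode, Encodable.encode_inj]
  constructor
  · intro h
    rw [h]
    exact ⟨s.sortedLT_sort.pairwise, fun n => Finset.mem_sort _⟩
  · rintro ⟨h1, h2⟩
    have hs : (l.map Encodable.encode).toFinset = s := by
      ext n
      rw [List.mem_toFinset, h2]
    rw [← hs]
    exact ((List.toFinset_sort _ (h1.imp fun h => h.ne)).2 (h1.imp fun h => h.le)).symm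

theorem exists_encode_eq_setCode {α : Type*} [Encodable α] (s : Finset ℕ)
    (h : ∀ n ∈ s, ∃ a : α, Encodable.encode a = n) :
    ∃ l : List α, Encodable.encode l = setCode s := by
  have hs : ∀ n ∈ s.sort (· ≤ ·), n ∈ Set.range (Encodable.encode : α → ℕ) := fun n hn =>
    h n ((Finset.mem_sort _).1 hn)
  obtain ⟨l, hl⟩ : s.sort (· ≤ ·) ∈ Set.range (List.map (Encodable.encode : α → ℕ)) := by
    rw [Set.range_list_map]
    exact hs
  exact ⟨l, by rw [← encode_list_map_encode, hl, setCode]⟩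

theorem encode_eq_setCode_image_iff {α ι : Type*} [Encodable α] {l : List α} {s : Finset ι}
    {g : ι → α} : Encodable.encode l = setCode (s.image fun i => Encodable.encode (g i)) ↔
      (l.map Encodable.encode).Pairwise (· < ·) ∧ ∀ a, a ∈ l ↔ ∃ i ∈ s, g i = a := by
  rw [encode_eq_setCode_iff]
  refine and_congr_right fun _ => ⟨fun h a => ?_, fun h n => ?_⟩
  · have ha := h (Encodable.encode a)
    rw [List.mem_map_of_injective Encodable.encode_injective] at ha
    simpa [Encodable.encode_inj] using ha
  · simp only [List.mem_map, Finset.mem_image]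
    constructor
    · rintro ⟨a, ha, rfl⟩
      obtain ⟨i, hi, rfl⟩ := (h a).1 ha
      exact ⟨i, hi, rfl⟩
    · rintro ⟨i, hi, rfl⟩
      exact ⟨g i, (h _).2 ⟨i, hi, rfl⟩, rfl⟩

theorem encode_eq_setCode_nat_iff {l : List ℕ} {s : Finset ℕ} :
    Encodable.encode l = setCode s ↔ (l.map Encodable.encode).Pairwise (· < ·) ∧
      ∀ n, n ∈ l ↔ n ∈ s := by
  rw [encode_eq_setCode_iff]
  simp

theorem encode_eq_setCode_rat_iff {l : List ℚ} {s : Finset ℚ} :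
    Encodable.encode l = setCode (s.image ratCode) ↔
      (l.map Encodable.encode).Pairwise (· < ·) ∧ ∀ q, q ∈ l ↔ q ∈ s := by
  have h := encode_eq_setCode_image_iff (l := l) (s := s) (g := fun q => q)
  simp only [exists_eq_right] at h
  exact h

theorem nodup_of_pairwise_encode {α : Type*} [Encodable α] {l : List α}
    (h : (l.map Encodable.encode).Pairwise (· < ·)) : l.Nodup :=
  List.Nodup.of_map _ (h.imp fun h => h.ne)

/-! ## Presentations of instances -/

namespace Program

variable {P : Program}

theorem encode_eq_inputCode_iff {l : Asg} {u : P.Input} :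
    Encodable.encode l = P.inputCode u ↔ (l.map Encodable.encode).Pairwise (· < ·) ∧
      ∀ p, p ∈ l ↔ ∃ x : {x // x ∈ P.inputs}, (x.1, (u x).1) = p := by
  have h := encode_eq_setCode_image_iff (l := l) (s := P.inputs.attach)
    (g := fun x => (x.1, (u x).1))
  simp only [Finset.mem_attach, true_and] at h
  exact h

theorem exists_encode_eq_inputCode (u : P.Input) : ∃ l : Asg, Encodable.encode l = P.inputCode u := by
  refine exists_encode_eq_setCode _ fun n hn => ?_
  obtain ⟨x, -, rfl⟩ := Finset.mem_image.1 hn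
  exact ⟨(x.1, (u x).1), rfl⟩

/-- A list with this code contains exactly the pairs of the graph of u, so lookup in it agrees with
u and fails outside the inputs. -/
theorem presents_of_encode_eq {u : P.Input} {l : Asg} (h : Encodable.encode l = P.inputCode u) :
    P.Presents u l := by
  obtain ⟨-, hl⟩ := encode_eq_inputCode_iff.1 h
  intro x
  rcases hx : l.lookup x with _ | e
  · rw [dif_neg]
    intro hxi
    rw [List.lookup_eq_none_iff] at hx
    simpa using hx _ ((hl _).2 ⟨⟨x, hxi⟩, rfl⟩)
  · obtain ⟨y, hy⟩ := (hl _).1 (mem_of_lookup_eq_some hx)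
    obtain ⟨rfl, rfl⟩ := Prod.ext_iff.1 hy
    rw [dif_pos y.2]

/-- An assignment with the given code, for every input valuation. -/
noncomputable def inputAsg (u : P.Input) : Asg := (exists_encode_eq_inputCode u).choose

theorem encode_inputAsg (u : P.Input) : Encodable.encode (inputAsg u) = P.inputCode u :=
  (exists_encode_eq_inputCode u).choose_spec

theorem encode_eq_code_iff (r : List ℚ × List ℕ × List ℕ × Stmt) :
    Encodable.encode r = P.code ↔ Encodable.encode r.1 = setCode (P.dom.image ratCode) ∧
      Encodable.encode r.2.1 = setCode P.inputs ∧ Encodable.encode r.2.2.1 = setCode P.outputs ∧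
      r.2.2.2 = P.body := by
  have h : Encodable.encode r = Nat.pair (Encodable.encode r.1) (Nat.pair
    (Encodable.encode r.2.1) (Nat.pair (Encodable.encode r.2.2.1) r.2.2.2.code)) := rfl
  rw [h, Program.code]
  simp only [Nat.pair_eq_pair, Stmt.code_injective.eq_iff]

end Program

theorem encode_eq_setCode_adj_iff {P : Program} {l : List (Asg × Asg)}
    {s : Finset (P.Input × P.Input)} :
    Encodable.encode l = setCode (s.image fun p => Nat.pair (P.inputCode p.1) (P.inputCode p.2)) ↔
      (l.map Encodable.encode).Pairwise (· < ·) ∧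
      ∀ p, p ∈ l ↔ ∃ i ∈ s, (Program.inputAsg i.1, Program.inputAsg i.2) = p := by
  rw [← encode_eq_setCode_image_iff]
  have h : ∀ i : P.Input × P.Input, Encodable.encode (Program.inputAsg i.1, Program.inputAsg i.2) =
      Nat.pair (P.inputCode i.1) (P.inputCode i.2) := fun i => by
    rw [← Program.encode_inputAsg, ← Program.encode_inputAsg]
    rfl
  simp only [h]

/-- The raw data are nested exactly as in `Problem.code`, so equality of codes can be checked
component by component. -/
theorem Problem.encode_eq_code_iff (x : Problem) (r : RawProblem) :
    Encodable.encode r = x.code ↔ Encodable.encode r.1 = x.prog.code ∧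
      Encodable.encode r.2.1 = setCode (x.adj.image fun p =>
        Nat.pair (x.prog.inputCode p.1) (x.prog.inputCode p.2)) ∧
      r.2.2.1 = x.ε.1 ∧ r.2.2.2.1 = x.εprv.1 ∧ r.2.2.2.2 = x.δ := by
  have h : Encodable.encode r = Nat.pair (Encodable.encode r.1) (Nat.pair
    (Encodable.encode r.2.1) (Nat.pair (ratCode r.2.2.1) (Nat.pair (ratCode r.2.2.2.1)
      (ratCode r.2.2.2.2)))) := rfl
  rw [h, Problem.code]
  simp only [Nat.pair_eq_pair, ratCode_injective.eq_iff]

theorem Problem.presents_of_encode_eq {x : Problem} {r : RawProblem}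
    (h : Encodable.encode r = x.code) : x.Presents r := by
  obtain ⟨hprog, hadj, h1, h2, h3⟩ := (x.encode_eq_code_iff r).1 h
  obtain ⟨hdom, -, hout, hbody⟩ := (Program.encode_eq_code_iff _).1 hprog
  rw [encode_eq_setCode_rat_iff] at hdom
  rw [encode_eq_setCode_nat_iff] at hout
  rw [encode_eq_setCode_adj_iff] at hadj
  have hP : ∀ u : x.prog.Input, x.prog.Presents u (Program.inputAsg u) := fun u =>
    Program.presents_of_encode_eq (Program.encode_inputAsg u)
  refine ⟨nodup_of_pairwise_encode hdom.1, hdom.2, nodup_of_pairwise_encode hout.1, hout.2, hbody,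
    fun p hp => ?_, fun u u' hu => ?_, h1, h2, h3⟩
  · obtain ⟨i, hi, rfl⟩ := (hadj.2 p).1 hp
    exact ⟨i.1, i.2, hi, hP _, hP _⟩
  · exact ⟨_, (hadj.2 _).2 ⟨_, hu, rfl⟩, hP _, hP _⟩

theorem Problem.exists_encode_eq_code (x : Problem) :
    ∃ r : RawProblem, Encodable.encode r = x.code := by
  obtain ⟨dom, hdom⟩ := exists_encode_eq_setCode (α := ℚ) (x.prog.dom.image ratCode) fun n hn => by
    obtain ⟨q, -, rfl⟩ := Finset.mem_image.1 hn
    exact ⟨q, rfl⟩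
  obtain ⟨ins, hins⟩ := exists_encode_eq_setCode (α := ℕ) x.prog.inputs fun n _ => ⟨n, rfl⟩
  obtain ⟨outs, houts⟩ := exists_encode_eq_setCode (α := ℕ) x.prog.outputs fun n _ => ⟨n, rfl⟩
  obtain ⟨adj, hadj⟩ := exists_encode_eq_setCode (α := Asg × Asg) (x.adj.image fun p =>
      Nat.pair (x.prog.inputCode p.1) (x.prog.inputCode p.2)) fun n hn => by
    obtain ⟨p, -, rfl⟩ := Finset.mem_image.1 hn
    refine ⟨(Program.inputAsg p.1, Program.inputAsg p.2), ?_⟩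
    rw [← Program.encode_inputAsg, ← Program.encode_inputAsg]
    rfl
  exact ⟨((dom, ins, outs, x.prog.body), adj, x.ε.1, x.εprv.1, x.δ),
    (x.encode_eq_code_iff _).2 ⟨(Program.encode_eq_code_iff _).2 ⟨hdom, hins, houts, rfl⟩, hadj,
      rfl, rfl, rfl⟩⟩

noncomputable section

/-! ## Recognizing the codes of instances -/

/-- Accesses as elements of a sum type. -/
def Access.equivSum : Access ≃ ℕ ⊕ ℕ ⊕ ℕ ⊕ ℕ where
  toFun
    | .readDom x => .inl x
    | .writeDom x => .inr (.inl x)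
    | .readReal r => .inr (.inr (.inl r))
    | .writeReal r => .inr (.inr (.inr r))
  invFun := Sum.elim .readDom (Sum.elim .writeDom (Sum.elim .readReal .writeReal))
  left_inv a := by cases a <;> rfl
  right_inv s := by rcases s with x | x | x | x <;> rfl

instance instPrimcodableAccess : Primcodable Access := Primcodable.ofEquiv _ Access.equivSum

/-- The access `a`, made after the accesses `seen`, is allowed in a program with inputs `I`. -/
def Access.allowed (I : List ℕ) (seen : List Access) (a : Access) : Bool :=
  Sum.elim (fun x => decide (x ∈ I) || decide (.writeDom x ∈ seen))
    (Sum.elim (fun _ => true) (Sum.elim (fun r => decide (.writeReal r ∈ seen))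
      fun r => !decide (.writeReal r ∈ seen))) a.equivSum

/-- All accesses on a path are allowed. -/
def pathAllowed (I : List ℕ) (p : List Access) : Bool :=
  (p.foldl (fun s a => (s.1 ++ [a], s.2 && a.allowed I s.1)) ([], true)).2

/-- The list of the codes is increasing. -/
def increasing {α : Type*} [Encodable α] (l : List α) : Bool :=
  decide ((l.map Encodable.encode).Pairwise (· < ·))

/-- The data are those of a program. -/
def validProgram (r : List ℚ × List ℕ × List ℕ × Stmt) : Bool :=
  increasing r.1 && increasing r.2.1 && increasing r.2.2.1 &&
    r.2.1.all (fun x => !decide (x ∈ r.2.2.1)) && r.2.2.2.consts.all (fun d => decide (d ∈ r.1)) &&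
    r.2.2.2.paths.all fun p => pathAllowed r.2.1 p

/-- The assignment is an input valuation. -/
def validInput (dom : List ℚ) (I : List ℕ) (l : Asg) : Bool :=
  increasing l && l.all (fun p => decide (p.1 ∈ I) && decide (p.2 ∈ dom) &&
    decide (l.lookup p.1 = some p.2)) && I.all fun x => decide (x ∈ l.map fun p => p.1)

/-- The data are those of an instance. -/
def validProblem (r : RawProblem) : Bool :=
  validProgram r.1 && increasing r.2.1 &&
    r.2.1.all (fun p => validInput r.1.1 r.1.2.1 p.1 && validInput r.1.1 r.1.2.1 p.2) &&
    decide (0 < r.2.2.1) && decide (0 < r.2.2.2.1) && decide (0 ≤ r.2.2.2.2) &&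
    decide (r.2.2.2.2 ≤ 1)

section

variable {α β : Type*} [Primcodable α] [Primcodable β]

@[fun_prop] theorem primrec_equivSum {a : α → Access} (ha : Primrec a) :
    Primrec fun x => Access.equivSum (a x) := (Primrec.of_equiv (e := Access.equivSum)).comp ha

theorem primrec_equivSum_symm {s : α → ℕ ⊕ ℕ ⊕ ℕ ⊕ ℕ} (hs : Primrec s) :
    Primrec fun x => Access.equivSum.symm (s x) :=
  (Primrec.of_equiv_symm (e := Access.equivSum)).comp hs

@[fun_prop] theorem primrec_readDom {x : α → ℕ} (hx : Primrec x) :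
    Primrec fun a => Access.readDom (x a) :=
  primrec_equivSum_symm (s := fun a => .inl (x a)) (by fun_prop)

@[fun_prop] theorem primrec_writeDom {x : α → ℕ} (hx : Primrec x) :
    Primrec fun a => Access.writeDom (x a) :=
  primrec_equivSum_symm (s := fun a => .inr (.inl (x a))) (by fun_prop)

@[fun_prop] theorem primrec_readReal {x : α → ℕ} (hx : Primrec x) :
    Primrec fun a => Access.readReal (x a) :=
  primrec_equivSum_symm (s := fun a => .inr (.inr (.inl (x a)))) (by fun_prop)

@[fun_prop] theorem primrec_writeReal {x : α → ℕ} (hx : Primrec x) :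
    Primrec fun a => Access.writeReal (x a) :=
  primrec_equivSum_symm (s := fun a => .inr (.inr (.inr (x a)))) (by fun_prop)

@[fun_prop] theorem primrec_allowed {I : α → List ℕ} {seen : α → List Access} {c : α → Access}
    (hI : Primrec I) (hs : Primrec seen) (hc : Primrec c) :
    Primrec fun a => (c a).allowed (I a) (seen a) := by
  have h : Primrec fun a => Sum.elim
    (fun x => decide (x ∈ I a) || decide (Access.writeDom x ∈ seen a))
    (fun z => Sum.elim (fun _ => true) (fun z => Sum.elim
      (fun r => decide (Access.writeReal r ∈ seen a))
      (fun r => !decide (Access.writeReal r ∈ seen a)) z) z) (c a).equivSum := by fun_prop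
  exact h

@[fun_prop] theorem primrec_pathAllowed {I : α → List ℕ} {p : α → List Access}
    (hI : Primrec I) (hp : Primrec p) : Primrec fun a => pathAllowed (I a) (p a) := by
  unfold pathAllowed; fun_prop

@[fun_prop] theorem primrec_increasing {l : α → List β} (hl : Primrec l) :
    Primrec fun a => increasing (l a) := by
  have h : Primrec fun a => decide (((l a).map fun b => Encodable.encode b).Pairwise (· < ·)) := by
    fun_prop
  exact h

@[fun_prop] theorem primrec_reads {B : α → BExp} (hB : Primrec B) :
    Primrec fun a => (B a).reads := by
  have h : Primrec fun a => Sum.elim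
    (fun p => (p.1.vars ++ p.2.2.vars).map fun r => Access.readReal r)
    (fun z => Sum.elim (fun p => (p.1.vars.map fun r => Access.readReal r) ++ [.readDom p.2.2])
      (fun p => [.readDom p.1, .readDom p.2.2]) z) (B a).toSum := by fun_prop
  refine h.of_eq fun a => ?_
  cases B a <;> rfl

@[fun_prop] theorem primrec_paths {S : α → Stmt} (hS : Primrec S) :
    Primrec fun a => (S a).paths :=
  primrec_stmt_rec (f := fun _ S => S.paths) (fun _ p => [[.writeDom p.1]])
    (fun _ p => [[.readDom p.2.2.1, .writeReal p.2.1]])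
    (fun _ p => [(p.2.vars.map fun r => Access.readReal r) ++ [.writeReal p.1]])
    (fun _ B l l' => (l ++ l').map fun p => B.reads ++ p) (fun _ => [[]])
    (fun _ l l' => l.flatMap fun p => l'.map fun q => p ++ q)
    (by fun_prop) (by fun_prop) (by fun_prop) (by fun_prop) (by fun_prop) (by fun_prop)
    (fun _ _ _ => rfl) (fun _ _ _ _ _ => rfl) (fun _ _ _ => rfl) (fun _ _ _ _ => rfl)
    (fun _ => rfl) (fun _ _ _ => rfl) hS

@[fun_prop] theorem primrec_consts {S : α → Stmt} (hS : Primrec S) :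
    Primrec fun a => (S a).consts :=
  primrec_stmt_rec (f := fun _ S => S.consts) (fun _ p => [p.2]) (fun _ _ => [])
    (fun _ _ => []) (fun _ _ l l' => l ++ l') (fun _ => []) (fun _ l l' => l ++ l')
    (by fun_prop) (by fun_prop) (by fun_prop) (by fun_prop) (by fun_prop) (by fun_prop)
    (fun _ _ _ => rfl) (fun _ _ _ _ _ => rfl) (fun _ _ _ => rfl) (fun _ _ _ _ => rfl)
    (fun _ => rfl) (fun _ _ _ => rfl) hS

@[fun_prop] theorem primrec_validProgram {r : α → List ℚ × List ℕ × List ℕ × Stmt}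
    (hr : Primrec r) : Primrec fun a => validProgram (r a) := by
  unfold validProgram; fun_prop

@[fun_prop] theorem primrec_validInput {dom : α → List ℚ} {I : α → List ℕ} {l : α → Asg}
    (hdom : Primrec dom) (hI : Primrec I) (hl : Primrec l) :
    Primrec fun a => validInput (dom a) (I a) (l a) := by
  unfold validInput; fun_prop

@[fun_prop] theorem primrec_validProblem {r : α → RawProblem} (hr : Primrec r) :
    Primrec fun a => validProblem (r a) := by
  unfold validProblem; fun_prop

end

/-! ### Correctness of the recognition of codes -/

theorem forall_append_concat_iff {α : Type*} (P : List α → α → Prop) (p : List α) (c : α) :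
    (∀ l a l', p ++ [c] = l ++ a :: l' → P l a) ↔ (∀ l a l', p = l ++ a :: l' → P l a) ∧ P p c := by
  constructor
  · intro h
    exact ⟨fun l a l' hp => h l a (l' ++ [c]) (by rw [hp]; simp), h p c [] rfl⟩
  · rintro ⟨h1, h2⟩ l a l' hp
    rcases List.eq_nil_or_concat l' with rfl | ⟨l'', b, rfl⟩
    · obtain ⟨rfl, hc⟩ := List.append_inj' hp rfl
      rw [← List.singleton_inj.1 hc]
      exact h2
    · rw [List.concat_eq_append, ← List.cons_append, ← List.append_assoc] at hp
      exact h1 l a l'' (List.append_inj' hp rfl).1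

/-- The fold carries the accesses seen so far along with the verdict. Induction from the right end
matches it: an occurrence in p ++ [c] is either the last one, with prefix p, or lies in p. -/
theorem pathAllowed_iff (I : List ℕ) (p : List Access) :
    pathAllowed I p = true ↔ ∀ l a l', p = l ++ a :: l' → a.allowed I l = true := by
  have hfst : ∀ p : List Access,
      (p.foldl (fun s a => (s.1 ++ [a], s.2 && a.allowed I s.1)) ([], true)).1 = p := by
    intro p
    induction p using List.reverseRecOn with
    | nil => rfl
    | append_singleton p c ih => rw [List.foldl_concat]; simp only [ih]
  induction p using List.reverseRecOn with
  | nil => simp [pathAllowed]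
  | append_singleton p c ih =>
    refine Iff.trans ?_ (forall_append_concat_iff _ _ _).symm
    refine Iff.trans ?_ (and_congr_left' ih)
    rw [pathAllowed, List.foldl_concat]
    simp only [hfst, Bool.and_eq_true]
    rfl

/-- Rephrases single assignment as a condition on prefixes, the form of the other two conditions, so
that one pass along the path checks all three. -/
theorem count_le_one_iff (p : List Access) (c : Access) :
    p.count c ≤ 1 ↔ ∀ l a l', p = l ++ a :: l' → a = c → c ∉ l := by
  induction p using List.reverseRecOn with
  | nil => simp
  | append_singleton p b ih =>
    rw [forall_append_concat_iff fun l a => a = c → c ∉ l, ← ih, List.count_append,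
      List.count_singleton, ← List.count_eq_zero]
    by_cases h : b = c
    · simp only [h, beq_self_eq_true, if_true, forall_const]
      omega
    · simp [h]

theorem forall_pathAllowed_iff (I : List ℕ) (p : List Access) : pathAllowed I p = true ↔
    (∀ r : ℕ, p.count (.writeReal r) ≤ 1) ∧
    (∀ (l l' : List Access) (x : ℕ), p = l ++ .readDom x :: l' → x ∈ I ∨ .writeDom x ∈ l) ∧
    (∀ (l l' : List Access) (r : ℕ), p = l ++ .readReal r :: l' → .writeReal r ∈ l) := by
  rw [pathAllowed_iff]
  simp only [count_le_one_iff]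
  constructor
  · intro h
    refine ⟨fun r l a l' hp ha => ?_, fun l l' x hp => ?_, fun l l' r hp => ?_⟩
    · subst ha
      simpa [Access.allowed, Access.equivSum] using h _ _ _ hp
    · simpa [Access.allowed, Access.equivSum] using h _ _ _ hp
    · simpa [Access.allowed, Access.equivSum] using h _ _ _ hp
  · rintro ⟨h1, h2, h3⟩ l a l' hp
    cases a with
    | readDom x => simpa [Access.allowed, Access.equivSum] using h2 _ _ _ hp
    | writeDom x => rfl
    | readReal r => simpa [Access.allowed, Access.equivSum] using h3 _ _ _ hp
    | writeReal r => simpa [Access.allowed, Access.equivSum] using h1 r _ _ _ hp rfl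

theorem validProgram_iff (r : List ℚ × List ℕ × List ℕ × Stmt) :
    validProgram r = true ↔ ∃ P : Program, Encodable.encode r = P.code := by
  simp only [validProgram, increasing, Bool.and_eq_true, decide_eq_true_eq, List.all_eq_true,
    Bool.not_eq_true', decide_eq_false_iff_not, forall_pathAllowed_iff, Program.encode_eq_code_iff,
    encode_eq_setCode_rat_iff, encode_eq_setCode_nat_iff]
  constructor
  · rintro ⟨⟨⟨⟨⟨h1, h2⟩, h3⟩, h4⟩, h5⟩, h6⟩
    refine ⟨⟨r.1.toFinset, r.2.1.toFinset, r.2.2.1.toFinset, r.2.2.2, ?_, ?_, ?_, ?_, ?_⟩,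
      ⟨h1, ?_⟩, ⟨h2, ?_⟩, ⟨h3, ?_⟩, rfl⟩
    · rw [Finset.disjoint_left]
      intro x hx hx'
      exact h4 x (List.mem_toFinset.1 hx) (List.mem_toFinset.1 hx')
    · exact fun d hd => List.mem_toFinset.2 (h5 d hd)
    · exact fun p hp => (h6 p hp).1
    · intro p hp l l' x h
      rw [List.mem_toFinset]
      exact (h6 p hp).2.1 l l' x h
    · exact fun p hp => (h6 p hp).2.2
    · exact fun _ => List.mem_toFinset.symm
    · exact fun _ => List.mem_toFinset.symm
    · exact fun _ => List.mem_toFinset.symm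
  · rintro ⟨P, ⟨h1, h1'⟩, ⟨h2, h2'⟩, ⟨h3, h3'⟩, h4⟩
    rw [h4]
    refine ⟨⟨⟨⟨⟨h1, h2⟩, h3⟩, fun x hx hx' => ?_⟩, fun d hd => ?_⟩, fun p hp => ⟨?_, ?_, ?_⟩⟩
    · exact Finset.disjoint_left.1 P.disjoint ((h2' x).1 hx) ((h3' x).1 hx')
    · exact (h1' d).2 (P.consts_mem d hd)
    · exact P.assign_once p hp
    · intro l l' x h
      rw [h2']
      exact P.dom_defined p hp l l' x h
    · exact P.real_defined p hp

/-- Requiring that lookup return the listed value for each pair forces the list to be the graph of a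
function; the remaining tests fix its domain and range. -/
theorem validInput_iff {P : Program} {dom : List ℚ} {I : List ℕ}
    (hdom : ∀ d, d ∈ dom ↔ d ∈ P.dom) (hI : ∀ x, x ∈ I ↔ x ∈ P.inputs) (l : Asg) :
    validInput dom I l = true ↔ ∃ u : P.Input, Encodable.encode l = P.inputCode u := by
  simp only [validInput, increasing, Bool.and_eq_true, decide_eq_true_eq, List.all_eq_true]
  constructor
  · rintro ⟨⟨h1, h2⟩, h3⟩
    have hval : ∀ p ∈ l, asgVal l p.1 = p.2 := fun p hp => by
      rw [asgVal, (h2 p hp).2, Option.getD_some]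
    have hmem : ∀ x : {x // x ∈ P.inputs}, (x.1, asgVal l x.1) ∈ l := fun x => by
      obtain ⟨p, hp, hpx⟩ := List.mem_map.1 (h3 x.1 ((hI _).2 x.2))
      rw [← hpx, hval p hp]
      exact hp
    refine ⟨fun x => ⟨asgVal l x.1, (hdom _).1 (h2 _ (hmem x)).1.2⟩,
      Program.encode_eq_inputCode_iff.2 ⟨h1, fun p => ⟨fun hp => ?_, ?_⟩⟩⟩
    · exact ⟨⟨p.1, (hI _).1 (h2 p hp).1.1⟩, Prod.ext rfl (hval p hp)⟩
    · rintro ⟨x, rfl⟩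
      exact hmem x
  · rintro ⟨u, hu⟩
    have hl := Program.presents_of_encode_eq hu
    obtain ⟨h1, h2⟩ := Program.encode_eq_inputCode_iff.1 hu
    refine ⟨⟨h1, fun p hp => ?_⟩, fun x hx => ?_⟩
    · obtain ⟨x, rfl⟩ := (h2 p).1 hp
      refine ⟨⟨(hI _).2 x.2, (hdom _).2 (u x).2⟩, ?_⟩
      rw [hl x.1, dif_pos x.2]
    · exact List.mem_map.2 ⟨_, (h2 _).2 ⟨⟨x, (hI x).1 hx⟩, rfl⟩, rfl⟩

theorem validProblem_iff (r : RawProblem) :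
    validProblem r = true ↔ ∃ x : Problem, Encodable.encode r = x.code := by
  simp only [validProblem, Bool.and_eq_true, decide_eq_true_eq, validProgram_iff,
    List.all_eq_true, Problem.encode_eq_code_iff]
  constructor
  · rintro ⟨⟨⟨⟨⟨⟨⟨P, hP⟩, h2⟩, h3⟩, h4⟩, h5⟩, h6⟩, h7⟩
    classical
    obtain ⟨hdom, hI, -, -⟩ := (Program.encode_eq_code_iff _).1 hP
    rw [encode_eq_setCode_rat_iff] at hdom
    rw [encode_eq_setCode_nat_iff] at hI
    simp only [validInput_iff hdom.2 hI.2] at h3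
    -- The adjacency relation is recovered as the set of all pairs of inputs whose assignments occur
    -- in the list.
    refine ⟨⟨P, Finset.univ.filter fun i => (Program.inputAsg i.1, Program.inputAsg i.2) ∈ r.2.1,
      ⟨r.2.2.1, h4⟩, ⟨r.2.2.2.1, h5⟩, r.2.2.2.2, h6, h7⟩, hP, ?_, rfl, rfl, rfl⟩
    refine encode_eq_setCode_adj_iff.2 ⟨of_decide_eq_true h2, fun p => ?_⟩
    simp only [Finset.mem_filter, Finset.mem_univ, true_and]
    constructor
    · intro hp
      obtain ⟨⟨u, hu⟩, u', hu'⟩ := h3 p hp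
      rw [← Program.encode_inputAsg, Encodable.encode_inj] at hu hu'
      have hpu : (Program.inputAsg u, Program.inputAsg u') = p := by rw [← hu, ← hu']
      exact ⟨(u, u'), hpu ▸ hp, hpu⟩
    · rintro ⟨i, hi, rfl⟩
      exact hi
  · rintro ⟨x, hP, hadj, h1, h2, h3⟩
    obtain ⟨hdom, hI, -, -⟩ := (Program.encode_eq_code_iff _).1 hP
    rw [encode_eq_setCode_rat_iff] at hdom
    rw [encode_eq_setCode_nat_iff] at hI
    rw [encode_eq_setCode_adj_iff] at hadj
    rw [h1, h2, h3]
    refine ⟨⟨⟨⟨⟨⟨⟨_, hP⟩, decide_eq_true hadj.1⟩, fun p hp => ?_⟩, x.ε.2⟩, x.εprv.2⟩,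
      x.δ_nonneg⟩, x.δ_le_one⟩
    simp only [validInput_iff hdom.2 hI.2]
    obtain ⟨i, -, rfl⟩ := (hadj.2 p).1 hp
    exact ⟨⟨_, Program.encode_inputAsg _⟩, _, Program.encode_inputAsg _⟩

/-! ## The decision procedures -/

/-- At precision `m` the number `n` is recognized as the code of an instance that is not
differentially private. -/
def refuteCode (n m : ℕ) : Bool :=
  (Encodable.decode n : Option RawProblem).elim false fun r => decide (Encodable.encode r = n) &&
    (validProblem r && notDPQ r m)

/-- The verdict, if any, at precision `m` on the instance with code `n`. -/
def verdict (n m : ℕ) : Option Bool :=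
  (Encodable.decode n : Option RawProblem).bind fun r =>
    cond (notDPQ r m) (some false) (cond (isDPQ r m) (some true) none)

theorem primrec_refuteCode : Primrec₂ refuteCode := by
  have h0 : Primrec fun q : (ℕ × ℕ) × RawProblem => decide (Encodable.encode q.2 = q.1.1) :=
    primrec_decide_eq (Primrec.encode.comp Primrec.snd) (Primrec.fst.comp Primrec.fst)
  have h1 : Primrec fun q : (ℕ × ℕ) × RawProblem => validProblem q.2 && notDPQ q.2 q.1.2 := by
    fun_prop
  have h : Primrec fun p : ℕ × ℕ => (Encodable.decode p.1 : Option RawProblem).elim false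
    fun r => decide (Encodable.encode r = p.1) && (validProblem r && notDPQ r p.2) :=
    primrec_option_elim (primrec_decode Primrec.fst) (Primrec.const false)
      (Primrec.and.comp h0 h1)
  exact h

theorem primrec_verdict : Primrec₂ verdict := by
  have h : Primrec fun p : ℕ × ℕ => (Encodable.decode p.1 : Option RawProblem).bind fun r =>
    cond (notDPQ r p.2) (some false) (cond (isDPQ r p.2) (some true) none) := by fun_prop
  exact h

theorem exists_refuteCode_iff (n : ℕ) :
    (∃ m, refuteCode n m = true) ↔ ∃ x : Problem, x.code = n ∧ ¬ x.IsDP := by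
  constructor
  · rintro ⟨m, hm⟩
    unfold refuteCode at hm
    rcases hd : (Encodable.decode n : Option RawProblem) with _ | r
    · rw [hd] at hm
      exact absurd hm Bool.false_ne_true
    · rw [hd, Option.elim_some, Bool.and_eq_true, Bool.and_eq_true, decide_eq_true_eq,
        validProblem_iff] at hm
      obtain ⟨hn, ⟨x, hx⟩, hm⟩ := hm
      exact ⟨x, hx.symm.trans hn, (Problem.presents_of_encode_eq hx).exists_notDPQ_iff.1 ⟨m, hm⟩⟩
  · rintro ⟨x, rfl, hx⟩
    obtain ⟨r, hr⟩ := x.exists_encode_eq_code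
    obtain ⟨m, hm⟩ := (Problem.presents_of_encode_eq hr).exists_notDPQ_iff.2 hx
    refine ⟨m, ?_⟩
    rw [refuteCode, ← hr, Encodable.encodek, Option.elim_some, (validProblem_iff r).2 ⟨x, hr⟩, hm]
    simp

/-- The predicate is the domain of the unbounded search for m. -/
theorem rePred_exists {f : ℕ → ℕ → Bool} (hf : Primrec₂ f) :
    REPred fun n => ∃ m, f n m = true := by
  have h : Partrec fun n => Nat.rfind fun m => Part.some (f n m) :=
    Partrec.rfind hf.to_comp.partrec₂
  refine h.dom_re.of_eq fun n => ?_
  refine Nat.rfind_dom.trans ?_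
  constructor
  · rintro ⟨m, hm, -⟩
    exact ⟨m, (Part.mem_some_iff.1 hm).symm⟩
  · rintro ⟨m, hm⟩
    exact ⟨m, Part.mem_some_iff.2 hm.symm, fun _ => trivial⟩

/-- Both tests are conclusive at every precision. Validity of the code is not tested by `verdict`,
since the answer matters only on codes of instances. -/
theorem Problem.verdict_sound {x : Problem} {r : RawProblem}
    (hr : Encodable.encode r = x.code) {m : ℕ} {b : Bool} (h : verdict x.code m = some b) :
    b = true ↔ x.IsDP := by
  have hx := Problem.presents_of_encode_eq hr
  rw [verdict, ← hr, Encodable.encodek, Option.bind_some] at h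
  cases h1 : notDPQ r m
  · cases h2 : isDPQ r m
    · simp [h1, h2] at h
    · simp only [h1, h2, cond_false, cond_true, Option.some.injEq] at h
      simp [← h, hx.isDP_of_isDPQ h2]
  · simp only [h1, cond_true, Option.some.injEq] at h
    simpa [← h] using hx.exists_notDPQ_iff.1 ⟨m, h1⟩

theorem Problem.exists_verdict {x : Problem} {r : RawProblem}
    (hr : Encodable.encode r = x.code) (hδ : (x.δ : ℝ) ∉ x.crit) :
    ∃ m b, verdict x.code m = some b := by
  have hx := Problem.presents_of_encode_eq hr
  simp only [verdict, ← hr, Encodable.encodek, Option.bind_some]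
  by_cases hdp : x.IsDP
  · obtain ⟨m, hm⟩ := hx.exists_isDPQ hδ hdp
    refine ⟨m, ?_⟩
    -- Only halting is at stake here, so any verdict will do; its correctness is the content of
    -- `Problem.verdict_sound`.
    cases notDPQ r m
    · exact ⟨true, by simp [hm]⟩
    · exact ⟨false, rfl⟩
  · obtain ⟨m, hm⟩ := hx.exists_notDPQ_iff.2 hdp
    exact ⟨m, false, by simp [hm]⟩

end

end DiPGauss

theorem mainTheorem1 :
    -- the set of instances that are not differentially private is recursively enumerable
    REPred (fun n : ℕ => ∃ x : DiPGauss.Problem, x.code = n ∧ ¬ x.IsDP) ∧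
    -- there are only finitely many critical error parameters
    (∀ (P : DiPGauss.Program) (ε : DiPGauss.PosRat) (εprv : ℝ) (Φ : Finset (P.Input × P.Input)),
      (P.crit ε εprv Φ).Finite) ∧
    -- one algorithm answers correctly whenever it halts, and halts on every instance whose error
    -- parameter is not critical
    ∃ V : ℕ →. Bool, Partrec V ∧ ∀ x : DiPGauss.Problem,
      (∀ b ∈ V x.code, (b = true ↔ x.IsDP)) ∧
      ((x.δ : ℝ) ∉ x.crit → (V x.code).Dom) := by
  refine ⟨(DiPGauss.rePred_exists DiPGauss.primrec_refuteCode).of_eq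
    DiPGauss.exists_refuteCode_iff, DiPGauss.Program.finite_crit,
    -- The algorithm increases the precision until one of the two strict tests succeeds and returns
    -- that verdict.
    fun n => Nat.rfindOpt (DiPGauss.verdict n),
    Partrec.rfindOpt DiPGauss.primrec_verdict.to_comp, fun x => ?_⟩
  obtain ⟨r, hr⟩ := x.exists_encode_eq_code
  constructor
  · intro b hb
    obtain ⟨m, hm⟩ := Nat.rfindOpt_spec hb
    exact DiPGauss.Problem.verdict_sound hr hm
  · intro hδ
    exact Nat.rfindOpt_dom.2 (DiPGauss.Problem.exists_verdict hr hδ)
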